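/- Let $-1<a<0$ and $s=\frac{1-a}{2}\in(\tfrac12,1)$, let $\Omega=(-1,1)\times(0,1)$, and let $W^{1,2}(\Omega,y^a)$ be the closure of $C^\infty(\overline\Omega)$ with respect to the norm $\|u\|^2=\int_\Omega |u|^2y^a\,dx\,dy+\int_\Omega|\nabla u|^2y^a\,dx\,dy$ (real-valued functions). Put $$D_s:=\frac{d_s}{e_s},\qquad d_s:=\int_{\mathbb R}\frac{2-2\cos z}{|z|^{1+2s}}\,dz,\qquad e_s:=\inf_{\varphi}\int_0^\infty\big(\varphi'(t)^2+\varphi(t)^2\big)\,t^{a}\,dt,$$ where the infimum is over all $\varphi\in C([0,\infty))\cap C^1((0,\infty))$ with $\varphi(0)=1$ and $\lim_{t\to\infty}\varphi(t)=0$; this $D_s$ is the sharp constant of the corresponding trace inequality in the half-plane $\mathbb R\times(0,\infty)$ with weight $y^a$. Then every $u\in W^{1,2}(\Omega,y^a)$ has a well-defined trace $v$ on $(-1,1)\times\{0\}$: there is a function $v$ on $(-1,1)$, unique up to equality almost everywhere, such that $\varphi_n(\cdot,0)\to v$ in $L^2(-1,1)$ for every sequence $\varphi_n\in C^\infty(\overline\Omega)$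 with $\varphi_n\to u$ in $W^{1,2}(\Omega,y^a)$. Moreover $v\in H^s(-1,1)$, that is, $v \in L^2(-1,1)$ and the left-hand side below is finite, and $$\iint_{(-1,1)^2}\frac{|v(x)-v(x')|^2}{|x-x'|^{1+2s}}\,dx\,dx'\le D_s\int_\Omega|\nabla u|^2\,y^a\,dx\,dy .$$ -/

import Mathlib

open MeasureTheory Set Filter Topology
open scoped ENNReal ContDiff

noncomputable section

namespace TraceIneq

/-- The open rectangle `Ω = (-1, 1) × (0, 1)`. -/
def Omega : Set (ℝ × ℝ) := Ioo (-1) 1 ×ˢ Ioo 0 1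

/-- The closed rectangle, i.e. the closure of `Ω`. -/
def OmegaBar : Set (ℝ × ℝ) := Icc (-1) 1 ×ˢ Icc 0 1

theorem closure_Omega : closure Omega = OmegaBar := by
  unfold Omega OmegaBar
  rw [closure_prod_eq, closure_Ioo (by norm_num), closure_Ioo (by norm_num)]

/-- The squared weighted `L²` norm `∫_Ω |u|² y^a`. -/
def sqMass (a : ℝ) (u : ℝ × ℝ → ℝ) : ℝ≥0∞ :=
  ∫⁻ p in Omega, ENNReal.ofReal (u p ^ 2 * p.2 ^ a)

/-- The weighted Dirichlet energy `∫_Ω |G|² y^a` of a vector field `G` (a gradient), with the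
Euclidean norm of `G`. -/
def energy (a : ℝ) (G : ℝ × ℝ → ℝ × ℝ) : ℝ≥0∞ :=
  ∫⁻ p in Omega, ENNReal.ofReal (((G p).1 ^ 2 + (G p).2 ^ 2) * p.2 ^ a)

/-- The classical gradient `(∂φ/∂x, ∂φ/∂y)`. -/
def grad (φ : ℝ × ℝ → ℝ) (p : ℝ × ℝ) : ℝ × ℝ :=
  (fderiv ℝ φ p (1, 0), fderiv ℝ φ p (0, 1))

/-- `φ ∈ C^∞(Ω̄)`: all derivatives of `φ` in `Ω` extend continuously to the closed rectangle. -/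
def SmoothUpToBoundary (φ : ℝ × ℝ → ℝ) : Prop := ContDiffOn ℝ ∞ φ OmegaBar

/-- `G` is the weak (distributional) gradient of `u` in `Ω`. -/
def IsWeakGradient (u : ℝ × ℝ → ℝ) (G : ℝ × ℝ → ℝ × ℝ) : Prop :=
  ∀ ψ : ℝ × ℝ → ℝ, ContDiff ℝ ∞ ψ → HasCompactSupport ψ → tsupport ψ ⊆ Omega →
    (∫ p in Omega, u p * (grad ψ p).1 = - ∫ p in Omega, (G p).1 * ψ p) ∧
    (∫ p in Omega, u p * (grad ψ p).2 = - ∫ p in Omega, (G p).2 * ψ p)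

/-- The functions `φ n` converge to `u`, with gradient `G`, in the norm
`(∫_Ω |u|² y^a + ∫_Ω |∇u|² y^a)^{1/2}` of `W^{1,2}(Ω, y^a)`. -/
def ConvergesInW (a : ℝ) (φ : ℕ → ℝ × ℝ → ℝ) (u : ℝ × ℝ → ℝ) (G : ℝ × ℝ → ℝ × ℝ) : Prop :=
  Tendsto (fun n => sqMass a (fun p => φ n p - u p) + energy a (fun p => grad (φ n) p - G p))
    atTop (𝓝 0)

/-- `u ∈ W^{1,2}(Ω, y^a)`, with weak gradient `G`. The space is the closure of `C^∞(Ω̄)` for the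
norm `(∫_Ω |u|² y^a + ∫_Ω |∇u|² y^a)^{1/2}`. -/
structure MemW (a : ℝ) (u : ℝ × ℝ → ℝ) (G : ℝ × ℝ → ℝ × ℝ) : Prop where
  aestronglyMeasurable : AEStronglyMeasurable u (volume.restrict Omega)
  aestronglyMeasurable_grad : AEStronglyMeasurable G (volume.restrict Omega)
  sqMass_lt_top : sqMass a u < ⊤
  energy_lt_top : energy a G < ⊤
  isWeakGradient : IsWeakGradient u G
  approx : ∃ φ : ℕ → ℝ × ℝ → ℝ, (∀ n, SmoothUpToBoundary (φ n)) ∧ ConvergesInW a φ u G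

/-- The open interval `(-1, 1)`, identified with the bottom side `(-1, 1) × {0}` of `Ω`. -/
def base : Set ℝ := Ioo (-1) 1

/-- The squared Gagliardo seminorm `∫∫_{(-1,1)²} |v(x) - v(x')|² / |x - x'|^{1+2s} dx dx'`. -/
def gagliardo (s : ℝ) (v : ℝ → ℝ) : ℝ≥0∞ :=
  ∫⁻ q in base ×ˢ base, ENNReal.ofReal ((v q.1 - v q.2) ^ 2 / |q.1 - q.2| ^ (1 + 2 * s))

/-- The squared `L²(-1, 1)` norm. -/
def sqNormBase (v : ℝ → ℝ) : ℝ≥0∞ := ∫⁻ x in base, ENNReal.ofReal (v x ^ 2)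

/-- `v ∈ H^s(-1, 1)`: the squared norm `‖v‖²_{L²} + (Gagliardo seminorm)²` is finite. -/
def MemHs (s : ℝ) (v : ℝ → ℝ) : Prop :=
  AEStronglyMeasurable v (volume.restrict base) ∧ sqNormBase v + gagliardo s v < ⊤

/-- `v` is the trace on `(-1, 1) × {0}` of the element `u` (with gradient `G`) of
`W^{1,2}(Ω, y^a)`: the trace is the continuous extension of the restriction map
`φ ↦ φ(·, 0)` on `C^∞(Ω̄)`, so for *every* sequence of functions in `C^∞(Ω̄)` that converges to `u`
in `W^{1,2}(Ω, y^a)`, the restrictions to the bottom side converge to `v` in `L²(-1, 1)`. -/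
def IsTrace (a : ℝ) (u : ℝ × ℝ → ℝ) (G : ℝ × ℝ → ℝ × ℝ) (v : ℝ → ℝ) : Prop :=
  AEStronglyMeasurable v (volume.restrict base) ∧
  ∀ φ : ℕ → ℝ × ℝ → ℝ, (∀ n, SmoothUpToBoundary (φ n)) → ConvergesInW a φ u G →
    Tendsto (fun n => sqNormBase (fun x => φ n (x, 0) - v x)) atTop (𝓝 0)

/-- `d_s = ∫_ℝ (2 - 2 cos z) / |z|^{1+2s} dz`. -/
def dConst (s : ℝ) : ℝ≥0∞ :=
  ∫⁻ z : ℝ, ENNReal.ofReal ((2 - 2 * Real.cos z) / |z| ^ (1 + 2 * s))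

/-- Profiles `φ : [0, ∞) → ℝ` with `φ(0) = 1` and `φ(t) → 0` as `t → ∞`. -/
structure IsProfile (φ : ℝ → ℝ) : Prop where
  continuousOn : ContinuousOn φ (Ici 0)
  contDiffOn : ContDiffOn ℝ 1 φ (Ioi 0)
  at_zero : φ 0 = 1
  at_infinity : Tendsto φ atTop (𝓝 0)

/-- The one-dimensional functional `∫_0^∞ (φ'(t)² + φ(t)²) t^a dt`. -/
def profileEnergy (a : ℝ) (φ : ℝ → ℝ) : ℝ≥0∞ :=
  ∫⁻ t in Ioi (0 : ℝ), ENNReal.ofReal ((deriv φ t ^ 2 + φ t ^ 2) * t ^ a)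

/-- The least value of the one-dimensional functional over all profiles, for `a = 1 - 2 s`.
The minimizer is the multiple of `t^s K_s(t)` with value `1` at `0`. This constant is the factor
between the least weighted Dirichlet energy in the half-plane of the extensions of `v` and
`∫ |ξ|^{2s} |v̂(ξ)|² dξ`, for the unitary Fourier transform with kernel `e^{-i x ξ} / √(2π)`. -/
def eConst (s : ℝ) : ℝ≥0∞ :=
  ⨅ (φ : ℝ → ℝ) (_ : IsProfile φ), profileEnergy (1 - 2 * s) φ

/-- The sharp trace constant `D_s = d_s / e_s` of the half-plane `ℝ × (0, ∞)`. -/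
def DConst (s : ℝ) : ℝ≥0∞ := dConst s / eConst s

end TraceIneq

end

/-!
The trace inequality is first proved for `φ` smooth up to the boundary, with trace `v = φ(·, 0)`,
by comparing both sides mode by mode in the cosine basis `cos (w_k (x + 1))`, `w_k = k π / 2`, of
`(-1, 1)`. Write `a_k` for the cosine coefficients of `v`.

*The seminorm from above* (`gagliardo_add_le`). Extend `v` to a `4`-periodic function on `ℝ` by
reflection at the end points. The Gagliardo energy of the extension over one period is, by
Parseval's identity, a multiple of `d_s ∑ w_k^{2s} a_k²`. It contains the seminorm of `v` itself
and, in addition, the interaction of each point with the mirror images of all others. Convexity of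
the kernel bounds the latter below by a multiple of `∬ (v(x) - v(y))² dx dy`, i.e. of `∑ a_k²`.
Altogether `[v]² + 2^{2-2s} ∑_{k ≥ 1} a_k² ≤ d_s ∑_{k ≥ 1} w_k^{2s} a_k²`.

*The Dirichlet energy from below* (`tsum_mode_energy_le`). Bessel's inequality on horizontal lines
bounds the Dirichlet energy below by the sum over `k` of the one-dimensional energies
`∫_0^1 (f_k'² + w_k² f_k²) y^a dy` of the cosine coefficients `f_k(y)` of `φ(·, y)`. On the whole
half-line, scaling would give the lower bound `e_s w_k^{2s} a_k²` for each of them. The rectangle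
has height `1`, so that something is lost: `mode_inequality` says that at most `e_s s (1 - s) a_k²`
is lost. Since `d_s ≤ 2^{2-2s} / (s (1 - s))` (`dConst_le`), the gain from the mirror images pays
for this loss, and `gagliardo_le_of_smooth` follows.

*The loss by truncation.* A function `f` on `(0, R)`, `R = w_k`, is turned into a competitor for
`e_s` by subtracting a multiple of the growing solution `h` of the Euler-Lagrange equation (a
multiple of `t^s I_s(t)`, here a power series) and continuing as a multiple of `e^{-t}` beyond `R`
(`eConst_le_of_glue`, `eConst_le_energy_add`). The cost is an explicit function of `h`,
exponentially small in `R`, and it is compared with `e_s` through the lower bound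
`ofReal_le_eConst`, which comes from a calibration by a solution of a Riccati inequality. The smallest frequency is
`π / 2 > 3 / 2`, and from `R = 3 / 2` on the cost is small enough (`truncation_le`).

*General `u`.* The elementary estimate `sqNormBase_le_of_smooth` makes restriction to the bottom
side continuous from `W^{1,2}(Ω, y^a)` to `L²(-1, 1)`, so that traces exist by completeness and
are unique. The inequality passes to the limit by Fatou's lemma.
-/

open MeasureTheory Set Filter Topology
open scoped ENNReal ContDiff

noncomputable section

namespace TraceIneq

/-! ### Convergent series for the Bessel profile -/

section BesselSeries

/-- Termwise differentiation of an even power series whose coefficients are at most `1 / n!`. -/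
theorem hasDerivAt_evenSeries {c : ℕ → ℝ} (hc : ∀ n, |c n| ≤ 1 / (n.factorial : ℝ)) (t : ℝ) :
    Summable (fun n => c n * t ^ (2 * n)) ∧
    Summable (fun n => c n * ((2 * n : ℕ) * t ^ (2 * n - 1))) ∧
    HasDerivAt (fun x => ∑' n, c n * x ^ (2 * n))
      (∑' n, c n * ((2 * n : ℕ) * t ^ (2 * n - 1))) t := by
  -- the derivatives are dominated on the ball of radius `|t| + 1`
  set ρ : ℝ := |t| + 1 with hρ
  have hρ1 : 1 ≤ ρ := by have := abs_nonneg t; linarith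
  have hsum : Summable (fun n : ℕ => 2 * ((2 * ρ ^ 2) ^ n / (n.factorial : ℝ))) :=
    (Real.summable_pow_div_factorial _).mul_left 2
  have hn2 : ∀ n : ℕ, (n : ℝ) ≤ 2 ^ n := fun n => by
    exact_mod_cast (Nat.lt_two_pow_self (n := n)).le
  have hbound : ∀ n : ℕ, ∀ y : ℝ, |y| ≤ ρ →
      ‖c n * ((2 * n : ℕ) * y ^ (2 * n - 1))‖ ≤ 2 * ((2 * ρ ^ 2) ^ n / (n.factorial : ℝ)) := by
    intro n y hy
    rw [Real.norm_eq_abs, abs_mul, abs_mul, abs_pow]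
    have h1 : |y| ^ (2 * n - 1) ≤ ρ ^ (2 * n) :=
      (pow_le_pow_left₀ (abs_nonneg _) hy _).trans (pow_le_pow_right₀ hρ1 (by omega))
    have h2 : |((2 * n : ℕ) : ℝ)| ≤ 2 * 2 ^ n := by
      rw [abs_of_nonneg (by positivity)]; push_cast; linarith [hn2 n]
    calc |c n| * (|((2 * n : ℕ) : ℝ)| * |y| ^ (2 * n - 1))
        ≤ 1 / (n.factorial : ℝ) * ((2 * 2 ^ n) * ρ ^ (2 * n)) := by
          gcongr; exact hc n
      _ = 2 * ((2 * ρ ^ 2) ^ n / (n.factorial : ℝ)) := by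
          rw [mul_pow, ← pow_mul]; ring
  have hs0 : Summable (fun n => c n * t ^ (2 * n)) := by
    refine Summable.of_norm_bounded (Real.summable_pow_div_factorial (t ^ 2)) fun n => ?_
    rw [Real.norm_eq_abs, abs_mul, pow_mul, abs_of_nonneg (by positivity : 0 ≤ (t ^ 2) ^ n)]
    calc |c n| * (t ^ 2) ^ n ≤ 1 / (n.factorial : ℝ) * (t ^ 2) ^ n := by
          gcongr; exact hc n
      _ = _ := by ring
  refine ⟨hs0, Summable.of_norm_bounded hsum fun n => hbound n t (by linarith), ?_⟩
  refine hasDerivAt_tsum_of_isPreconnected (g := fun n x => c n * x ^ (2 * n))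
    (g' := fun n x => c n * ((2 * n : ℕ) * x ^ (2 * n - 1)))
    (t := Metric.ball (0:ℝ) ρ) (y₀ := t) hsum Metric.isOpen_ball
    (convex_ball (0:ℝ) ρ).isPreconnected (fun n y _ => ?_) (fun n y hy => ?_) ?_ hs0 ?_
  · simpa using (hasDerivAt_pow (2 * n) y).const_mul (c n)
  · exact hbound n y (by simpa using (Metric.mem_ball.1 hy).le)
  · simp [hρ]
  · simp [hρ]

/-- Coefficients of the even entire series
`Γ(s+1) (2/t)^s I_s(t) = ∑ n, besselCoeff s n * t^(2n)`, with `I_s` the modified Bessel function. -/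
def besselCoeff (s : ℝ) : ℕ → ℝ
  | 0 => 1
  | n + 1 => besselCoeff s n / (4 * (n + 1) * (n + 1 + s))

theorem besselCoeff_pos {s : ℝ} (hs : 0 < s) (n : ℕ) : 0 < besselCoeff s n := by
  induction n with
  | zero => simp [besselCoeff]
  | succ n ih => rw [besselCoeff]; positivity

/-- The coefficients of `growingFlux`, and hence those of `besselSeries`, are at most `1 / n!`. -/
theorem besselCoeff_le {s : ℝ} (hs : 1 / 2 < s) (n : ℕ) :
    besselCoeff s n * (1 + n / s) ≤ 1 / (n.factorial : ℝ) := by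
  have hs0 : 0 < s := by linarith
  have key : besselCoeff s n ≤ 1 / (4 ^ n * (n.factorial : ℝ)) := by
    induction n with
    | zero => simp [besselCoeff]
    | succ n ih =>
      rw [besselCoeff]
      have h1 : (4:ℝ) * (n + 1) ≤ 4 * (n + 1) * (n + 1 + s) := by
        have : (0:ℝ) ≤ n := by positivity
        nlinarith
      calc besselCoeff s n / (4 * (n + 1) * (n + 1 + s))
          ≤ (1 / (4 ^ n * (n.factorial : ℝ))) / (4 * (n + 1)) := by
            gcongr
        _ = _ := by rw [Nat.factorial_succ, pow_succ]; push_cast; field_simp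
  have h3 : (1 + n / s : ℝ) ≤ 4 ^ n := by
    have hb := one_add_mul_le_pow (a := (3:ℝ)) (by norm_num) n
    have : (n / s : ℝ) ≤ n * 3 := by
      rw [div_le_iff₀ hs0]
      have : (0:ℝ) ≤ n := by positivity
      nlinarith
    norm_num at hb; linarith
  calc besselCoeff s n * (1 + n / s) ≤ (1 / (4 ^ n * (n.factorial : ℝ))) * 4 ^ n := by
        gcongr
    _ = _ := by field_simp

/-- The even series `∑ n, besselCoeff s n * t^(2n)`. -/
def besselSeries (s t : ℝ) : ℝ := ∑' n, besselCoeff s n * t ^ (2 * n)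

/-- The solution `h` of `(h' t^(1-2s))' = h t^(1-2s)` with `h(0) = 0` whose flux
`h' t^(1-2s)` is `1` at `0`. It is a multiple of `t^s I_s(t)`. -/
def growing (s t : ℝ) : ℝ := t ^ (2 * s) * (besselSeries s t / (2 * s))

/-- The flux `h' t^(1-2s)` of `growing s`. -/
def growingFlux (s t : ℝ) : ℝ := ∑' n, (besselCoeff s n * (1 + n / s)) * t ^ (2 * n)

variable {s : ℝ}

theorem besselCoeff_abs_le (hs : 1 / 2 < s) (n : ℕ) :
    |besselCoeff s n| ≤ 1 / (n.factorial : ℝ) := by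
  have h := besselCoeff_pos (s := s) (by linarith) n
  rw [abs_of_pos h]
  refine le_trans ?_ (besselCoeff_le hs n)
  have : (0:ℝ) ≤ n / s := by have : 0 < s := by linarith
                             positivity
  nlinarith

theorem fluxCoeff_abs_le (hs : 1 / 2 < s) (n : ℕ) :
    |besselCoeff s n * (1 + n / s)| ≤ 1 / (n.factorial : ℝ) := by
  have h := besselCoeff_pos (s := s) (by linarith) n
  rw [abs_of_pos (by positivity)]
  exact besselCoeff_le hs n

theorem hasDerivAt_growingFlux (hs : 1 / 2 < s) (t : ℝ) :
    HasDerivAt (growingFlux s) (t * besselSeries s t / (2 * s)) t := by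
  obtain ⟨-, h1, h2⟩ := hasDerivAt_evenSeries (fluxCoeff_abs_le hs) t
  have : ∑' n, (besselCoeff s n * (1 + n / s)) * ((2 * n : ℕ) * t ^ (2 * n - 1))
      = t * besselSeries s t / (2 * s) := by
    rw [h1.tsum_eq_zero_add, besselSeries, ← tsum_mul_left, ← tsum_div_const]
    simp only [Nat.cast_zero, zero_mul, mul_zero, zero_add]
    refine tsum_congr fun n => ?_
    rw [besselCoeff, show 2 * (n + 1) - 1 = 2 * n + 1 by omega, pow_succ]
    have : (n : ℝ) + 1 + s ≠ 0 := by positivity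
    push_cast
    field_simp
    ring
  rw [this] at h2
  exact h2

theorem hasDerivAt_growing (hs : 1 / 2 < s) {t : ℝ} (ht : 0 < t) :
    HasDerivAt (growing s) (t ^ (2 * s - 1) * growingFlux s t) t := by
  obtain ⟨h0, h1, h2⟩ := hasDerivAt_evenSeries (besselCoeff_abs_le hs) t
  have h3 := (Real.hasDerivAt_rpow_const (p := 2 * s) (Or.inl ht.ne')).mul (h2.div_const (2 * s))
  refine HasDerivAt.congr_deriv (f := growing s) h3 ?_
  rw [growingFlux]
  have : ∑' n, besselCoeff s n * (1 + n / s) * t ^ (2 * n) =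
      (∑' n, besselCoeff s n * t ^ (2 * n)) +
        t / (2 * s) * ∑' n, besselCoeff s n * ((2 * n : ℕ) * t ^ (2 * n - 1)) := by
    rw [← tsum_mul_left, ← h0.tsum_add (h1.mul_left _)]
    refine tsum_congr fun n => ?_
    rcases n with _ | n
    · simp
    · rw [show 2 * (n + 1) - 1 = 2 * n + 1 by omega, show 2 * (n + 1) = 2 * n + 1 + 1 by ring,
        pow_succ t (2 * n + 1)]
      push_cast
      field_simp
      ring
  rw [this, show t ^ (2 * s) = t ^ (2 * s - 1) * t by
    rw [← Real.rpow_add_one ht.ne']; congr 1; ring]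
  field_simp

theorem continuous_besselSeries (hs : 1 / 2 < s) : Continuous (besselSeries s) :=
  continuous_iff_continuousAt.2 fun t =>
    (hasDerivAt_evenSeries (besselCoeff_abs_le hs) t).2.2.continuousAt

theorem continuous_growingFlux (hs : 1 / 2 < s) : Continuous (growingFlux s) :=
  continuous_iff_continuousAt.2 fun t => (hasDerivAt_growingFlux hs t).continuousAt

theorem continuous_growing (hs : 1 / 2 < s) : Continuous (growing s) :=
  (Real.continuous_rpow_const (by linarith)).mul ((continuous_besselSeries hs).div_const _)

theorem growing_zero (hs : 1 / 2 < s) : growing s 0 = 0 := by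
  rw [growing, Real.zero_rpow (by linarith), zero_mul]

theorem growingFlux_zero : growingFlux s 0 = 1 := by
  rw [growingFlux, tsum_eq_single 0 (fun n hn => by simp [hn])]
  simp [besselCoeff]

/-- The quantity `h t^(1-2s)`, which is the derivative of the flux by `hasDerivAt_growingFlux`. -/
theorem growing_mul_rpow {t : ℝ} (ht : 0 < t) :
    growing s t * t ^ (1 - 2 * s) = t * besselSeries s t / (2 * s) := by
  rw [growing]
  have : t ^ (2 * s) * t ^ (1 - 2 * s) = t := by
    rw [← Real.rpow_add ht]; simp
  linear_combination (besselSeries s t / (2 * s)) * this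

/-- The first two terms of the series. -/
theorem le_besselSeries (hs : 1 / 2 < s) (t : ℝ) :
    1 + t ^ 2 / (4 * (1 + s)) ≤ besselSeries s t := by
  obtain ⟨h0, -, -⟩ := hasDerivAt_evenSeries (besselCoeff_abs_le hs) t
  have hs0 : 0 < s := by linarith
  have := h0.sum_le_tsum (Finset.range 2) fun n _ => by
    have := besselCoeff_pos hs0 n
    rw [pow_mul]; positivity
  refine le_trans (le_of_eq ?_) this
  simp [Finset.sum_range_succ, besselCoeff]
  field_simp

/-- The first three terms of the series. -/
theorem le_growingFlux (hs : 1 / 2 < s) (t : ℝ) :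
    1 + t ^ 2 / (4 * s) + t ^ 4 / (32 * s * (1 + s)) ≤ growingFlux s t := by
  obtain ⟨h0, -, -⟩ := hasDerivAt_evenSeries (fluxCoeff_abs_le hs) t
  have hs0 : 0 < s := by linarith
  have := h0.sum_le_tsum (Finset.range 3) fun n _ => by
    have := besselCoeff_pos hs0 n
    rw [pow_mul]; positivity
  refine le_trans (le_of_eq ?_) this
  simp [Finset.sum_range_succ, besselCoeff]
  field_simp
  ring

end BesselSeries

/-! ### Calibration: lower bounds for the one-dimensional functional -/

/-- A one-sided fundamental theorem of calculus, in which the integral may be infinite. -/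
theorem ofReal_sub_le_lintegral_of_deriv_le {W W' g : ℝ → ℝ} {R : ℝ} (hR : 0 ≤ R)
    (hW : ContinuousOn W (Icc 0 R)) (hW' : ∀ t ∈ Ioo 0 R, HasDerivAt W (W' t) t)
    (hg : AEStronglyMeasurable g (volume.restrict (Ioo 0 R))) (hg0 : ∀ t ∈ Ioo 0 R, 0 ≤ g t)
    (hle : ∀ t ∈ Ioo 0 R, W' t ≤ g t) :
    ENNReal.ofReal (W R - W 0) ≤ ∫⁻ t in Ioo 0 R, ENNReal.ofReal (g t) := by
  by_cases htop : ∫⁻ t in Ioo 0 R, ENNReal.ofReal (g t) = ⊤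
  · rw [htop]; exact le_top
  have hnn : 0 ≤ᵐ[volume.restrict (Ioo 0 R)] g :=
    (ae_restrict_mem measurableSet_Ioo).mono hg0
  have hint : IntegrableOn g (Ioo 0 R) :=
    ⟨hg, (hasFiniteIntegral_iff_ofReal hnn).2 (lt_top_iff_ne_top.2 htop)⟩
  rw [← ofReal_integral_eq_lintegral_ofReal hint hnn]
  refine ENNReal.ofReal_le_ofReal ?_
  have := intervalIntegral.sub_le_integral_of_hasDeriv_right_of_le hR hW
    (fun t ht => (hW' t ht).hasDerivWithinAt) (((integrableOn_Icc_iff_integrableOn_Ioo).2 hint)) hle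
  rwa [intervalIntegral.integral_of_le hR, integral_Ioc_eq_integral_Ioo] at this

/-- The solution `(1 - t^b)/b` of the Riccati inequality without its quadratic term. -/
def riccatiUpper (b t : ℝ) : ℝ := (1 - t ^ b) / b

/-- A solution on `[0, 1]` of the Riccati inequality `q' ≥ q² t^(1-b) - t^(b-1)` with `q(1) = 0`,
obtained from `riccatiUpper` by one step of Picard iteration. -/
def riccati (b t : ℝ) : ℝ :=
  (1 - t ^ b) / b - (1 / b ^ 2) * ((1 / (2 - b) - 1 + 1 / (2 + b)) -
    (t ^ (2 - b) / (2 - b) - t ^ 2 + t ^ (2 + b) / (2 + b)))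

theorem riccati_zero {b : ℝ} (hb : 0 < b) (hb1 : b < 1) :
    riccati b 0 = 1 / b - 1 / (4 - b ^ 2) := by
  have h2 : (2 - b) ≠ 0 := by linarith
  have h3 : (2 + b) ≠ 0 := by linarith
  rw [riccati, Real.zero_rpow hb.ne', Real.zero_rpow h2, Real.zero_rpow h3]
  rw [show 4 - b ^ 2 = (2 - b) * (2 + b) by ring]
  field_simp
  ring

theorem riccati_one (b : ℝ) : riccati b 1 = 0 := by
  simp [riccati]

theorem continuous_riccati {b : ℝ} (hb : 0 < b) (hb1 : b < 1) : Continuous (riccati b) := by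
  have h1 : Continuous fun t : ℝ => t ^ b := Real.continuous_rpow_const hb.le
  have h2 : Continuous fun t : ℝ => t ^ (2 - b) := Real.continuous_rpow_const (by linarith)
  have h3 : Continuous fun t : ℝ => t ^ (2 + b) := Real.continuous_rpow_const (by linarith)
  unfold riccati
  fun_prop

theorem hasDerivAt_riccati {b : ℝ} (hb : 0 < b) (hb1 : b < 1) {t : ℝ} (ht : 0 < t) :
    HasDerivAt (riccati b) (riccatiUpper b t ^ 2 * t ^ (1 - b) - t ^ (b - 1)) t := by
  have h1 := Real.hasDerivAt_rpow_const (x := t) (p := b) (Or.inl ht.ne')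
  have h2 := Real.hasDerivAt_rpow_const (x := t) (p := 2 - b) (Or.inl ht.ne')
  have h3 := Real.hasDerivAt_rpow_const (x := t) (p := 2 + b) (Or.inl ht.ne')
  have h4 := ((h1.const_sub 1).div_const b).sub
    (((((h2.div_const (2 - b)).sub (hasDerivAt_pow 2 t)).add (h3.div_const (2 + b))).const_sub
      (1 / (2 - b) - 1 + 1 / (2 + b))).const_mul (1 / b ^ 2))
  refine HasDerivAt.congr_deriv (f := riccati b) h4 ?_
  have e1 : t ^ (2 - b - 1) = t ^ (1 - b) := by congr 1; ring
  have e2 : t ^ (2 + b - 1) = t ^ (1 - b) * (t ^ b * t ^ b) := by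
    rw [← Real.rpow_add ht, ← Real.rpow_add ht]; congr 1; ring
  have e3 : t = t ^ (1 - b) * t ^ b := by
    rw [← Real.rpow_add ht]; simp
  have h2 : (2 - b) ≠ 0 := by linarith
  have h3 : (2 + b) ≠ 0 := by linarith
  rw [e1, e2, riccatiUpper]
  field_simp
  norm_num
  linear_combination (-2 : ℝ) * e3

theorem riccatiUpper_mul_rpow_le {b : ℝ} (hb : 0 < b) (hb1 : b < 1) {t : ℝ} (ht : 0 < t) :
    riccatiUpper b t * t ^ (1 - b) ≤ 1 := by
  have e3 : t ^ (1 - b) * t ^ b = t := by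
    rw [← Real.rpow_add ht]; simp
  have hAG := Real.geom_mean_le_arith_mean2_weighted (w₁ := 1 - b) (w₂ := b) (p₁ := t) (p₂ := 1)
    (by linarith) hb.le ht.le zero_le_one (by ring)
  rw [Real.one_rpow, mul_one, mul_one] at hAG
  rw [riccatiUpper, div_mul_eq_mul_div, div_le_one hb]
  nlinarith

/-- One step of the iteration stays between zero and `riccatiUpper`; this is what makes `riccati`
a solution of the Riccati inequality. -/
theorem riccati_bounds {b : ℝ} (hb : 0 < b) (hb1 : b < 1) {t : ℝ} (ht : t ∈ Ioo (0:ℝ) 1) :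
    0 ≤ riccati b t ∧ riccati b t ≤ riccatiUpper b t := by
  have hcont := continuous_riccati hb hb1
  have hup : ∀ x ∈ Ioo (0:ℝ) 1, 0 ≤ riccatiUpper b x := fun x hx =>
    div_nonneg (by have := Real.rpow_le_one hx.1.le hx.2.le hb.le; linarith) hb.le
  constructor
  · have hanti : AntitoneOn (riccati b) (Icc 0 1) := by
      refine antitoneOn_of_deriv_nonpos (convex_Icc 0 1) hcont.continuousOn ?_ ?_
      · intro x hx; rw [interior_Icc] at hx
        exact (hasDerivAt_riccati hb hb1 hx.1).differentiableAt.differentiableWithinAt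
      · intro x hx; rw [interior_Icc] at hx
        rw [(hasDerivAt_riccati hb hb1 hx.1).deriv]
        have h1 := riccatiUpper_mul_rpow_le hb hb1 hx.1
        have h3 : x ^ (1 - b) * x ^ (b - 1) = 1 := by
          rw [← Real.rpow_add hx.1]; simp
        have h4 : 0 < x ^ (b - 1) := Real.rpow_pos_of_pos hx.1 _
        have h5 : 0 ≤ riccatiUpper b x * x ^ (1 - b) :=
          mul_nonneg (hup x hx) (Real.rpow_nonneg hx.1.le _)
        have h6 : riccatiUpper b x ^ 2 * x ^ (1 - b) =
            (riccatiUpper b x * x ^ (1 - b)) ^ 2 * x ^ (b - 1) := by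
          linear_combination (-riccatiUpper b x ^ 2 * x ^ (1 - b)) * h3
        rw [h6]
        have : (riccatiUpper b x * x ^ (1 - b)) ^ 2 ≤ 1 := by nlinarith
        nlinarith
    have := hanti (Ioo_subset_Icc_self ht) (right_mem_Icc.2 zero_le_one) ht.2.le
    rwa [riccati_one] at this
  · have hanti : MonotoneOn (fun x => riccati b x - riccatiUpper b x) (Icc 0 1) := by
      have hder : ∀ x ∈ Ioo (0:ℝ) 1, HasDerivAt (fun x => riccati b x - riccatiUpper b x)
          (riccatiUpper b x ^ 2 * x ^ (1 - b)) x := by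
        intro x hx
        have h1 := Real.hasDerivAt_rpow_const (x := x) (p := b) (Or.inl hx.1.ne')
        refine HasDerivAt.congr_deriv ((hasDerivAt_riccati hb hb1 hx.1).sub
          ((h1.const_sub 1).div_const b)) ?_
        field_simp
        ring
      refine monotoneOn_of_deriv_nonneg (convex_Icc 0 1) ?_ ?_ ?_
      · have h1 : Continuous fun t : ℝ => t ^ b := Real.continuous_rpow_const hb.le
        refine (hcont.sub ?_).continuousOn
        unfold riccatiUpper
        fun_prop
      · intro x hx; rw [interior_Icc] at hx
        exact (hder x hx).differentiableAt.differentiableWithinAt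
      · intro x hx; rw [interior_Icc] at hx
        rw [(hder x hx).deriv]
        exact mul_nonneg (sq_nonneg _) (Real.rpow_nonneg hx.1.le _)
    have := hanti (Ioo_subset_Icc_self ht) (right_mem_Icc.2 zero_le_one) ht.2.le
    simp only [riccati_one, riccatiUpper, Real.one_rpow] at this
    simp only [riccatiUpper]
    norm_num at this
    exact this

/-- A lower bound for `e_s`. For a profile `φ` and a solution `q` of the Riccati inequality, the
integrand is at least `-(q φ²)'` by completing the square, and the integral of the latter over
`(0, 1)` is `q(0)`. -/
theorem ofReal_le_eConst {s : ℝ} (hs : 1 / 2 < s) (hs1 : s < 1) :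
    ENNReal.ofReal (1 / (2 - 2 * s) - 1 / (4 - (2 - 2 * s) ^ 2)) ≤ eConst s := by
  have hb : 0 < 2 - 2 * s := by linarith
  have hb1 : 2 - 2 * s < 1 := by linarith
  refine le_iInf₂ fun φ hφ => ?_
  set b := 2 - 2 * s with hbdef
  have hd : ∀ t ∈ Ioo (0:ℝ) 1, HasDerivAt φ (deriv φ t) t := fun t ht =>
    ((hφ.contDiffOn.differentiableOn (by norm_num)).differentiableAt
      (Ioi_mem_nhds ht.1)).hasDerivAt
  have hcont : ContinuousOn φ (Icc 0 1) := hφ.continuousOn.mono Icc_subset_Ici_self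
  have key := ofReal_sub_le_lintegral_of_deriv_le (R := 1)
    (W := fun t => -(riccati b t * φ t ^ 2))
    (W' := fun t => -((riccatiUpper b t ^ 2 * t ^ (1 - b) - t ^ (b - 1)) * φ t ^ 2 +
      riccati b t * (2 * φ t * deriv φ t)))
    (g := fun t => (deriv φ t ^ 2 + φ t ^ 2) * t ^ (1 - 2 * s)) zero_le_one
    ?_ ?_ ?_ ?_ ?_
  · simp only [riccati_one, riccati_zero hb hb1, hφ.at_zero, zero_mul, one_pow, mul_one,
      sub_neg_eq_add, neg_zero, zero_add] at key
    exact key.trans (lintegral_mono_set Ioo_subset_Ioi_self)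
  · exact ((continuous_riccati hb hb1).continuousOn.mul (hcont.pow 2)).neg
  · intro t ht
    refine (((hasDerivAt_riccati hb hb1 ht.1).mul ((hd t ht).pow 2)).neg).congr_deriv ?_
    simp
  · refine AEStronglyMeasurable.mul (.add ?_ ?_) ?_
    · exact ((measurable_deriv φ).pow_const 2).aestronglyMeasurable
    · exact ((hcont.mono Ioo_subset_Icc_self).pow 2).aestronglyMeasurable measurableSet_Ioo
    · exact (measurable_id.pow_const _).aestronglyMeasurable
  · intro t ht
    have := Real.rpow_nonneg ht.1.le (1 - 2 * s)
    positivity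
  · intro t ht
    obtain ⟨h0, h1⟩ := riccati_bounds hb hb1 ht
    have e : 1 - 2 * s = b - 1 := by rw [hbdef]; ring
    have h3 : t ^ (1 - b) * t ^ (b - 1) = 1 := by
      rw [← Real.rpow_add ht.1]; simp
    have hX : 0 < t ^ (b - 1) := Real.rpow_pos_of_pos ht.1 _
    have hY : 0 < t ^ (1 - b) := Real.rpow_pos_of_pos ht.1 _
    rw [e]
    have h4 : riccati b t ^ 2 ≤ riccatiUpper b t ^ 2 := by gcongr
    have h5 : 0 ≤ t ^ (b - 1) * (deriv φ t + riccati b t * φ t * t ^ (1 - b)) ^ 2 := by positivity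
    have h6 : t ^ (b - 1) * (deriv φ t + riccati b t * φ t * t ^ (1 - b)) ^ 2 =
      t ^ (b - 1) * deriv φ t ^ 2 + riccati b t * (2 * φ t * deriv φ t) +
        riccati b t ^ 2 * φ t ^ 2 * t ^ (1 - b) := by
      linear_combination (2 * riccati b t * φ t * deriv φ t + riccati b t ^ 2 * φ t ^ 2
        * t ^ (1 - b)) * h3
    have h7 : riccati b t ^ 2 * (φ t ^ 2 * t ^ (1 - b)) ≤
        riccatiUpper b t ^ 2 * (φ t ^ 2 * t ^ (1 - b)) := by gcongr
    nlinarith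

/-! ### Gluing a truncated profile to a tail -/

theorem lintegral_image_const_mul {w : ℝ} (hw : 0 < w) {S : Set ℝ} (hS : MeasurableSet S)
    (g : ℝ → ℝ≥0∞) :
    ∫⁻ x in (fun t => w * t) '' S, g x = ENNReal.ofReal w * ∫⁻ t in S, g (w * t) := by
  rw [lintegral_image_eq_lintegral_abs_deriv_mul (f := fun t => w * t) (f' := fun _ => w) hS
    (fun x _ => by simpa using ((hasDerivAt_id x).const_mul w).hasDerivWithinAt)
    (fun x _ y _ h => mul_left_cancel₀ hw.ne' h), abs_of_pos hw,
    lintegral_const_mul' _ _ ENNReal.ofReal_ne_top]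

/-- Young's inequality for squares. -/
theorem add_sq_le {ε : ℝ} (hε : 0 < ε) (x y : ℝ) :
    (x + y) ^ 2 ≤ (1 + ε) * x ^ 2 + (1 + ε⁻¹) * y ^ 2 := by
  have h : (1 + ε) * x ^ 2 + (1 + ε⁻¹) * y ^ 2 - (x + y) ^ 2 = ε⁻¹ * (ε * x - y) ^ 2 := by
    field_simp
    ring
  have : 0 ≤ ε⁻¹ * (ε * x - y) ^ 2 := by positivity
  linarith

/-- The part beyond `R` of the profiles used for gluing: it starts with value `T` and slope
`J - T`, and its energy tends to that of `T * exp (-τ)` as `n → ∞`. -/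
def gluedTail (T J n τ : ℝ) : ℝ := T * Real.exp (-τ) + J * (τ * Real.exp (-n * τ))

/-- The derivative of `gluedTail`. -/
def gluedTailDeriv (T J n τ : ℝ) : ℝ :=
  -T * Real.exp (-τ) + J * ((1 - n * τ) * Real.exp (-n * τ))

theorem hasDerivAt_gluedTail (T J n τ : ℝ) :
    HasDerivAt (gluedTail T J n) (gluedTailDeriv T J n τ) τ := by
  have h1 := ((hasDerivAt_neg τ).exp).const_mul T
  have h2 := ((hasDerivAt_id τ).mul ((((hasDerivAt_id τ).const_mul (-n))).exp)).const_mul J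
  refine HasDerivAt.congr_deriv (f := gluedTail T J n) (h1.add h2) ?_
  simp only [gluedTailDeriv, id]
  ring

/-- The two exponentials on the right have integrals `1 / 2` and `1 / n`, so that the second term is
negligible for large `n` and the first one gives `T²` as `η → 0`. -/
theorem gluedTail_energy_le (T J : ℝ) {η n τ : ℝ} (hη : 0 < η) (hn : 1 ≤ n) (hτ : 0 ≤ τ) :
    gluedTailDeriv T J n τ ^ 2 + gluedTail T J n τ ^ 2 ≤
      2 * (1 + η) * T ^ 2 * Real.exp (-2 * τ) + 2 * (1 + 1 / η) * J ^ 2 * Real.exp (-n * τ) := by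
  have hyoung : ∀ x y : ℝ, (x + y) ^ 2 ≤ (1 + η) * x ^ 2 + (1 + 1 / η) * y ^ 2 :=
    fun x y => by simpa only [one_div] using add_sq_le hη x y
  have hquad : ∀ x : ℝ, 0 ≤ x → 1 + x + x ^ 2 / 2 ≤ Real.exp x :=
    fun x hx => Real.quadratic_le_exp_of_nonneg hx
  set E := Real.exp (-n * τ) with hE
  have hinv : E * Real.exp (n * τ) = 1 := by rw [hE, ← Real.exp_add]; simp
  have hnτ : 0 ≤ n * τ := by positivity
  have h1 : ((1 - n * τ) * E) ^ 2 ≤ E := by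
    have : (1 - n * τ) ^ 2 ≤ Real.exp (n * τ) := by
      by_cases h : n * τ ≤ 2
      · have := Real.one_le_exp hnτ; nlinarith
      · have h4 : Real.exp (n * τ) = Real.exp (n * τ / 2) ^ 2 := by
          rw [← Real.exp_nat_mul]; congr 1; push_cast; ring
        have := hquad (n * τ / 2) (by positivity)
        rw [h4]
        refine pow_le_pow_left₀ ?_ ?_ 2 |>.trans' (le_of_eq (sub_sq_comm 1 (n * τ)))
        · linarith
        · nlinarith [sq_nonneg (n * τ - 2)]
    calc ((1 - n * τ) * E) ^ 2 = (1 - n * τ) ^ 2 * E * E := by ring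
      _ ≤ Real.exp (n * τ) * E * E := by gcongr
      _ = E := by linear_combination E * hinv
  have h2 : (τ * E) ^ 2 ≤ E := by
    have : τ ^ 2 ≤ Real.exp (n * τ) := by
      have := hquad (n * τ) hnτ
      have h3 := hquad (n * τ / 2) (by positivity)
      have h4 : Real.exp (n * τ) = Real.exp (n * τ / 2) ^ 2 := by
          rw [← Real.exp_nat_mul]; congr 1; push_cast; ring
      rw [h4]
      refine pow_le_pow_left₀ hτ ?_ 2
      have : τ ≤ n * τ := by nlinarith
      nlinarith [sq_nonneg (n * τ - 2)]
    calc (τ * E) ^ 2 = τ ^ 2 * E * E := by ring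
      _ ≤ Real.exp (n * τ) * E * E := by gcongr
      _ = E := by linear_combination E * hinv
  have h3 : Real.exp (-2 * τ) = Real.exp (-τ) ^ 2 := by
    rw [← Real.exp_nat_mul]; congr 1; push_cast; ring
  rw [h3]
  have hA := hyoung (-T * Real.exp (-τ)) (J * ((1 - n * τ) * E))
  have hB := hyoung (T * Real.exp (-τ)) (J * (τ * E))
  have h4 : (1 + 1 / η) * (J * ((1 - n * τ) * E)) ^ 2 ≤ (1 + 1 / η) * J ^ 2 * E := by
    rw [mul_pow, ← mul_assoc]; gcongr
  have h5 : (1 + 1 / η) * (J * (τ * E)) ^ 2 ≤ (1 + 1 / η) * J ^ 2 * E := by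
    rw [mul_pow, ← mul_assoc]; gcongr
  unfold gluedTailDeriv gluedTail
  nlinarith

theorem lintegral_exp_mul_le {c R : ℝ} (hc : 0 < c) :
    ∫⁻ t in Ioi R, ENNReal.ofReal (Real.exp (-c * (t - R))) = ENNReal.ofReal (1 / c) := by
  have hint : IntegrableOn (fun t => Real.exp (-c * t) * Real.exp (c * R)) (Ioi R) :=
    (integrableOn_exp_mul_Ioi (neg_lt_zero.2 hc) R).mul_const _
  have e : ∀ t, Real.exp (-c * (t - R)) = Real.exp (-c * t) * Real.exp (c * R) := fun t => by
    rw [← Real.exp_add]; congr 1; ring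
  simp_rw [e]
  rw [← ofReal_integral_eq_lintegral_ofReal hint (Eventually.of_forall fun t => by positivity),
    integral_mul_const, integral_exp_mul_Ioi (neg_lt_zero.2 hc)]
  congr 1
  have : Real.exp (-c * R) * Real.exp (c * R) = 1 := by rw [← Real.exp_add]; simp
  rw [neg_div_neg_eq, div_mul_eq_mul_div, this]

/-- A function on `(0, R)` with value `1` at `0`, continued beyond `R` as a multiple of
`exp (-t)`, competes in `eConst`; the kink at `R` is smoothed by `gluedTail`. -/
theorem eConst_le_of_glue {s : ℝ} (hs : 1 / 2 < s) {F F' : ℝ → ℝ} {R R₀ : ℝ}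
    (hR : 0 < R) (hRR : R < R₀) (hF : ContinuousOn F (Ico 0 R₀))
    (hd : ∀ t ∈ Ioo 0 R₀, HasDerivAt F (F' t) t) (hF' : ContinuousOn F' (Ioo 0 R₀))
    (h0 : F 0 = 1) :
    eConst s ≤ (∫⁻ t in Ioo 0 R, ENNReal.ofReal ((F' t ^ 2 + F t ^ 2) * t ^ (1 - 2 * s))) +
      ENNReal.ofReal (R ^ (1 - 2 * s) * F R ^ 2) := by
  set T := F R
  set J := F' R + T with hJ
  -- glue with `n = (k + 1)²`, and use Young's inequality with parameter `1 / (k + 1)`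
  have hbd : ∀ k : ℕ, eConst s ≤
      (∫⁻ t in Ioo 0 R, ENNReal.ofReal ((F' t ^ 2 + F t ^ 2) * t ^ (1 - 2 * s))) +
      ENNReal.ofReal (R ^ (1 - 2 * s) * ((1 + 1 / ((k : ℝ) + 1)) * T ^ 2 +
        2 * (1 / ((k : ℝ) + 1) ^ 2 + 1 / ((k : ℝ) + 1)) * J ^ 2)) := by
    intro k
    set n : ℝ := ((k : ℝ) + 1) ^ 2 with hn
    have hk : (1:ℝ) ≤ (k : ℝ) + 1 := by have : (0:ℝ) ≤ k := by positivity
                                        linarith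
    have hn1 : 1 ≤ n := by rw [hn]; nlinarith
    set Φ : ℝ → ℝ := fun t => if t ≤ R then F t else gluedTail T J n (t - R) with hΦ
    set Φ' : ℝ → ℝ := fun t => if t ≤ R then F' t else gluedTailDeriv T J n (t - R) with hΦ'
    have hG : ∀ t, HasDerivAt (fun t => gluedTail T J n (t - R))
        (gluedTailDeriv T J n (t - R)) t := fun t => by
      simpa using (hasDerivAt_gluedTail T J n (t - R)).comp_sub_const t R
    have hΦd : ∀ t, 0 < t → HasDerivAt Φ (Φ' t) t := by
      intro t ht
      rcases lt_trichotomy t R with h | h | h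
      · have : Φ' t = F' t := by simp [hΦ', h.le]
        rw [this]
        refine (hd t ⟨ht, h.trans hRR⟩).congr_of_eventuallyEq ?_
        filter_upwards [Iio_mem_nhds h] with x hx
        simp [hΦ, (mem_Iio.1 hx).le]
      · subst h
        have e1 : Φ' t = F' t := by simp [hΦ']
        have e2 : gluedTailDeriv T J n (t - t) = F' t := by simp [gluedTailDeriv, hJ]
        rw [e1]
        have hl : HasDerivWithinAt Φ (F' t) (Iic t) t :=
          (hd t ⟨ht, hRR⟩).hasDerivWithinAt.congr (fun x hx => by simp [hΦ, mem_Iic.1 hx])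
            (by simp [hΦ])
        have hr : HasDerivWithinAt Φ (F' t) (Ici t) t := by
          have h3 := (hG t).hasDerivWithinAt (s := Ici t)
          rw [e2] at h3
          refine h3.congr (fun x hx => ?_) ?_
          · rcases eq_or_lt_of_le (mem_Ici.1 hx) with h | h
            · subst h; simp [hΦ, gluedTail, T]
            · simp [hΦ, not_le.2 h]
          · simp [hΦ, gluedTail, T]
        have := hl.union hr
        rwa [Iic_union_Ici, hasDerivWithinAt_univ] at this
      · have : Φ' t = gluedTailDeriv T J n (t - R) := by simp [hΦ', not_le.2 h]
        rw [this]
        refine (hG t).congr_of_eventuallyEq ?_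
        filter_upwards [Ioi_mem_nhds h] with x hx
        simp [hΦ, not_le.2 (mem_Ioi.1 hx)]
    have hΦ'c : ContinuousOn Φ' (Ioi 0) := by
      have hcG : Continuous fun t => gluedTailDeriv T J n (t - R) := by
        unfold gluedTailDeriv; fun_prop
      refine ContinuousOn.if ?_ ?_ ?_
      · intro a ha
        have : {a : ℝ | a ≤ R} = Iic R := rfl
        rw [this, frontier_Iic] at ha
        rw [mem_singleton_iff.1 ha.2]; simp [gluedTailDeriv, hJ]
      · refine hF'.mono fun x hx => ⟨hx.1, ?_⟩
        have : {a : ℝ | a ≤ R} = Iic R := rfl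
        rw [this, closure_Iic] at hx
        exact lt_of_le_of_lt hx.2 hRR
      · exact hcG.continuousOn
    have hprof : IsProfile Φ := by
      refine ⟨fun t ht => ?_, ?_, by simp [hΦ, hR.le, h0], ?_⟩
      · rcases eq_or_lt_of_le (mem_Ici.1 ht) with h | h
        · subst h
          have h1 : ContinuousWithinAt F (Ici 0) 0 :=
            (hF 0 ⟨le_rfl, hR.trans hRR⟩).mono_of_mem_nhdsWithin
              (Ico_mem_nhdsGE (hR.trans hRR))
          refine h1.congr_of_eventuallyEq ?_ (by simp [hΦ, hR.le])
          filter_upwards [Ico_mem_nhdsGE hR] with x hx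
          simp [hΦ, hx.2.le]
        · exact (hΦd t h).continuousAt.continuousWithinAt
      · have := contDiffOn_succ_iff_deriv_of_isOpen (𝕜 := ℝ) (n := 0) (f := Φ)
          (isOpen_Ioi (a := (0:ℝ)))
        rw [zero_add] at this
        rw [this]
        refine ⟨fun t ht => (hΦd t ht).differentiableAt.differentiableWithinAt, by simp, ?_⟩
        rw [contDiffOn_zero]
        exact hΦ'c.congr fun t ht => (hΦd t ht).deriv
      · have h1 : Tendsto (fun τ : ℝ => gluedTail T J n τ) atTop (𝓝 0) := by
          have a1 : Tendsto (fun τ : ℝ => Real.exp (-τ)) atTop (𝓝 0) :=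
            Real.tendsto_exp_neg_atTop_nhds_zero
          have a2 : Tendsto (fun τ : ℝ => τ * Real.exp (-n * τ)) atTop (𝓝 0) := by
            have := tendsto_rpow_mul_exp_neg_mul_atTop_nhds_zero 1 n (by linarith)
            simpa using this
          simpa [gluedTail] using (a1.const_mul T).add (a2.const_mul J)
        have h2 : Tendsto (fun t : ℝ => t - R) atTop atTop :=
          tendsto_atTop_add_const_right _ _ tendsto_id
        refine (h1.comp h2).congr' ?_
        filter_upwards [eventually_gt_atTop R] with t ht
        simp [hΦ, not_le.2 ht]
    have hsplit : profileEnergy (1 - 2 * s) Φ =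
        (∫⁻ t in Ioo 0 R, ENNReal.ofReal ((F' t ^ 2 + F t ^ 2) * t ^ (1 - 2 * s))) +
        ∫⁻ t in Ioi R, ENNReal.ofReal ((gluedTailDeriv T J n (t - R) ^ 2 +
          gluedTail T J n (t - R) ^ 2) * t ^ (1 - 2 * s)) := by
      rw [profileEnergy, ← Ioc_union_Ioi_eq_Ioi hR.le,
        lintegral_union measurableSet_Ioi (Ioc_disjoint_Ioi le_rfl),
        setLIntegral_congr Ioo_ae_eq_Ioc]
      congr 1
      · refine setLIntegral_congr_fun measurableSet_Ioc fun t ht => ?_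
        have e1 : Φ t = F t := if_pos ht.2
        have e2 : Φ' t = F' t := if_pos ht.2
        simp only [(hΦd t ht.1).deriv, e1, e2]
      · refine setLIntegral_congr_fun measurableSet_Ioi fun t ht => ?_
        have e1 : Φ t = gluedTail T J n (t - R) := if_neg (not_le.2 ht)
        have e2 : Φ' t = gluedTailDeriv T J n (t - R) := if_neg (not_le.2 ht)
        simp only [(hΦd t (hR.trans ht)).deriv, e1, e2]
    refine (iInf₂_le Φ hprof).trans ?_
    rw [hsplit]
    gcongr
    have hη : (0:ℝ) < 1 / ((k : ℝ) + 1) := by positivity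
    set c1 := R ^ (1 - 2 * s) * (2 * (1 + 1 / ((k : ℝ) + 1)) * T ^ 2) with hc1
    set c2 := R ^ (1 - 2 * s) * (2 * (1 + 1 / (1 / ((k : ℝ) + 1))) * J ^ 2) with hc2
    have hc1' : 0 ≤ c1 := by positivity
    have hc2' : 0 ≤ c2 := by positivity
    calc ∫⁻ t in Ioi R, ENNReal.ofReal ((gluedTailDeriv T J n (t - R) ^ 2 +
          gluedTail T J n (t - R) ^ 2) * t ^ (1 - 2 * s))
        ≤ ∫⁻ t in Ioi R, (ENNReal.ofReal c1 * ENNReal.ofReal (Real.exp (-2 * (t - R))) +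
            ENNReal.ofReal c2 * ENNReal.ofReal (Real.exp (-n * (t - R)))) := by
          refine setLIntegral_mono' measurableSet_Ioi fun t ht => ?_
          rw [← ENNReal.ofReal_mul hc1', ← ENNReal.ofReal_mul hc2',
            ← ENNReal.ofReal_add (by positivity) (by positivity)]
          refine ENNReal.ofReal_le_ofReal ?_
          have h1 := gluedTail_energy_le T J hη hn1 (sub_nonneg.2 (mem_Ioi.1 ht).le)
          have h2 : t ^ (1 - 2 * s) ≤ R ^ (1 - 2 * s) :=
            Real.rpow_le_rpow_of_nonpos hR (mem_Ioi.1 ht).le (by linarith)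
          refine (mul_le_mul h1 h2 (Real.rpow_nonneg (hR.trans ht).le _) (by positivity)).trans ?_
          rw [hc1, hc2]; apply le_of_eq; ring
      _ = ENNReal.ofReal c1 * ENNReal.ofReal (1 / 2) +
          ENNReal.ofReal c2 * ENNReal.ofReal (1 / n) := by
          rw [lintegral_add_left (by fun_prop), lintegral_const_mul' _ _ ENNReal.ofReal_ne_top,
            lintegral_const_mul' _ _ ENNReal.ofReal_ne_top, lintegral_exp_mul_le two_pos,
            lintegral_exp_mul_le (by linarith)]
      _ = ENNReal.ofReal (c1 * (1 / 2) + c2 * (1 / n)) := by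
          rw [← ENNReal.ofReal_mul hc1', ← ENNReal.ofReal_mul hc2', ENNReal.ofReal_add
            (by positivity) (by positivity)]
      _ ≤ _ := by
          refine ENNReal.ofReal_le_ofReal (le_of_eq ?_)
          rw [hc1, hc2, hn]
          field_simp
  have hlim : Tendsto (fun k : ℕ => ENNReal.ofReal (R ^ (1 - 2 * s) *
      ((1 + 1 / ((k : ℝ) + 1)) * T ^ 2 +
        2 * (1 / ((k : ℝ) + 1) ^ 2 + 1 / ((k : ℝ) + 1)) * J ^ 2))) atTop
      (𝓝 (ENNReal.ofReal (R ^ (1 - 2 * s) * T ^ 2))) := by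
    have h1 := tendsto_one_div_add_atTop_nhds_zero_nat (𝕜 := ℝ)
    have h2 : Tendsto (fun k : ℕ => 1 / ((k : ℝ) + 1) ^ 2) atTop (𝓝 0) := by
      have := h1.pow 2
      simpa using this
    refine ENNReal.tendsto_ofReal ?_
    have := (((h1.const_add 1).mul_const (T ^ 2)).add
      (((h2.add h1).const_mul 2).mul_const (J ^ 2))).const_mul (R ^ (1 - 2 * s))
    simpa using this
  exact ge_of_tendsto (hlim.const_add _) (Eventually.of_forall hbd)

/-! ### Finiteness of the constant and approximation by short intervals -/

theorem eConst_lt_top {s : ℝ} (hs : 1 / 2 < s) (hs1 : s < 1) : eConst s < ⊤ := by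
  refine (eConst_le_of_glue hs (F := fun _ => 1) (F' := fun _ => 0) (R := 1) (R₀ := 2)
    one_pos one_lt_two continuousOn_const (fun t _ => hasDerivAt_const t 1) continuousOn_const
    rfl).trans_lt ?_
  refine ENNReal.add_lt_top.2 ⟨?_, ENNReal.ofReal_lt_top⟩
  have h := (intervalIntegrable_iff_integrableOn_Ioo_of_le (zero_le_one (α := ℝ))).1
    (intervalIntegral.intervalIntegrable_rpow' (r := 1 - 2 * s) (by linarith) (a := 0) (b := 1))
  have := h.lintegral_lt_top
  simpa using this

/-- Truncating the half-line at `R` lowers the least energy by at most the last term. The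
competitor for the half-line is `φ - δ h`, with `h` the growing solution of the Euler-Lagrange
equation, continued exponentially beyond `R`. -/
theorem eConst_le_energy_add {s : ℝ} (hs : 1 / 2 < s) {φ φ' : ℝ → ℝ} {R R₀ : ℝ}
    (hR : 0 < R) (hRR : R < R₀) (hφ : ContinuousOn φ (Ico 0 R₀))
    (hd : ∀ t ∈ Ioo 0 R₀, HasDerivAt φ (φ' t) t) (hφ' : ContinuousOn φ' (Ioo 0 R₀))
    (h0 : φ 0 = 1) :
    eConst s ≤ (∫⁻ t in Ioo 0 R, ENNReal.ofReal ((φ' t ^ 2 + φ t ^ 2) * t ^ (1 - 2 * s))) +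
      ENNReal.ofReal (R ^ (1 - 2 * s) / (growingFlux s R *
        (growingFlux s R + R * besselSeries s R / (2 * s)))) := by
  by_cases htop : ∫⁻ t in Ioo 0 R, ENNReal.ofReal ((φ' t ^ 2 + φ t ^ 2) * t ^ (1 - 2 * s)) = ⊤
  · rw [htop, top_add]; exact le_top
  set q := growingFlux s with hq
  set h := growing s with hh
  set B := R ^ (1 - 2 * s)
  have hBpos : 0 < B := Real.rpow_pos_of_pos hR _
  have hAR : 0 < besselSeries s R := lt_of_lt_of_le (by positivity) (le_besselSeries hs R)
  have hqR : 0 < q R := lt_of_lt_of_le (by positivity) (le_growingFlux hs R)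
  have hBh : h R * B = R * besselSeries s R / (2 * s) := growing_mul_rpow hR
  have hhR : 0 < h R := by
    have : 0 < h R * B := by rw [hBh]; positivity
    exact pos_of_mul_pos_left this hBpos.le
  rw [← hBh]
  set T := φ R
  -- `T'` is the value at `R` of the solution with the natural boundary condition `F' = -F` there,
  -- and `δ` is chosen such that the competitor has this value at `R`
  set T' := 1 / (q R + h R * B) with hT'
  set δ := (T - T') / h R with hδ
  set F : ℝ → ℝ := fun t => φ t - δ * h t with hF
  set F' : ℝ → ℝ := fun t => φ' t - δ * (t ^ (2 * s - 1) * q t) with hF'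
  have hqc := continuous_growingFlux hs
  have hhc := continuous_growing hs
  have hAc := continuous_besselSeries hs
  have hpow : Continuous fun t : ℝ => t ^ (2 * s - 1) := Real.continuous_rpow_const (by linarith)
  have hglue := eConst_le_of_glue hs (F := F) (F' := F') hR hRR
    (hφ.sub (hhc.const_mul δ).continuousOn)
    (fun t ht => (hd t ht).sub ((hasDerivAt_growing hs ht.1).const_mul δ))
    (hφ'.sub ((hpow.mul hqc).const_mul δ).continuousOn)
    (by simp [hF, h0, hh, growing_zero hs])
  refine hglue.trans ?_
  have hsub : Ioo 0 R ⊆ Ioo 0 R₀ := Ioo_subset_Ioo le_rfl hRR.le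
  have hmeas : ∀ {f f' : ℝ → ℝ}, ContinuousOn f (Ioo 0 R) → ContinuousOn f' (Ioo 0 R) →
      AEStronglyMeasurable (fun t => (f' t ^ 2 + f t ^ 2) * t ^ (1 - 2 * s))
        (volume.restrict (Ioo 0 R)) := fun hf hf' =>
    (((hf'.pow 2).add (hf.pow 2)).aestronglyMeasurable measurableSet_Ioo).mul
      (measurable_id.pow_const _).aestronglyMeasurable
  have hφc : ContinuousOn φ (Ioo 0 R) := hφ.mono fun x hx => ⟨hx.1.le, hx.2.trans hRR⟩
  have hφ'c : ContinuousOn φ' (Ioo 0 R) := hφ'.mono hsub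
  have hnn : ∀ f f' : ℝ → ℝ, 0 ≤ᵐ[volume.restrict (Ioo 0 R)]
      fun t => (f' t ^ 2 + f t ^ 2) * t ^ (1 - 2 * s) := fun f f' =>
    (ae_restrict_mem measurableSet_Ioo).mono fun t ht =>
      mul_nonneg (by positivity) (Real.rpow_nonneg ht.1.le _)
  have hint : IntegrableOn (fun t => (φ' t ^ 2 + φ t ^ 2) * t ^ (1 - 2 * s)) (Ioo 0 R) :=
    ⟨hmeas hφc hφ'c, (hasFiniteIntegral_iff_ofReal (hnn φ φ')).2 (lt_top_iff_ne_top.2 htop)⟩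
  -- as `q' = h t^(1-2s)` and `h' t^(1-2s) = q`, the energies of `F` and `φ` differ by a derivative
  set Z : ℝ → ℝ := fun t => -2 * δ * (φ t * q t) + δ ^ 2 * (h t * q t) with hZ
  set Z' : ℝ → ℝ := fun t => -2 * δ * (φ' t * q t + φ t * (t * besselSeries s t / (2 * s))) +
    δ ^ 2 * ((t ^ (2 * s - 1) * q t) * q t + h t * (t * besselSeries s t / (2 * s))) with hZ'
  have hZd : ∀ t ∈ Ioo 0 R, HasDerivAt Z (Z' t) t := fun t ht =>
    ((((hd t (hsub ht)).mul (hasDerivAt_growingFlux hs t)).const_mul (-2 * δ)).add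
      (((hasDerivAt_growing hs ht.1).mul (hasDerivAt_growingFlux hs t)).const_mul (δ ^ 2)))
  have hZc : ContinuousOn Z (Icc 0 R) := by
    have : ContinuousOn φ (Icc 0 R) := hφ.mono fun x hx => ⟨hx.1, hx.2.trans_lt hRR⟩
    exact ((this.mul hqc.continuousOn).const_mul _).add ((hhc.mul hqc).const_mul _).continuousOn
  have hexp : ∀ t ∈ Ioo 0 R, (F' t ^ 2 + F t ^ 2) * t ^ (1 - 2 * s) =
      (φ' t ^ 2 + φ t ^ 2) * t ^ (1 - 2 * s) + Z' t := by
    intro t ht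
    have e1 : t ^ (2 * s - 1) * t ^ (1 - 2 * s) = 1 := by
      rw [← Real.rpow_add ht.1]; simp
    have e2 : h t * t ^ (1 - 2 * s) = t * besselSeries s t / (2 * s) := growing_mul_rpow ht.1
    simp only [hF, hF', hZ', ← e2]
    linear_combination (-2 * δ * φ' t * q t + δ ^ 2 * t ^ (2 * s - 1) * q t ^ 2) * e1
  have hbnd : ∀ t ∈ Ioo 0 R, |Z' t| ≤ 3 * ((φ' t ^ 2 + φ t ^ 2) * t ^ (1 - 2 * s)) +
      2 * δ ^ 2 * ((t ^ (2 * s - 1) * q t) * q t + h t * (t * besselSeries s t / (2 * s))) := by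
    intro t ht
    have e1 : t ^ (2 * s - 1) * t ^ (1 - 2 * s) = 1 := by
      rw [← Real.rpow_add ht.1]; simp
    have e2 : h t * t ^ (1 - 2 * s) = t * besselSeries s t / (2 * s) := growing_mul_rpow ht.1
    have hw : 0 < t ^ (1 - 2 * s) := Real.rpow_pos_of_pos ht.1 _
    have hex := hexp t ht
    have e3 : (t ^ (2 * s - 1) * q t) * q t + h t * (t * besselSeries s t / (2 * s)) =
        ((t ^ (2 * s - 1) * q t) ^ 2 + h t ^ 2) * t ^ (1 - 2 * s) := by
      rw [← e2]; linear_combination (-t ^ (2 * s - 1) * q t ^ 2) * e1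
    have hFle : (F' t ^ 2 + F t ^ 2) * t ^ (1 - 2 * s) ≤
        2 * ((φ' t ^ 2 + φ t ^ 2) * t ^ (1 - 2 * s)) +
        2 * δ ^ 2 * (((t ^ (2 * s - 1) * q t) ^ 2 + h t ^ 2) * t ^ (1 - 2 * s)) := by
      have : F' t ^ 2 + F t ^ 2 ≤ 2 * (φ' t ^ 2 + φ t ^ 2) +
          2 * δ ^ 2 * ((t ^ (2 * s - 1) * q t) ^ 2 + h t ^ 2) := by
        simp only [hF, hF']
        nlinarith [sq_nonneg (φ' t + δ * (t ^ (2 * s - 1) * q t)), sq_nonneg (φ t + δ * h t)]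
      calc _ ≤ (2 * (φ' t ^ 2 + φ t ^ 2) +
          2 * δ ^ 2 * ((t ^ (2 * s - 1) * q t) ^ 2 + h t ^ 2)) * t ^ (1 - 2 * s) := by gcongr
        _ = _ := by ring
    have hF0 : 0 ≤ (F' t ^ 2 + F t ^ 2) * t ^ (1 - 2 * s) := by positivity
    have hφ0 : 0 ≤ (φ' t ^ 2 + φ t ^ 2) * t ^ (1 - 2 * s) := by positivity
    rw [e3, abs_le]
    constructor <;> linarith
  have hZint : IntegrableOn Z' (Ioo 0 R) := by
    have hc : Continuous fun t => 2 * δ ^ 2 *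
        ((t ^ (2 * s - 1) * q t) * q t + h t * (t * besselSeries s t / (2 * s))) := by
      fun_prop
    refine Integrable.mono' ((hint.const_mul 3).add
      ((hc.integrableOn_Icc (a := 0) (b := R)).mono_set Ioo_subset_Icc_self)) ?_
      ((ae_restrict_mem measurableSet_Ioo).mono hbnd)
    refine ContinuousOn.aestronglyMeasurable ?_ measurableSet_Ioo
    have c1 : ContinuousOn (fun t => t * besselSeries s t / (2 * s)) (Ioo 0 R) := by fun_prop
    have c2 : ContinuousOn (fun t => t ^ (2 * s - 1) * q t * q t) (Ioo 0 R) := by fun_prop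
    exact (((hφ'c.mul hqc.continuousOn).add (hφc.mul c1)).const_mul _).add
      ((c2.add (hhc.continuousOn.mul c1)).const_mul _)
  have hFTC : ∫ t in Ioo 0 R, Z' t = Z R - Z 0 := by
    rw [← integral_Ioc_eq_integral_Ioo, ← intervalIntegral.integral_of_le hR.le]
    exact intervalIntegral.integral_eq_sub_of_hasDerivAt_of_le hR.le hZc hZd
      ((intervalIntegrable_iff_integrableOn_Ioo_of_le hR.le).2 hZint)
  have hFeq : ∫⁻ t in Ioo 0 R, ENNReal.ofReal ((F' t ^ 2 + F t ^ 2) * t ^ (1 - 2 * s)) =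
      ENNReal.ofReal ((∫ t in Ioo 0 R, (φ' t ^ 2 + φ t ^ 2) * t ^ (1 - 2 * s)) + (Z R - Z 0)) := by
    have hFint : IntegrableOn (fun t => (F' t ^ 2 + F t ^ 2) * t ^ (1 - 2 * s)) (Ioo 0 R) :=
      (hint.add hZint).congr
        ((ae_restrict_mem measurableSet_Ioo).mono fun t ht => (hexp t ht).symm)
    rw [← ofReal_integral_eq_lintegral_ofReal hFint (hnn F F'),
      setIntegral_congr_fun measurableSet_Ioo hexp, integral_add hint hZint, hFTC]
  have hFnn : 0 ≤ (∫ t in Ioo 0 R, (φ' t ^ 2 + φ t ^ 2) * t ^ (1 - 2 * s)) + (Z R - Z 0) := by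
    rw [← hFTC, ← integral_add hint hZint,
      ← setIntegral_congr_fun measurableSet_Ioo hexp]
    exact integral_nonneg_of_ae (hnn F F')
  have hTe : T' * (q R + h R * B) = 1 := by rw [hT']; field_simp
  have hδe : T = T' + δ * h R := by rw [hδ]; field_simp; ring
  -- completing the square in `δ q(R) - B T'`
  have hend : Z R - Z 0 + B * F R ^ 2 ≤ B / (q R * (q R + h R * B)) := by
    have e0 : Z 0 = -2 * δ := by
      simp [hZ, h0, hq, growingFlux_zero, hh, growing_zero hs]
    have eF : F R = T' := by simp only [hF]; linarith
    have eR : Z R = -2 * δ * (T * q R) + δ ^ 2 * (h R * q R) := rfl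
    have e4 : B / (q R * (q R + h R * B)) = B * T' / q R := by rw [hT']; field_simp
    rw [e0, eF, eR, e4, le_div_iff₀ hqR, hδe]
    have : 0 ≤ h R * (δ * q R - B * T') ^ 2 := by positivity
    have e5 : (-2 * δ * ((T' + δ * h R) * q R) + δ ^ 2 * (h R * q R) - -2 * δ + B * T' ^ 2) * q R
        = B * T' - h R * (δ * q R - B * T') ^ 2 := by
      linear_combination (-2 * δ * q R + B * T') * hTe
    rw [e5]; linarith
  have hBF : 0 ≤ B * F R ^ 2 := by positivity
  have hint0 : 0 ≤ ∫ t in Ioo 0 R, (φ' t ^ 2 + φ t ^ 2) * t ^ (1 - 2 * s) :=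
    integral_nonneg_of_ae (hnn φ φ')
  rw [hFeq, ← ofReal_integral_eq_lintegral_ofReal hint (hnn φ φ'),
    ← ENNReal.ofReal_add hFnn hBF, ← ENNReal.ofReal_add hint0 (by positivity)]
  exact ENNReal.ofReal_le_ofReal (by linarith)

/-! ### The mode inequality -/

/-- The inequality behind `truncation_le` at the smallest radius `R = 3 / 2`. After bounding
`1 / (1 + s)` by its tangent at `s = 1` it is polynomial in `s`. -/
theorem truncation_numeric {s : ℝ} (hs : 1 / 2 < s) (hs1 : s < 1) :
    4 * (2 - s) ≤ (5 * s - 2 * s ^ 2 - 1) *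
      (1 + (3 / 2) ^ 2 / (4 * s) + (3 / 2) ^ 4 / (32 * s * (1 + s))) *
      (2 / 3 + (3 / 2) / (4 * s) + (3 / 2) ^ 3 / (32 * s * (1 + s)) + 1 / (2 * s) +
        (3 / 2) ^ 2 / (8 * s * (1 + s))) := by
  have hs0 : 0 < s := by linarith
  have hinv : 3 / 4 - s / 4 ≤ 1 / (1 + s) := by
    rw [le_div_iff₀ (by linarith)]; nlinarith [sq_nonneg (1 - s)]
  have h1 : 0.96 + 0.68 / s ≤
      1 + (3 / 2) ^ 2 / (4 * s) + (3 / 2) ^ 4 / (32 * s * (1 + s)) := by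
    have e : 1 + (3 / 2) ^ 2 / (4 * s) + (3 / 2) ^ 4 / (32 * s * (1 + s)) =
      1 + (1 / s) * (9 / 16 + 81 / 512 * (1 / (1 + s))) := by field_simp; ring
    have : (1 / s) * (9 / 16 + 81 / 512 * (3 / 4 - s / 4)) ≤
      (1 / s) * (9 / 16 + 81 / 512 * (1 / (1 + s))) := by gcongr
    have e2 : (1 / s) * (9 / 16 + 81 / 512 * (3 / 4 - s / 4)) =
      (9 / 16 + 81 / 512 * (3 / 4)) * (1 / s) - 81 / 2048 := by field_simp; ring
    have : 0 < 1 / s := by positivity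
    have e3 : 0.68 / s = 0.68 * (1 / s) := by ring
    rw [e, e3]; nlinarith
  have h2 : 0.569 + 1.04 / s ≤ 2 / 3 + (3 / 2) / (4 * s) + (3 / 2) ^ 3 / (32 * s * (1 + s)) +
      1 / (2 * s) + (3 / 2) ^ 2 / (8 * s * (1 + s)) := by
    have e : 2 / 3 + (3 / 2) / (4 * s) + (3 / 2) ^ 3 / (32 * s * (1 + s)) +
      1 / (2 * s) + (3 / 2) ^ 2 / (8 * s * (1 + s)) =
      2 / 3 + (1 / s) * (7 / 8 + 99 / 256 * (1 / (1 + s))) := by field_simp; ring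
    have : (1 / s) * (7 / 8 + 99 / 256 * (3 / 4 - s / 4)) ≤
      (1 / s) * (7 / 8 + 99 / 256 * (1 / (1 + s))) := by gcongr
    have e2 : (1 / s) * (7 / 8 + 99 / 256 * (3 / 4 - s / 4)) =
      (7 / 8 + 99 / 256 * (3 / 4)) * (1 / s) - 99 / 1024 := by field_simp; ring
    have : 0 < 1 / s := by positivity
    have e3 : 1.04 / s = 1.04 * (1 / s) := by ring
    rw [e, e3]; nlinarith
  have h3 : 0 ≤ 5 * s - 2 * s ^ 2 - 1 := by nlinarith
  have h4 : 4 * (2 - s) ≤ (5 * s - 2 * s ^ 2 - 1) * (0.96 + 0.68 / s) * (0.569 + 1.04 / s) := by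
    have e : (5 * s - 2 * s ^ 2 - 1) * (0.96 + 0.68 / s) * (0.569 + 1.04 / s) =
      ((5 * s - 2 * s ^ 2 - 1) * (0.96 * s + 0.68) * (0.569 * s + 1.04)) / s ^ 2 := by
      field_simp
    rw [e, le_div_iff₀ (by positivity)]
    -- a polynomial inequality on `(1/2, 1)`, as a combination of products of `x` and `1/2 - x`
    obtain ⟨x, rfl⟩ : ∃ x, s = 1 / 2 + x := ⟨s - 1 / 2, by ring⟩
    have hx : 0 < x := by linarith
    have hx1 : 0 < 1 / 2 - x := by linarith
    nlinarith [mul_pos hx hx1, mul_pos hx (mul_pos hx hx1),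
      mul_pos (mul_pos hx hx) (mul_pos hx hx1)]
  refine h4.trans ?_
  gcongr

/-- Polynomial inequalities that reduce `truncation_le` to `R = 3 / 2`. -/
theorem quartic_bounds {R : ℝ} (hR : 3 / 2 ≤ R) :
    0 ≤ R ^ 4 / 32 + R ^ 3 / 8 - 99 / 256 * R ∧
    0 ≤ 1 + (R ^ 2 / 4 + R / 2 - 7 / 8 * R) * 1 +
        (R ^ 4 / 32 + R ^ 3 / 8 - 99 / 256 * R) * (1 / 2) - 2 / 3 * R := by
  obtain ⟨r, rfl⟩ : ∃ r, R = 3 / 2 + r := ⟨R - 3 / 2, by ring⟩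
  have hr : 0 ≤ r := by linarith
  have h2 : 0 ≤ r ^ 2 := by positivity
  have h3 : 0 ≤ r ^ 3 := by positivity
  have h4 : 0 ≤ r ^ 4 := by positivity
  constructor <;> ring_nf <;> linarith

/-- The energy lost by truncating at `R ≥ 3/2` is at most the fraction `s (1-s) R^(-2s)` of
`eConst s`. -/
theorem truncation_le {s : ℝ} (hs : 1 / 2 < s) (hs1 : s < 1) {R : ℝ} (hR : 3 / 2 ≤ R) :
    ENNReal.ofReal (R ^ (1 - 2 * s) / (growingFlux s R *
      (growingFlux s R + R * besselSeries s R / (2 * s)))) ≤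
      eConst s * ENNReal.ofReal (s * (1 - s) * R ^ (-2 * s)) := by
  have hs0 : 0 < s := by linarith
  have hs1' : 0 < 1 - s := by linarith
  have hR0 : 0 < R := by linarith
  refine le_trans ?_ (mul_le_mul_left (ofReal_le_eConst hs hs1) _)
  have h4 : 0 < 4 - (2 - 2 * s) ^ 2 := by nlinarith
  have hlow : 1 / (2 - 2 * s) - 1 / (4 - (2 - 2 * s) ^ 2) =
      (5 * s - 2 * s ^ 2 - 1) / (4 * (2 - s) * (s * (1 - s))) := by
    have : 4 - (2 - 2 * s) ^ 2 = 4 * s * (2 - s) := by ring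
    rw [this]
    have h5 : 2 - s ≠ 0 := by linarith
    have h6 : 2 - 2 * s = 2 * (1 - s) := by ring
    rw [h6]
    field_simp
    ring
  have hk : 0 ≤ 5 * s - 2 * s ^ 2 - 1 := by nlinarith
  have h2s : 0 < 2 - s := by linarith
  rw [hlow, ← ENNReal.ofReal_mul (by positivity)]
  refine ENNReal.ofReal_le_ofReal ?_
  set p₀ := 1 + (3 / 2) ^ 2 / (4 * s) + (3 / 2) ^ 4 / (32 * s * (1 + s)) with hp₀
  set c₀ := 2 / 3 + (3 / 2) / (4 * s) + (3 / 2) ^ 3 / (32 * s * (1 + s)) + 1 / (2 * s) +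
        (3 / 2) ^ 2 / (8 * s * (1 + s)) with hc₀
  have hq : p₀ ≤ growingFlux s R := by
    refine le_trans ?_ (le_growingFlux hs R)
    rw [hp₀]; gcongr
  have hqA : R * c₀ ≤ growingFlux s R + R * besselSeries s R / (2 * s) := by
    have h1 := le_growingFlux hs R
    have h2 : R * (1 + R ^ 2 / (4 * (1 + s))) / (2 * s) ≤ R * besselSeries s R / (2 * s) := by
      gcongr; exact le_besselSeries hs R
    refine le_trans ?_ (add_le_add h1 h2)
    have hu : 1 ≤ 1 / s := by rw [le_div_iff₀ hs0]; linarith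
    have hv : 1 / 2 ≤ 1 / (s * (1 + s)) := by
      rw [div_le_div_iff₀ two_pos (by positivity)]; nlinarith
    have e1 : R * c₀ = 2 / 3 * R + (7 / 8 * (1 / s) + 99 / 256 * (1 / (s * (1 + s)))) * R := by
      rw [hc₀]; field_simp; ring
    have e2 : 1 + R ^ 2 / (4 * s) + R ^ 4 / (32 * s * (1 + s)) +
        R * (1 + R ^ 2 / (4 * (1 + s))) / (2 * s) =
        1 + (R ^ 2 / 4 + R / 2) * (1 / s) + (R ^ 4 / 32 + R ^ 3 / 8) * (1 / (s * (1 + s))) := by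
      field_simp; ring
    rw [e1, e2]
    have a1 : (R ^ 2 / 4 + R / 2 - 7 / 8 * R) * 1 ≤ (R ^ 2 / 4 + R / 2 - 7 / 8 * R) * (1 / s) := by
      refine mul_le_mul_of_nonneg_left hu ?_
      nlinarith
    have a2 : (R ^ 4 / 32 + R ^ 3 / 8 - 99 / 256 * R) * (1 / 2) ≤
        (R ^ 4 / 32 + R ^ 3 / 8 - 99 / 256 * R) * (1 / (s * (1 + s))) := by
      exact mul_le_mul_of_nonneg_left hv (quartic_bounds hR).1
    have a3 := (quartic_bounds hR).2
    generalize 1 / s = U at *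
    generalize 1 / (s * (1 + s)) = V at *
    linarith
  have hp0 : 0 < p₀ := by positivity
  have hc0 : 0 < c₀ := by positivity
  have hnum := truncation_numeric hs hs1
  rw [← hp₀, ← hc₀] at hnum
  have hRR : R ^ (1 - 2 * s) = R * R ^ (-2 * s) := by
    rw [show (1 - 2 * s) = 1 + (-2 * s) by ring, Real.rpow_add hR0, Real.rpow_one]
  have hq0 : 0 ≤ growingFlux s R := hp0.le.trans hq
  calc R ^ (1 - 2 * s) / (growingFlux s R * (growingFlux s R + R * besselSeries s R / (2 * s)))
      ≤ R ^ (1 - 2 * s) / (p₀ * (R * c₀)) := by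
        gcongr
    _ = R ^ (-2 * s) / (p₀ * c₀) := by rw [hRR]; field_simp
    _ ≤ R ^ (-2 * s) * ((5 * s - 2 * s ^ 2 - 1) / (4 * (2 - s))) := by
        rw [div_eq_mul_inv]
        gcongr
        rw [inv_eq_one_div, div_le_div_iff₀ (by positivity) (by positivity)]
        linarith
    _ = _ := by field_simp

/-- The one-dimensional inequality for a single frequency `w` on the truncated interval `(0, 1)`. -/
theorem mode_inequality {s : ℝ} (hs : 1 / 2 < s) (hs1 : s < 1) {w : ℝ} (hw : 3 / 2 < w)
    {f f' : ℝ → ℝ} (hf : ContinuousOn f (Ico 0 1))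
    (hd : ∀ t ∈ Ioo 0 1, HasDerivAt f (f' t) t) (hf' : ContinuousOn f' (Ioo 0 1)) :
    ENNReal.ofReal (f 0 ^ 2) * (eConst s * ENNReal.ofReal (w ^ (2 * s))) ≤
      (∫⁻ t in Ioo 0 1, ENNReal.ofReal ((f' t ^ 2 + w ^ 2 * f t ^ 2) * t ^ (1 - 2 * s))) +
        ENNReal.ofReal (f 0 ^ 2) * (eConst s * ENNReal.ofReal (s * (1 - s))) := by
  rcases eq_or_ne (f 0) 0 with h0 | h0
  · simp [h0]
  have hw0 : 0 < w := by linarith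
  set φ : ℝ → ℝ := fun t => f (w⁻¹ * t) / f 0 with hφ
  set φ' : ℝ → ℝ := fun t => f' (w⁻¹ * t) * w⁻¹ / f 0 with hφ'
  have hmap : ∀ {t}, t ∈ Ioo 0 w → w⁻¹ * t ∈ Ioo (0:ℝ) 1 := fun {t} ht =>
    ⟨mul_pos (inv_pos.2 hw0) ht.1, by rw [inv_mul_lt_iff₀ hw0]; linarith [ht.2]⟩
  have hmap' : ∀ {t}, t ∈ Ico 0 w → w⁻¹ * t ∈ Ico (0:ℝ) 1 := fun {t} ht =>
    ⟨mul_nonneg (inv_pos.2 hw0).le ht.1, by rw [inv_mul_lt_iff₀ hw0]; linarith [ht.2]⟩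
  have hlin : ∀ S : Set ℝ, ContinuousOn (fun t : ℝ => w⁻¹ * t) S := fun S => by fun_prop
  have hφc : ContinuousOn φ (Ico 0 w) :=
    (hf.comp (hlin _) fun t ht => hmap' ht).div_const _
  have hφ'c : ContinuousOn φ' (Ioo 0 w) :=
    ((hf'.comp (hlin _) fun t ht => hmap ht).mul_const _).div_const _
  have hφd : ∀ t ∈ Ioo 0 w, HasDerivAt φ (φ' t) t := fun t ht => by
    have h1 : HasDerivAt (fun t : ℝ => w⁻¹ * t) w⁻¹ t := by
      simpa using (hasDerivAt_id t).const_mul w⁻¹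
    exact ((hd _ (hmap ht)).comp t h1).div_const _
  have hφ0 : φ 0 = 1 := by simp [hφ, h0]
  set X := ∫⁻ t in Ioo 0 w, ENNReal.ofReal ((φ' t ^ 2 + φ t ^ 2) * t ^ (1 - 2 * s)) with hX
  -- only `f` on `[0, 1)` is used, hence the limit `R → w` from below
  have hstep : ∀ R ∈ Ioo (3 / 2) w, eConst s ≤
      X + eConst s * ENNReal.ofReal (s * (1 - s) * R ^ (-2 * s)) := by
    intro R hR
    refine (eConst_le_energy_add hs (by linarith [hR.1]) hR.2 hφc hφd hφ'c hφ0).trans ?_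
    refine add_le_add (lintegral_mono_set (Ioo_subset_Ioo le_rfl hR.2.le)) ?_
    exact truncation_le hs hs1 hR.1.le
  have hlim : eConst s ≤ X + eConst s * ENNReal.ofReal (s * (1 - s) * w ^ (-2 * s)) := by
    have h1 : Tendsto (fun R : ℝ => X + eConst s * ENNReal.ofReal (s * (1 - s) * R ^ (-2 * s)))
        (𝓝[<] w) (𝓝 (X + eConst s * ENNReal.ofReal (s * (1 - s) * w ^ (-2 * s)))) := by
      refine Tendsto.const_add _ (ENNReal.Tendsto.const_mul ?_ (Or.inr (eConst_lt_top hs hs1).ne))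
      refine ENNReal.tendsto_ofReal (Tendsto.const_mul _ ?_)
      exact ((Real.continuousAt_rpow_const w (-2 * s) (Or.inl hw0.ne')).tendsto).mono_left
        nhdsWithin_le_nhds
    exact ge_of_tendsto h1 (eventually_of_mem (Ioo_mem_nhdsLT hw) hstep)
  have hXeq : X = ENNReal.ofReal (w ^ (-2 * s) / f 0 ^ 2) *
      ∫⁻ t in Ioo 0 1, ENNReal.ofReal ((f' t ^ 2 + w ^ 2 * f t ^ 2) * t ^ (1 - 2 * s)) := by
    have himg : Ioo 0 w = (fun t => w * t) '' Ioo 0 1 := by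
      rw [image_mul_left_Ioo hw0]; simp
    rw [hX, himg, lintegral_image_const_mul hw0 measurableSet_Ioo,
      ← lintegral_const_mul' _ _ ENNReal.ofReal_ne_top,
      ← lintegral_const_mul' _ _ ENNReal.ofReal_ne_top]
    refine setLIntegral_congr_fun measurableSet_Ioo fun t ht => ?_
    simp only [hφ, hφ']
    rw [← ENNReal.ofReal_mul hw0.le, ← ENNReal.ofReal_mul (by positivity)]
    congr 1
    rw [inv_mul_cancel_left₀ hw0.ne', Real.mul_rpow hw0.le ht.1.le]
    have e : w ^ (1 - 2 * s) = w * w ^ (-2 * s) := by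
      rw [show (1 - 2 * s) = 1 + (-2 * s) by ring, Real.rpow_add hw0, Real.rpow_one]
    rw [e]
    field_simp
  have hmul := mul_le_mul_right hlim (ENNReal.ofReal (f 0 ^ 2 * w ^ (2 * s)))
  have hwp : 0 < w ^ (2 * s) := Real.rpow_pos_of_pos hw0 _
  have hww : w ^ (2 * s) * w ^ (-2 * s) = 1 := by rw [← Real.rpow_add hw0]; simp
  rw [mul_add, hXeq, ← mul_assoc (ENNReal.ofReal (f 0 ^ 2 * w ^ (2 * s))),
    ← ENNReal.ofReal_mul (by positivity)] at hmul
  have e1 : f 0 ^ 2 * w ^ (2 * s) * (w ^ (-2 * s) / f 0 ^ 2) = 1 := by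
    rw [mul_div_assoc', mul_assoc, hww, mul_one, div_self (pow_ne_zero 2 h0)]
  have e2 : ENNReal.ofReal (f 0 ^ 2 * w ^ (2 * s)) *
      (eConst s * ENNReal.ofReal (s * (1 - s) * w ^ (-2 * s))) =
      ENNReal.ofReal (f 0 ^ 2) * (eConst s * ENNReal.ofReal (s * (1 - s))) := by
    rw [mul_left_comm, ← ENNReal.ofReal_mul (by positivity),
      mul_left_comm (ENNReal.ofReal (f 0 ^ 2)), ← ENNReal.ofReal_mul (by positivity)]
    congr 2
    linear_combination (f 0 ^ 2 * s * (1 - s)) * hww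
  have e3 : ENNReal.ofReal (f 0 ^ 2 * w ^ (2 * s)) * eConst s =
      ENNReal.ofReal (f 0 ^ 2) * (eConst s * ENNReal.ofReal (w ^ (2 * s))) := by
    rw [ENNReal.ofReal_mul (by positivity), mul_assoc, mul_comm (ENNReal.ofReal (w ^ (2 * s)))]
  rwa [e1, e2, e3, ENNReal.ofReal_one, one_mul] at hmul

/-! ### The constant `d_s` -/

theorem lintegral_eq_two_mul_of_even {g : ℝ → ℝ≥0∞} (hg : ∀ x, g (-x) = g x) :
    ∫⁻ x, g x = 2 * ∫⁻ x in Ioi (0:ℝ), g x := by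
  have h1 : ∫⁻ x in Iio (0:ℝ), g x = ∫⁻ x in Ioi (0:ℝ), g x := by
    have := (Measure.measurePreserving_neg (volume : Measure ℝ)).setLIntegral_comp_preimage_emb
      (MeasurableEquiv.neg ℝ).measurableEmbedding g (Iio 0)
    simp only [hg] at this
    rw [← this]
    simp
  rw [← setLIntegral_univ, ← Iic_union_Ioi (a := (0:ℝ)),
    lintegral_union measurableSet_Ioi (Iic_disjoint_Ioi le_rfl),
    setLIntegral_congr Iio_ae_eq_Iic.symm, h1, two_mul]

theorem two_sub_two_cos_nonneg (z : ℝ) : 0 ≤ 2 - 2 * Real.cos z := by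
  linarith [Real.cos_le_one z]

/-- Split at `|z| = 2`: use `2 - 2 cos z ≤ z²` inside and `2 - 2 cos z ≤ 4` outside. -/
theorem dConst_le {s : ℝ} (hs : 1 / 2 < s) (hs1 : s < 1) :
    dConst s ≤ ENNReal.ofReal (2 ^ (2 - 2 * s) / (s * (1 - s))) := by
  have hs1' : 0 < 1 - s := by linarith
  have hsmall : ∫⁻ z in Ioc (0:ℝ) 2, ENNReal.ofReal ((2 - 2 * Real.cos z) / |z| ^ (1 + 2 * s)) ≤
      ENNReal.ofReal (2 ^ (2 - 2 * s) / (2 - 2 * s)) := by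
    have hint : IntegrableOn (fun z : ℝ => z ^ (1 - 2 * s)) (Ioc 0 2) :=
      (intervalIntegrable_iff_integrableOn_Ioc_of_le two_pos.le).1
        (intervalIntegral.intervalIntegrable_rpow' (by linarith))
    calc _ ≤ ∫⁻ z in Ioc (0:ℝ) 2, ENNReal.ofReal (z ^ (1 - 2 * s)) := by
          refine setLIntegral_mono' measurableSet_Ioc fun z hz => ENNReal.ofReal_le_ofReal ?_
          rw [abs_of_pos hz.1, div_le_iff₀ (Real.rpow_pos_of_pos hz.1 _), ← Real.rpow_add hz.1,
            show 1 - 2 * s + (1 + 2 * s) = (2:ℕ) by norm_num, Real.rpow_natCast]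
          linarith [Real.one_sub_sq_div_two_le_cos (x := z)]
      _ = ENNReal.ofReal (∫ z in Ioc (0:ℝ) 2, z ^ (1 - 2 * s)) :=
          (ofReal_integral_eq_lintegral_ofReal hint ((ae_restrict_mem measurableSet_Ioc).mono
            fun z hz => Real.rpow_nonneg hz.1.le _)).symm
      _ = _ := by
          rw [← intervalIntegral.integral_of_le two_pos.le, integral_rpow (Or.inl (by linarith)),
            Real.zero_rpow (by linarith), sub_zero]
          ring_nf
  have hlarge : ∫⁻ z in Ioi (2:ℝ), ENNReal.ofReal ((2 - 2 * Real.cos z) / |z| ^ (1 + 2 * s)) ≤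
      ENNReal.ofReal (2 ^ (2 - 2 * s) / (2 * s)) := by
    have hint : IntegrableOn (fun z : ℝ => 4 * z ^ (-(1 + 2 * s))) (Ioi 2) :=
      (integrableOn_Ioi_rpow_of_lt (by linarith) two_pos).const_mul 4
    calc _ ≤ ∫⁻ z in Ioi (2:ℝ), ENNReal.ofReal (4 * z ^ (-(1 + 2 * s))) := by
          refine setLIntegral_mono' measurableSet_Ioi fun z hz => ENNReal.ofReal_le_ofReal ?_
          have hz0 : 0 < z := two_pos.trans hz
          rw [abs_of_pos hz0, Real.rpow_neg hz0.le, div_eq_mul_inv]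
          have : 0 < (z ^ (1 + 2 * s))⁻¹ := by positivity
          gcongr
          linarith [Real.neg_one_le_cos z]
      _ = ENNReal.ofReal (∫ z in Ioi (2:ℝ), 4 * z ^ (-(1 + 2 * s))) :=
          (ofReal_integral_eq_lintegral_ofReal hint ((ae_restrict_mem measurableSet_Ioi).mono
            fun z hz => by
              have := Real.rpow_nonneg (two_pos.trans hz).le (-(1 + 2 * s))
              positivity)).symm
      _ = _ := by
          rw [integral_const_mul, integral_Ioi_rpow_of_lt (by linarith) two_pos]
          congr 1
          have e : (2:ℝ) ^ (2 - 2 * s) = 4 * 2 ^ (-(2 * s)) := by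
            rw [show (2 - 2 * s) = 2 + -(2 * s) by ring, Real.rpow_add two_pos]
            norm_num
          rw [e, show -(1 + 2 * s) + 1 = -(2 * s) by ring, neg_div_neg_eq]
          ring
  have heven := lintegral_eq_two_mul_of_even
    (g := fun z : ℝ => ENNReal.ofReal ((2 - 2 * Real.cos z) / |z| ^ (1 + 2 * s)))
    (fun z => by simp)
  rw [dConst, heven, ← Ioc_union_Ioi_eq_Ioi (two_pos (α := ℝ)).le,
    lintegral_union measurableSet_Ioi (Ioc_disjoint_Ioi le_rfl)]
  have h2 : 0 < 2 - 2 * s := by linarith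
  refine (mul_le_mul_right (add_le_add hsmall hlarge) _).trans ?_
  rw [← ENNReal.ofReal_add (by positivity) (by positivity),
    show (2:ℝ≥0∞) = ENNReal.ofReal 2 by simp, ← ENNReal.ofReal_mul (by norm_num)]
  refine ENNReal.ofReal_le_ofReal (le_of_eq ?_)
  rw [show 2 - 2 * s = 2 * (1 - s) by ring]
  field_simp
  ring

/-- The kernel `|h|^(-1-2s)` has the Fourier multiplier `d_s |w|^(2s)`, by scaling. -/
theorem lintegral_cos_kernel {s : ℝ} (w : ℝ) (hw : 0 < w) :
    ∫⁻ h : ℝ, ENNReal.ofReal ((2 - 2 * Real.cos (w * h)) / |h| ^ (1 + 2 * s)) =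
      ENNReal.ofReal (w ^ (2 * s)) * dConst s := by
  have himg : (fun t : ℝ => w * t) '' univ = univ :=
    image_univ_of_surjective (mul_left_surjective₀ hw.ne')
  have h := lintegral_image_const_mul hw MeasurableSet.univ
    (fun z => ENNReal.ofReal ((2 - 2 * Real.cos z) / |z| ^ (1 + 2 * s)))
  rw [himg, setLIntegral_univ, setLIntegral_univ] at h
  rw [dConst, h, ← mul_assoc, ← ENNReal.ofReal_mul (by positivity),
    ← lintegral_const_mul' _ _ ENNReal.ofReal_ne_top]
  refine lintegral_congr fun z => ?_
  rw [← ENNReal.ofReal_mul (by positivity)]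
  congr 1
  rw [abs_mul, abs_of_pos hw, Real.mul_rpow hw.le (abs_nonneg _)]
  have e : w ^ (1 + 2 * s) = w * w ^ (2 * s) := by
    rw [Real.rpow_add hw, Real.rpow_one]
  rw [e]
  field_simp

/-! ### Cosine and sine expansions -/

section Cosine

/-- The frequencies `n π / 2` of functions of period `4`. -/
def freq (n : ℝ) : ℝ := n * (Real.pi / 2)

theorem freq_neg (n : ℝ) : freq (-n) = -freq n := by simp [freq]

theorem hasSum_of_eq {ι : Type*} {f g : ι → ℝ} {a b : ℝ} (hf : HasSum f a)
    (hfg : ∀ i, g i = f i) (hab : b = a) : HasSum g b := by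
  rw [hab, funext hfg]; exact hf

/-- Parseval's identity on `(-2, 2)` for a real function, in terms of sines and cosines. -/
theorem hasSum_parseval_real {g : ℝ → ℝ} (hg : MemLp g 2 (volume.restrict (Ioc (-2) 2))) :
    HasSum (fun n : ℤ => (∫ x in (-2:ℝ)..2, g x * Real.cos (freq n * x)) ^ 2 +
      (∫ x in (-2:ℝ)..2, g x * Real.sin (freq n * x)) ^ 2)
      (4 * ∫ x in (-2:ℝ)..2, g x ^ 2) := by
  have hab : (-2:ℝ) < 2 := by norm_num
  have hgC : MemLp (fun x => (g x : ℂ)) 2 (volume.restrict (Ioc (-2) 2)) := hg.ofReal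
  have hgi : IntervalIntegrable g volume (-2) 2 := by
    rw [intervalIntegrable_iff_integrableOn_Ioc_of_le hab.le]
    exact hg.integrable (by norm_num)
  have h := (hasSum_sq_fourierCoeffOn hab hgC).mul_left 16
  have e2 : (16:ℝ) * ((2 - (-2:ℝ))⁻¹ • ∫ x in (-2:ℝ)..2, ‖(g x : ℂ)‖ ^ 2) =
      4 * ∫ x in (-2:ℝ)..2, g x ^ 2 := by
    simp only [Complex.norm_real, Real.norm_eq_abs, sq_abs, smul_eq_mul]
    norm_num
    ring
  rw [e2] at h
  refine hasSum_of_eq h (fun n => ?_) rfl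
  have hc : IntervalIntegrable (fun x => g x * Real.cos (freq n * x)) volume (-2) 2 :=
    hgi.mul_continuousOn (by fun_prop)
  have hs : IntervalIntegrable (fun x => g x * Real.sin (freq n * x)) volume (-2) 2 :=
    hgi.mul_continuousOn (by fun_prop)
  have hcoef : fourierCoeffOn hab (fun x => (g x : ℂ)) n = (1 / 4 : ℝ) •
      (((∫ x in (-2:ℝ)..2, g x * Real.cos (freq n * x) : ℝ) : ℂ) -
        ((∫ x in (-2:ℝ)..2, g x * Real.sin (freq n * x) : ℝ) : ℂ) * Complex.I) := by
    rw [fourierCoeffOn_eq_integral, ← intervalIntegral.integral_ofReal,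
      ← intervalIntegral.integral_ofReal, ← intervalIntegral.integral_mul_const,
      ← intervalIntegral.integral_sub]
    · congr 1
      · norm_num
      · refine intervalIntegral.integral_congr fun x _ => ?_
        simp only [smul_eq_mul]
        rw [fourier_coe_apply]
        have : (2 * Real.pi * Complex.I * ((-n : ℤ) : ℂ) * (x : ℂ) / ((2 - (-2:ℝ) : ℝ) : ℂ)) =
            ((-(freq n * x) : ℝ) : ℂ) * Complex.I := by
          simp only [freq]
          push_cast
          ring
        rw [this, Complex.exp_mul_I, ← Complex.ofReal_cos, ← Complex.ofReal_sin, Real.cos_neg,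
          Real.sin_neg]
        push_cast
        ring
    · exact ⟨hc.1.ofReal, hc.2.ofReal⟩
    · exact IntervalIntegrable.mul_const ⟨hs.1.ofReal, hs.2.ofReal⟩ _
  rw [hcoef, norm_smul, mul_pow, ← Complex.normSq_eq_norm_sq, Complex.normSq_apply]
  simp
  ring

theorem hasSum_nat_of_hasSum_int_even {f : ℤ → ℝ} {a : ℝ} (hf : HasSum f a)
    (heven : ∀ n, f (-n) = f n) : HasSum (fun n : ℕ => 2 * f n) (a + f 0) := by
  refine hasSum_of_eq hf.nat_add_neg (fun n => ?_) rfl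
  rw [heven, two_mul]

/-- The interval integral of an even function over a symmetric interval. -/
theorem integral_symm_of_even {g : ℝ → ℝ} (hg : IntervalIntegrable g volume (-2) 2)
    (heven : ∀ x, g (-x) = g x) : ∫ x in (-2:ℝ)..2, g x = 2 * ∫ x in (0:ℝ)..2, g x := by
  have h1 : IntervalIntegrable g volume (-2) 0 :=
    hg.mono_set (by
      rw [uIcc_of_le (by norm_num), uIcc_of_le (by norm_num)]
      exact Icc_subset_Icc le_rfl (by norm_num))
  have h2 : IntervalIntegrable g volume 0 2 :=
    hg.mono_set (by
      rw [uIcc_of_le (by norm_num), uIcc_of_le (by norm_num)]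
      exact Icc_subset_Icc (by norm_num) le_rfl)
  rw [← intervalIntegral.integral_add_adjacent_intervals h1 h2]
  have : ∫ x in (-2:ℝ)..0, g x = ∫ x in (0:ℝ)..2, g x := by
    have := intervalIntegral.integral_comp_neg (a := 0) (b := 2) g
    simp only [heven, neg_zero] at this
    exact this.symm
  rw [this, two_mul]

theorem integral_symm_of_odd {g : ℝ → ℝ} (hodd : ∀ x, g (-x) = -g x) :
    ∫ x in (-2:ℝ)..2, g x = 0 := by
  have := intervalIntegral.integral_comp_neg (a := -2) (b := 2) g
  simp only [hodd, neg_neg, intervalIntegral.integral_neg] at this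
  linarith

/-- The cosine coefficients `∫_{-1}^1 v(x) cos (nπ(x+1)/2) dx` on the interval `(-1, 1)`. -/
def cosCoeff (v : ℝ → ℝ) (n : ℕ) : ℝ := ∫ x in (-1:ℝ)..1, v x * Real.cos (freq n * (x + 1))

/-- The sine coefficients `∫_{-1}^1 v(x) sin (nπ(x+1)/2) dx` on the interval `(-1, 1)`. -/
def sinCoeff (v : ℝ → ℝ) (n : ℕ) : ℝ := ∫ x in (-1:ℝ)..1, v x * Real.sin (freq n * (x + 1))

/-- The `4`-periodic triangle wave that is the identity on `[-1, 1]`; composing with it extends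
functions on `[-1, 1]` to `ℝ` by reflections at the end points. -/
def fold (t : ℝ) : ℝ := 2 / Real.pi * Real.arccos (Real.cos (Real.pi / 2 * (t + 1))) - 1

theorem continuous_fold : Continuous fold := by
  unfold fold
  have := Real.continuous_arccos
  fun_prop

theorem fold_mem (t : ℝ) : fold t ∈ Icc (-1:ℝ) 1 := by
  have h0 := Real.arccos_nonneg (Real.cos (Real.pi / 2 * (t + 1)))
  have h1 := Real.arccos_le_pi (Real.cos (Real.pi / 2 * (t + 1)))
  have hpi := Real.pi_pos
  unfold fold
  constructor
  · have : 0 ≤ 2 / Real.pi * Real.arccos (Real.cos (Real.pi / 2 * (t + 1))) := by positivity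
    linarith
  · have : 2 / Real.pi * Real.arccos (Real.cos (Real.pi / 2 * (t + 1))) ≤
        2 / Real.pi * Real.pi := by
      gcongr
    rw [div_mul_cancel₀ _ hpi.ne'] at this
    linarith

theorem fold_of_mem {t : ℝ} (ht : t ∈ Icc (-1:ℝ) 1) : fold t = t := by
  unfold fold
  rw [Real.arccos_cos]
  · field_simp; ring
  · have : 0 ≤ t + 1 := by linarith [ht.1]
    positivity
  · have : t + 1 ≤ 2 := by linarith [ht.2]
    calc Real.pi / 2 * (t + 1) ≤ Real.pi / 2 * 2 := by gcongr
      _ = Real.pi := by ring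

theorem fold_add_four (t : ℝ) : fold (t + 4) = fold t := by
  unfold fold
  rw [show Real.pi / 2 * (t + 4 + 1) = Real.pi / 2 * (t + 1) + 2 * Real.pi by ring,
    Real.cos_add_two_pi]

theorem fold_reflect_left (t : ℝ) : fold (-2 - t) = fold t := by
  unfold fold
  rw [show Real.pi / 2 * (-2 - t + 1) = -(Real.pi / 2 * (t + 1)) by ring, Real.cos_neg]

theorem fold_reflect_right (t : ℝ) : fold (2 - t) = fold t := by
  rw [← fold_reflect_left, ← fold_add_four]
  congr 1
  ring

theorem integral_zero_two_eq {g : ℝ → ℝ} :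
    ∫ x in (0:ℝ)..2, g (x - 1) = ∫ x in (-1:ℝ)..1, g x := by
  rw [intervalIntegral.integral_comp_sub_right]
  norm_num

variable {v : ℝ → ℝ}

theorem continuous_comp_fold (hv : ContinuousOn v (Icc (-1) 1)) :
    Continuous (fun t => v (fold t)) :=
  hv.comp_continuous continuous_fold fold_mem

theorem integral_fold_mul_cos (hv : ContinuousOn v (Icc (-1) 1)) (n : ℤ) :
    ∫ x in (-2:ℝ)..2, v (fold (x - 1)) * Real.cos (freq n * x) = 2 * cosCoeff v n.natAbs := by
  have hV := continuous_comp_fold hv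
  have hcont : Continuous fun x => v (fold (x - 1)) * Real.cos (freq n * x) := by
    exact (hV.comp (continuous_id.sub continuous_const)).mul (by fun_prop)
  rw [integral_symm_of_even (hcont.intervalIntegrable _ _)]
  · congr 1
    have := integral_zero_two_eq (g := fun x => v (fold x) * Real.cos (freq n * (x + 1)))
    simp only [sub_add_cancel] at this
    rw [this, cosCoeff]
    refine intervalIntegral.integral_congr fun x hx => ?_
    rw [uIcc_of_le (by norm_num)] at hx
    simp only [fold_of_mem hx]
    congr 1
    rcases Int.natAbs_eq n with h | h
    · rw [h]; simp
    · rw [h]; simp [freq_neg]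
  · intro x
    rw [mul_neg, Real.cos_neg, show -x - 1 = -2 - (x - 1) by ring, fold_reflect_left]

theorem integral_fold_mul_sin (n : ℤ) :
    ∫ x in (-2:ℝ)..2, v (fold (x - 1)) * Real.sin (freq n * x) = 0 := by
  refine integral_symm_of_odd fun x => ?_
  rw [mul_neg, Real.sin_neg, show -x - 1 = -2 - (x - 1) by ring, fold_reflect_left, mul_neg]

theorem freq_mul_period (n : ℤ) (x : ℝ) : freq n * (x + 4) = freq n * x + n * (2 * Real.pi) := by
  unfold freq; ring

/-- Parseval's identity for the differences of the reflected extension of `v`. -/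
theorem hasSum_integral_sq_difference (hv : ContinuousOn v (Icc (-1) 1)) (h : ℝ) :
    HasSum (fun n : ℕ => 2 * ((2 - 2 * Real.cos (freq n * h)) * cosCoeff v n ^ 2))
      (∫ x in (-2:ℝ)..2, (v (fold (x + h - 1)) - v (fold (x - 1))) ^ 2) := by
  have hV := continuous_comp_fold hv
  have hV1 : Continuous fun x : ℝ => v (fold (x - 1)) :=
    hV.comp (continuous_id.sub continuous_const)
  have hV2 : Continuous fun x : ℝ => v (fold (x + h - 1)) :=
    hV1.comp (continuous_id.add continuous_const)
  have hmem : MemLp (fun x => v (fold (x + h - 1)) - v (fold (x - 1))) 2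
      (volume.restrict (Ioc (-2) 2)) := by
    refine MemLp.mono_measure (Measure.restrict_mono_set _ Ioc_subset_Icc_self) ?_
    obtain ⟨C, hC⟩ := isCompact_Icc.exists_bound_of_continuousOn
      (hV2.sub hV1).continuousOn (s := Icc (-2:ℝ) 2)
    exact MemLp.of_bound (hV2.sub hV1).aestronglyMeasurable C
      ((ae_restrict_mem measurableSet_Icc).mono hC)
  have hP := hasSum_parseval_real hmem
  -- translation multiplies the Fourier coefficients by a phase
  have htrans : ∀ k : ℝ → ℝ, (∀ x, k (x + 4) = k x) →
      ∫ x in (-2:ℝ)..2, v (fold (x + h - 1)) * k x =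
        ∫ x in (-2:ℝ)..2, v (fold (x - 1)) * k (x - h) := by
    intro k hper
    have e1 := intervalIntegral.integral_comp_add_right (a := -2) (b := 2)
      (fun x => v (fold (x - 1)) * k (x - h)) h
    simp only [add_sub_cancel_right] at e1
    rw [e1]
    have hp : Function.Periodic (fun x => v (fold (x - 1)) * k (x - h)) 4 := by
      intro x
      simp only
      rw [show x + 4 - h = x - h + 4 by ring, hper, show x + 4 - 1 = x - 1 + 4 by ring,
        fold_add_four]
    have := hp.intervalIntegral_add_eq (-2 + h) (-2)
    rw [show -2 + h + 4 = 2 + h by ring, show (-2:ℝ) + 4 = 2 by norm_num] at this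
    exact this
  have hcosper : ∀ (n : ℤ) (x : ℝ), Real.cos (freq n * (x + 4)) = Real.cos (freq n * x) :=
    fun n x => by rw [freq_mul_period, Real.cos_add_int_mul_two_pi]
  have hsinper : ∀ (n : ℤ) (x : ℝ), Real.sin (freq n * (x + 4)) = Real.sin (freq n * x) :=
    fun n x => by rw [freq_mul_period, Real.sin_add_int_mul_two_pi]
  have hA : ∀ n : ℤ, ∫ x in (-2:ℝ)..2,
      (v (fold (x + h - 1)) - v (fold (x - 1))) * Real.cos (freq n * x) =
      (Real.cos (freq n * h) - 1) * (2 * cosCoeff v n.natAbs) := by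
    intro n
    have i1 : IntervalIntegrable (fun x => v (fold (x - 1)) * Real.cos (freq n * x))
      volume (-2) 2 :=
      (hV1.mul (by fun_prop)).intervalIntegrable _ _
    have i2 : IntervalIntegrable (fun x => v (fold (x - 1)) * Real.sin (freq n * x))
      volume (-2) 2 :=
      (hV1.mul (by fun_prop)).intervalIntegrable _ _
    have i3 : IntervalIntegrable (fun x => v (fold (x + h - 1)) * Real.cos (freq n * x))
      volume (-2) 2 := (hV2.mul (by fun_prop)).intervalIntegrable _ _
    simp only [sub_mul]
    rw [intervalIntegral.integral_sub i3 i1,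
      htrans (fun x => Real.cos (freq n * x)) (hcosper n)]
    have : ∀ x, v (fold (x - 1)) * Real.cos (freq n * (x - h)) =
        Real.cos (freq n * h) * (v (fold (x - 1)) * Real.cos (freq n * x)) +
        Real.sin (freq n * h) * (v (fold (x - 1)) * Real.sin (freq n * x)) := fun x => by
      rw [mul_sub, Real.cos_sub]; ring
    simp only [this]
    rw [intervalIntegral.integral_add (i1.const_mul _) (i2.const_mul _),
      intervalIntegral.integral_const_mul, intervalIntegral.integral_const_mul,
      integral_fold_mul_sin, integral_fold_mul_cos hv]
    ring
  have hB : ∀ n : ℤ, ∫ x in (-2:ℝ)..2,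
      (v (fold (x + h - 1)) - v (fold (x - 1))) * Real.sin (freq n * x) =
      -Real.sin (freq n * h) * (2 * cosCoeff v n.natAbs) := by
    intro n
    have i1 : IntervalIntegrable (fun x => v (fold (x - 1)) * Real.cos (freq n * x))
      volume (-2) 2 :=
      (hV1.mul (by fun_prop)).intervalIntegrable _ _
    have i2 : IntervalIntegrable (fun x => v (fold (x - 1)) * Real.sin (freq n * x))
      volume (-2) 2 :=
      (hV1.mul (by fun_prop)).intervalIntegrable _ _
    have i3 : IntervalIntegrable (fun x => v (fold (x + h - 1)) * Real.sin (freq n * x))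
      volume (-2) 2 := (hV2.mul (by fun_prop)).intervalIntegrable _ _
    simp only [sub_mul]
    rw [intervalIntegral.integral_sub i3 i2,
      htrans (fun x => Real.sin (freq n * x)) (hsinper n)]
    have : ∀ x, v (fold (x - 1)) * Real.sin (freq n * (x - h)) =
        Real.cos (freq n * h) * (v (fold (x - 1)) * Real.sin (freq n * x)) -
        Real.sin (freq n * h) * (v (fold (x - 1)) * Real.cos (freq n * x)) := fun x => by
      rw [mul_sub, Real.sin_sub]; ring
    simp only [this]
    rw [intervalIntegral.integral_sub (i2.const_mul _) (i1.const_mul _),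
      intervalIntegral.integral_const_mul, intervalIntegral.integral_const_mul,
      integral_fold_mul_sin, integral_fold_mul_cos hv]
    ring
  simp only [hA, hB] at hP
  have hP2 := hasSum_nat_of_hasSum_int_even hP (fun n => by
    simp [freq_neg])
  refine hasSum_of_eq (hP2.mul_left (1 / 4)) (fun n => ?_) ?_
  · simp only [Int.natAbs_natCast, Int.cast_natCast]
    linear_combination (-2 * cosCoeff v n ^ 2) * Real.sin_sq_add_cos_sq (freq n * h)
  · simp [freq]

theorem memLp_two_of_continuousOn {a b : ℝ} (hv : ContinuousOn v (Icc a b)) :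
    MemLp v 2 (volume.restrict (Icc a b)) := by
  obtain ⟨C, hC⟩ := isCompact_Icc.exists_bound_of_continuousOn hv
  exact MemLp.of_bound (hv.aestronglyMeasurable measurableSet_Icc) C
    ((ae_restrict_mem measurableSet_Icc).mono hC)

/-- Parseval's identity for cosine series on `(-1, 1)`. -/
theorem hasSum_sq_cosCoeff (hv : ContinuousOn v (Icc (-1) 1)) :
    HasSum (fun n : ℕ => cosCoeff v n ^ 2)
      ((∫ x in (-1:ℝ)..1, v x ^ 2) + (∫ x in (-1:ℝ)..1, v x) ^ 2 / 2) := by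
  have hV := continuous_comp_fold hv
  have hV1 : Continuous fun x : ℝ => v (fold (x - 1)) :=
    hV.comp (continuous_id.sub continuous_const)
  have hP := hasSum_parseval_real ((memLp_two_of_continuousOn
    (hV1.continuousOn (s := Icc (-2) 2))).mono_measure
      (Measure.restrict_mono_set _ Ioc_subset_Icc_self))
  simp only [integral_fold_mul_cos hv, integral_fold_mul_sin] at hP
  rw [integral_symm_of_even (g := fun x => v (fold (x - 1)) ^ 2)
    ((hV1.pow 2).intervalIntegrable _ _) (fun x => by
    rw [show -x - 1 = -2 - (x - 1) by ring, fold_reflect_left]),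
    integral_zero_two_eq (g := fun x => v (fold x) ^ 2)] at hP
  have hP2 := (hasSum_nat_of_hasSum_int_even hP (fun n => by simp)).mul_left (1 / 8)
  refine hasSum_of_eq hP2 (fun n => ?_) ?_
  · simp only [Int.natAbs_natCast]
    ring
  · have e : ∫ x in (-1:ℝ)..1, v (fold x) ^ 2 = ∫ x in (-1:ℝ)..1, v x ^ 2 := by
      refine intervalIntegral.integral_congr fun x hx => ?_
      rw [uIcc_of_le (by norm_num)] at hx
      simp only [fold_of_mem hx]
    rw [e]
    simp [cosCoeff, freq]
    ring

/-- Parseval's identity for sine series on `(-1, 1)`. -/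
theorem hasSum_sq_sinCoeff (hv : ContinuousOn v (Icc (-1) 1)) :
    HasSum (fun n : ℕ => sinCoeff v n ^ 2) (∫ x in (-1:ℝ)..1, v x ^ 2) := by
  have hV := continuous_comp_fold hv
  have hV1 : Continuous fun x : ℝ => v (fold (x - 1)) :=
    hV.comp (continuous_id.sub continuous_const)
  set g : ℝ → ℝ := fun x => (SignType.sign x : ℝ) * v (fold (x - 1)) with hg
  have hsign : ∀ x : ℝ, ((SignType.sign (-x) : SignType) : ℝ) = -(SignType.sign x : ℝ) :=
    fun x => by rw [Left.sign_neg]; simp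
  have hgodd : ∀ x, g (-x) = -g x := fun x => by
    simp only [hg]
    rw [hsign, show -x - 1 = -2 - (x - 1) by ring, fold_reflect_left, neg_mul]
  have hgpos : ∀ x ∈ Ioc (0:ℝ) 2, g x = v (x - 1) := fun x hx => by
    simp only [hg]
    rw [sign_pos hx.1, fold_of_mem ⟨by linarith [hx.1], by linarith [hx.2]⟩]
    simp
  have hmem : MemLp g 2 (volume.restrict (Ioc (-2) 2)) := by
    have h1 := ((memLp_two_of_continuousOn (hV1.continuousOn (s := Icc (-2) 2))).mono_measure
      (Measure.restrict_mono_set _ Ioc_subset_Icc_self))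
    refine h1.mono ?_ (Eventually.of_forall fun x => ?_)
    · have hm : Measurable fun x : ℝ => ((SignType.sign x : SignType) : ℝ) := by
        have : (fun x : ℝ => ((SignType.sign x : SignType) : ℝ)) =
            fun x => if 0 < x then 1 else if x < 0 then -1 else 0 := by
          funext x
          rw [sign_apply]
          split_ifs <;> simp
        rw [this]
        exact Measurable.ite measurableSet_Ioi measurable_const
          (Measurable.ite measurableSet_Iio measurable_const measurable_const)
      exact hm.aestronglyMeasurable.mul h1.1
    · simp only [hg, norm_mul]
      have : ‖((SignType.sign x : SignType) : ℝ)‖ ≤ 1 := by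
        rcases lt_trichotomy x 0 with h | h | h
        · simp [sign_neg h]
        · simp [h]
        · simp [sign_pos h]
      exact mul_le_of_le_one_left (norm_nonneg _) this
  have hgi : IntervalIntegrable g volume (-2) 2 := by
    rw [intervalIntegrable_iff_integrableOn_Ioc_of_le (by norm_num)]
    exact hmem.integrable (by norm_num)
  have hP := hasSum_parseval_real hmem
  have hcos : ∀ n : ℤ, ∫ x in (-2:ℝ)..2, g x * Real.cos (freq n * x) = 0 := fun n =>
    integral_symm_of_odd fun x => by rw [hgodd, mul_neg, Real.cos_neg, neg_mul]
  have hsin : ∀ n : ℕ, ∫ x in (-2:ℝ)..2, g x * Real.sin (freq n * x) = 2 * sinCoeff v n := by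
    intro n
    rw [integral_symm_of_even (hgi.mul_continuousOn (by fun_prop)) (fun x => by
      rw [hgodd, mul_neg, Real.sin_neg, neg_mul_neg]), sinCoeff]
    congr 1
    have := integral_zero_two_eq (g := fun x => v x * Real.sin (freq n * (x + 1)))
    simp only [sub_add_cancel] at this
    rw [← this]
    refine intervalIntegral.integral_congr_ae (Eventually.of_forall fun x hx => ?_)
    rw [uIoc_of_le (by norm_num)] at hx
    rw [hgpos x hx]
  have hsq : ∫ x in (-2:ℝ)..2, g x ^ 2 = 2 * ∫ x in (-1:ℝ)..1, v x ^ 2 := by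
    rw [integral_symm_of_even _ (fun x => by rw [hgodd, neg_sq])]
    · congr 1
      rw [← integral_zero_two_eq (g := fun x => v x ^ 2)]
      refine intervalIntegral.integral_congr_ae (Eventually.of_forall fun x hx => ?_)
      rw [uIoc_of_le (by norm_num)] at hx
      rw [hgpos x hx]
    · rw [intervalIntegrable_iff_integrableOn_Ioc_of_le (by norm_num)]
      exact hmem.integrable_sq
  simp only [hcos, hsq] at hP
  have hP2 := (hasSum_nat_of_hasSum_int_even hP (fun n => by
    have : ∀ x : ℝ, g x * Real.sin (freq ((-n : ℤ) : ℝ) * x) =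
      -(g x * Real.sin (freq n * x)) := fun x => by
        push_cast; rw [freq_neg, neg_mul, Real.sin_neg, mul_neg]
    simp only [this, intervalIntegral.integral_neg, neg_sq])).mul_left (1 / 8)
  refine hasSum_of_eq hP2 (fun n => ?_) ?_
  · simp only [Int.cast_natCast, hsin]
    ring
  · simp [freq]
    ring

/-! ### The Gagliardo seminorm in terms of cosine coefficients -/

theorem measurableSet_base : MeasurableSet base := measurableSet_Ioo

theorem lintegral_Ioo_ofReal {f : ℝ → ℝ} {a b : ℝ} (hab : a ≤ b) (hf : ContinuousOn f (Icc a b))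
    (h0 : ∀ x ∈ Ioo a b, 0 ≤ f x) :
    ∫⁻ x in Ioo a b, ENNReal.ofReal (f x) = ENNReal.ofReal (∫ x in a..b, f x) := by
  rw [intervalIntegral.integral_of_le hab, integral_Ioc_eq_integral_Ioo,
    ofReal_integral_eq_lintegral_ofReal (hf.integrableOn_Icc.mono_set Ioo_subset_Icc_self)
      ((ae_restrict_mem measurableSet_Ioo).mono h0)]

theorem hasSum_sq_cosCoeff_succ (hv : ContinuousOn v (Icc (-1) 1)) :
    HasSum (fun n : ℕ => cosCoeff v (n + 1) ^ 2)
      ((∫ x in (-1:ℝ)..1, v x ^ 2) - (∫ x in (-1:ℝ)..1, v x) ^ 2 / 2) := by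
  have h := (hasSum_nat_add_iff' (f := fun n => cosCoeff v n ^ 2) 1).2 (hasSum_sq_cosCoeff hv)
  refine hasSum_of_eq h (fun n => rfl) ?_
  simp [cosCoeff, freq]
  ring

/-- `∫∫ (v(x) - v(y))² dx dy` over the square, in terms of cosine coefficients. -/
theorem lintegral_sq_sub (hv : ContinuousOn v (Icc (-1) 1)) :
    ∫⁻ x in base, ∫⁻ y in base, ENNReal.ofReal ((v x - v y) ^ 2) =
      4 * ∑' n : ℕ, ENNReal.ofReal (cosCoeff v (n + 1) ^ 2) := by
  have hI : ∀ f : ℝ → ℝ, ContinuousOn f (Icc (-1) 1) → IntervalIntegrable f volume (-1) 1 :=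
    fun f hf => ContinuousOn.intervalIntegrable (by rwa [uIcc_of_le (by norm_num)])
  set Q := ∫ x in (-1:ℝ)..1, v x ^ 2
  set M := ∫ x in (-1:ℝ)..1, v x
  have hinner : ∀ c, ∫⁻ y in base, ENNReal.ofReal ((c - v y) ^ 2) =
      ENNReal.ofReal (2 * c ^ 2 - 2 * c * M + Q) := by
    intro c
    rw [base, lintegral_Ioo_ofReal (by norm_num) (by fun_prop) (fun x _ => sq_nonneg _)]
    congr 1
    have : ∀ y, (c - v y) ^ 2 = (c ^ 2 - 2 * c * v y) + v y ^ 2 := fun y => by ring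
    simp only [this]
    rw [intervalIntegral.integral_add (hI _ (by fun_prop)) (hI _ (by fun_prop)),
      intervalIntegral.integral_sub (hI _ (by fun_prop)) (hI _ (by fun_prop)),
      intervalIntegral.integral_const_mul]
    simp
    ring
  simp only [hinner]
  have hnn : ∀ c, 0 ≤ 2 * c ^ 2 - 2 * c * M + Q := by
    intro c
    have e : 2 * c ^ 2 - 2 * c * M + Q = ∫ y in (-1:ℝ)..1, (c - v y) ^ 2 := by
      have : ∀ y, (c - v y) ^ 2 = (c ^ 2 - 2 * c * v y) + v y ^ 2 := fun y => by ring
      simp only [this]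
      rw [intervalIntegral.integral_add (hI _ (by fun_prop)) (hI _ (by fun_prop)),
        intervalIntegral.integral_sub (hI _ (by fun_prop)) (hI _ (by fun_prop)),
        intervalIntegral.integral_const_mul]
      simp
      ring
    rw [e]
    exact intervalIntegral.integral_nonneg (by norm_num) fun y _ => sq_nonneg _
  rw [base, lintegral_Ioo_ofReal (by norm_num) (by fun_prop) (fun x _ => hnn _)]
  have hS := hasSum_sq_cosCoeff_succ hv
  rw [← ENNReal.ofReal_tsum_of_nonneg (fun n => sq_nonneg _) hS.summable, hS.tsum_eq,
    show (4:ℝ≥0∞) = ENNReal.ofReal 4 by simp, ← ENNReal.ofReal_mul (by norm_num)]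
  congr 1
  have : ∀ y, 2 * v y ^ 2 - 2 * v y * M + Q = (2 * v y ^ 2 - (2 * M) * v y) + Q := fun y => by ring
  simp only [this]
  rw [intervalIntegral.integral_add (hI _ (by fun_prop)) (hI _ (by fun_prop)),
      intervalIntegral.integral_sub (hI _ (by fun_prop)) (hI _ (by fun_prop)),
      intervalIntegral.integral_const_mul, intervalIntegral.integral_const_mul]
  simp
  ring

/-- The Gagliardo kernel of the reflected extension of `v`. -/
def foldKernel (s : ℝ) (v : ℝ → ℝ) (x y : ℝ) : ℝ≥0∞ :=
  ENNReal.ofReal ((v (fold x) - v (fold y)) ^ 2 / |x - y| ^ (1 + 2 * s))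

theorem measurable_foldKernel (hv : ContinuousOn v (Icc (-1) 1)) (s : ℝ) :
    Measurable (Function.uncurry (foldKernel s v)) := by
  have hV := (continuous_comp_fold hv).measurable
  unfold foldKernel Function.uncurry
  have h1 : Measurable fun q : ℝ × ℝ => |q.1 - q.2| ^ (1 + 2 * s) :=
    ((continuous_abs.comp (continuous_fst.sub continuous_snd)).measurable).pow_const _
  exact ((((hV.comp measurable_fst).sub (hV.comp measurable_snd)).pow_const 2).div
    h1).ennreal_ofReal

theorem lintegral_reflect (c : ℝ) {S : Set ℝ} (hS : MeasurableSet S) (g : ℝ → ℝ≥0∞) :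
    ∫⁻ x in (fun t => c - t) '' S, g x = ∫⁻ t in S, g (c - t) := by
  rw [lintegral_image_eq_lintegral_abs_deriv_mul (f := fun t => c - t) (f' := fun _ => -1) hS
    (fun x _ => by simpa using ((hasDerivAt_id x).const_sub c).hasDerivWithinAt)
    (fun x _ y _ h => by simpa using h)]
  simp

theorem gagliardo_eq_foldKernel (hv : ContinuousOn v (Icc (-1) 1)) (s : ℝ) :
    gagliardo s v = ∫⁻ x in base, ∫⁻ y in base, foldKernel s v x y := by
  have hcongr : gagliardo s v =
      ∫⁻ q in base ×ˢ base, Function.uncurry (foldKernel s v) q := by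
    refine setLIntegral_congr_fun (measurableSet_Ioo.prod measurableSet_Ioo) fun q hq => ?_
    simp only [Function.uncurry, foldKernel]
    rw [fold_of_mem (Ioo_subset_Icc_self hq.1), fold_of_mem (Ioo_subset_Icc_self hq.2)]
  rw [hcongr, Measure.volume_eq_prod, ← Measure.prod_restrict,
    lintegral_prod _ (measurable_foldKernel hv s).aemeasurable]
  rfl

/-- The interaction of a point with its nearest mirror images at both end points is bounded below,
by convexity of `z ↦ z^(-p)`. -/
theorem mirror_kernel_ge {p z : ℝ} (hp : 0 < p) (hz : z ∈ Ioo (0:ℝ) 4) :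
    2 * 2 ^ (-p) ≤ z ^ (-p) + (4 - z) ^ (-p) := by
  have h1 : 0 < z := hz.1
  have h2 : 0 < 4 - z := by linarith [hz.2]
  have e1 : z ^ (-p) = (z ^ (-p / 2)) ^ 2 := by
    rw [← Real.rpow_natCast, ← Real.rpow_mul h1.le]; congr 1; push_cast; ring
  have e2 : (4 - z) ^ (-p) = ((4 - z) ^ (-p / 2)) ^ 2 := by
    rw [← Real.rpow_natCast, ← Real.rpow_mul h2.le]; congr 1; push_cast; ring
  have e3 : (2:ℝ) ^ (-p) = 4 ^ (-p / 2) := by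
    rw [show (4:ℝ) = 2 ^ (2:ℝ) by norm_num, ← Real.rpow_mul two_pos.le]
    congr 1; ring
  have h3 : (4:ℝ) ^ (-p / 2) ≤ (z * (4 - z)) ^ (-p / 2) :=
    Real.rpow_le_rpow_of_nonpos (by positivity) (by nlinarith [sq_nonneg (z - 2)]) (by linarith)
  rw [Real.mul_rpow h1.le h2.le] at h3
  rw [e1, e2, e3]
  nlinarith [sq_nonneg (z ^ (-p / 2) - (4 - z) ^ (-p / 2))]

/-- Integrating `y` over `ℝ` instead of `(-1, 1)` adds at least the interaction with the two nearest
mirror images, in `(-3, -1)` and `(1, 3)`. -/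
theorem gagliardo_add_le_lintegral_foldKernel {s : ℝ} (hs : 0 < s)
    (hv : ContinuousOn v (Icc (-1) 1)) :
    gagliardo s v + ENNReal.ofReal (2 ^ (2 - 2 * s)) *
      ∑' n : ℕ, ENNReal.ofReal (cosCoeff v (n + 1) ^ 2) ≤
      ∫⁻ x in base, ∫⁻ y, foldKernel s v x y := by
  have hm := measurable_foldKernel hv s
  have hsec : ∀ x, Measurable (foldKernel s v x) := fun x => hm.of_uncurry_left
  have hconst : ENNReal.ofReal (2 ^ (2 - 2 * s)) *
      ∑' n : ℕ, ENNReal.ofReal (cosCoeff v (n + 1) ^ 2) =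
      ∫⁻ x in base, ∫⁻ y in base, ENNReal.ofReal (2 * 2 ^ (-(1 + 2 * s)) * (v x - v y) ^ 2) := by
    have h0 : (0:ℝ) ≤ 2 * 2 ^ (-(1 + 2 * s)) := by positivity
    simp only [ENNReal.ofReal_mul h0]
    simp only [lintegral_const_mul' _ _ ENNReal.ofReal_ne_top]
    rw [lintegral_sq_sub hv, ← mul_assoc, show (4:ℝ≥0∞) = ENNReal.ofReal 4 by simp,
      ← ENNReal.ofReal_mul (by positivity)]
    congr 2
    rw [show (2 - 2 * s) = 3 + (-(1 + 2 * s)) by ring, Real.rpow_add two_pos]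
    norm_num
    ring
  rw [hconst, gagliardo_eq_foldKernel hv, ← lintegral_add_left]
  swap
  · exact hm.lintegral_prod_right (ν := volume.restrict base)
  refine setLIntegral_mono' measurableSet_Ioo fun x hx => ?_
  have hdisj1 : Disjoint (Ioo (-3:ℝ) (-1) ∪ base) (Ioo 1 3) := by
    rw [base, disjoint_union_left]
    constructor <;>
    · rw [Set.disjoint_left]; rintro y ⟨_, h⟩ ⟨h', _⟩; linarith
  have hdisj2 : Disjoint (Ioo (-3:ℝ) (-1)) base := by
    rw [base, Set.disjoint_left]; rintro y ⟨_, h⟩ ⟨h', _⟩; linarith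
  have himg1 : Ioo (-3:ℝ) (-1) = (fun t => -2 - t) '' base := by
    rw [base, image_const_sub_Ioo]; norm_num
  have himg2 : Ioo (1:ℝ) 3 = (fun t => 2 - t) '' base := by
    rw [base, image_const_sub_Ioo]; norm_num
  calc (∫⁻ y in base, foldKernel s v x y) +
        ∫⁻ y in base, ENNReal.ofReal (2 * 2 ^ (-(1 + 2 * s)) * (v x - v y) ^ 2)
      ≤ (∫⁻ y in base, foldKernel s v x y) + ∫⁻ y in base,
          (foldKernel s v x (-2 - y) + foldKernel s v x (2 - y)) := by
        gcongr (_ + ?_)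
        refine setLIntegral_mono' measurableSet_Ioo fun y hy => ?_
        simp only [foldKernel, fold_reflect_left, fold_reflect_right]
        rw [← ENNReal.ofReal_add (by positivity) (by positivity),
          fold_of_mem (Ioo_subset_Icc_self hx), fold_of_mem (Ioo_subset_Icc_self hy)]
        refine ENNReal.ofReal_le_ofReal ?_
        have hz : x + y + 2 ∈ Ioo (0:ℝ) 4 := ⟨by linarith [hx.1, hy.1], by linarith [hx.2, hy.2]⟩
        have h1 : 0 < 4 - (x + y + 2) := by linarith [hz.2]
        have e1 : |x - (-2 - y)| = x + y + 2 := by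
          rw [abs_of_pos (by linarith [hz.1])]; ring
        have e2 : |x - (2 - y)| = 4 - (x + y + 2) := by
          rw [abs_of_neg (by linarith [hz.2])]; ring
        rw [e1, e2, div_eq_mul_inv, div_eq_mul_inv, ← Real.rpow_neg hz.1.le,
          ← Real.rpow_neg h1.le, ← mul_add, mul_comm]
        gcongr
        exact mirror_kernel_ge (by linarith) hz
    _ = (∫⁻ y in base, foldKernel s v x y) + ((∫⁻ y in Ioo (-3) (-1), foldKernel s v x y) +
          ∫⁻ y in Ioo 1 3, foldKernel s v x y) := by
        rw [himg1, himg2, lintegral_reflect _ measurableSet_base,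
          lintegral_reflect _ measurableSet_base,
          lintegral_add_left (f := fun y => foldKernel s v x (-2 - y))
            ((hsec x).comp (measurable_const.sub measurable_id))]
    _ = ∫⁻ y in (Ioo (-3:ℝ) (-1) ∪ base) ∪ Ioo 1 3, foldKernel s v x y := by
        rw [lintegral_union measurableSet_Ioo hdisj1, lintegral_union measurableSet_base hdisj2]
        ring
    _ ≤ _ := setLIntegral_le_lintegral _ _

/-- By reflection, the two halves of a period contribute equally. -/
theorem two_mul_lintegral_foldKernel (v : ℝ → ℝ) (s : ℝ) :
    2 * ∫⁻ x in base, ∫⁻ y, foldKernel s v x y = ∫⁻ x in Ioo (-3) 1, ∫⁻ y, foldKernel s v x y := by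
  have hrefl : ∫⁻ x in Ioo (-3:ℝ) (-1), ∫⁻ y, foldKernel s v x y =
      ∫⁻ x in base, ∫⁻ y, foldKernel s v x y := by
    have himg1 : Ioo (-3:ℝ) (-1) = (fun t => -2 - t) '' base := by
      rw [base, image_const_sub_Ioo]; norm_num
    rw [himg1, lintegral_reflect _ measurableSet_base]
    refine setLIntegral_congr_fun measurableSet_base fun x _ => ?_
    rw [← lintegral_sub_left_eq_self _ (-2:ℝ)]
    refine lintegral_congr fun y => ?_
    simp only [foldKernel, fold_reflect_left]
    rw [show -2 - x - (-2 - y) = -(x - y) by ring, abs_neg]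
  have hunion : ∫⁻ x in Ioo (-3) 1, ∫⁻ y, foldKernel s v x y =
      (∫⁻ x in Ioo (-3:ℝ) (-1), ∫⁻ y, foldKernel s v x y) +
        ∫⁻ x in base, ∫⁻ y, foldKernel s v x y := by
    rw [setLIntegral_congr Ioo_ae_eq_Ioc, setLIntegral_congr (Ioo_ae_eq_Ioc (a := (-3:ℝ))), base,
      setLIntegral_congr (Ioo_ae_eq_Ioc (a := (-1:ℝ))),
      ← lintegral_union measurableSet_Ioc (Ioc_disjoint_Ioc_of_le le_rfl),
      Ioc_union_Ioc_eq_Ioc (by norm_num) (by norm_num)]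
  rw [hunion, hrefl, two_mul]

/-- The Gagliardo energy of the reflected extension over one period, by Parseval's identity for each
fixed difference `h = y - x`. -/
theorem lintegral_foldKernel_eq {s : ℝ} (hv : ContinuousOn v (Icc (-1) 1)) :
    ∫⁻ x in Ioo (-3) 1, ∫⁻ y, foldKernel s v x y =
      2 * (dConst s *
        ∑' n : ℕ, ENNReal.ofReal (freq (n + 1) ^ (2 * s) * cosCoeff v (n + 1) ^ 2)) := by
  have hV := continuous_comp_fold hv
  have hm := measurable_foldKernel hv s
  have hstep1 : ∫⁻ x in Ioo (-3) 1, ∫⁻ y, foldKernel s v x y =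
      ∫⁻ h, ∫⁻ x in Ioo (-3) 1, foldKernel s v x (x + h) := by
    have hm' : Measurable (Function.uncurry fun x h => foldKernel s v x (x + h)) := by
      have h2 : Measurable fun q : ℝ × ℝ => (q.1, q.1 + q.2) :=
        measurable_fst.prodMk (measurable_fst.add measurable_snd)
      have h3 : (Function.uncurry fun x h => foldKernel s v x (x + h)) =
          Function.uncurry (foldKernel s v) ∘ fun q : ℝ × ℝ => (q.1, q.1 + q.2) := by
        funext q
        simp only [Function.uncurry, Function.comp_apply]
      rw [h3]
      exact hm.comp h2
    calc _ = ∫⁻ x in Ioo (-3) 1, ∫⁻ h, foldKernel s v x (x + h) :=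
          lintegral_congr fun x => (lintegral_add_left_eq_self (foldKernel s v x) x).symm
      _ = _ := lintegral_lintegral_swap hm'.aemeasurable
  have hfreq : ∀ n : ℕ, 0 < freq ((n : ℝ) + 1) := fun n => by
    unfold freq; have := Real.pi_pos; positivity
  have hstep2 : ∀ h : ℝ, ∫⁻ x in Ioo (-3) 1, foldKernel s v x (x + h) =
      ∑' n : ℕ, ENNReal.ofReal (2 * cosCoeff v (n + 1) ^ 2) *
        ENNReal.ofReal ((2 - 2 * Real.cos (freq (n + 1) * h)) / |h| ^ (1 + 2 * s)) := by
    intro h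
    have hp : 0 ≤ (|h| ^ (1 + 2 * s))⁻¹ := by positivity
    have hsum := (hasSum_nat_add_iff' 1).2 (hasSum_integral_sq_difference hv h)
    simp only [Finset.sum_range_one, Nat.cast_zero] at hsum
    rw [show freq 0 * h = 0 by simp [freq], Real.cos_zero] at hsum
    norm_num at hsum
    have hc : Continuous fun x => (v (fold x) - v (fold (x + h))) ^ 2 :=
      (hV.sub (hV.comp (continuous_id.add continuous_const))).pow 2
    have hint : ∫ x in (-3:ℝ)..1, (v (fold x) - v (fold (x + h))) ^ 2 =
        ∫ x in (-2:ℝ)..2, (v (fold (x + h - 1)) - v (fold (x - 1))) ^ 2 := by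
      have := intervalIntegral.integral_comp_sub_right (a := -2) (b := 2)
        (fun x => (v (fold x) - v (fold (x + h))) ^ 2) 1
      rw [show (-2:ℝ) - 1 = -3 by norm_num, show (2:ℝ) - 1 = 1 by norm_num] at this
      rw [← this]
      refine intervalIntegral.integral_congr fun x _ => ?_
      rw [show x - 1 + h = x + h - 1 by ring]
      ring
    calc ∫⁻ x in Ioo (-3) 1, foldKernel s v x (x + h)
        = ∫⁻ x in Ioo (-3) 1, ENNReal.ofReal ((|h| ^ (1 + 2 * s))⁻¹) *
            ENNReal.ofReal ((v (fold x) - v (fold (x + h))) ^ 2) := by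
          refine lintegral_congr fun x => ?_
          rw [foldKernel, ← ENNReal.ofReal_mul hp, show x - (x + h) = -h by ring, abs_neg,
            div_eq_inv_mul]
      _ = ENNReal.ofReal ((|h| ^ (1 + 2 * s))⁻¹) * ∑' n : ℕ, ENNReal.ofReal
            (2 * ((2 - 2 * Real.cos (freq (n + 1) * h)) * cosCoeff v (n + 1) ^ 2)) := by
          rw [lintegral_const_mul' _ _ ENNReal.ofReal_ne_top,
            lintegral_Ioo_ofReal (by norm_num) hc.continuousOn (fun x _ => sq_nonneg _), hint,
            ← hsum.tsum_eq, ENNReal.ofReal_tsum_of_nonneg _ hsum.summable]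
          intro n
          have := two_sub_two_cos_nonneg (freq (n + 1) * h)
          positivity
      _ = _ := by
          rw [← ENNReal.tsum_mul_left]
          refine tsum_congr fun n => ?_
          rw [← ENNReal.ofReal_mul hp, ← ENNReal.ofReal_mul (by positivity)]
          congr 1
          rw [div_eq_mul_inv]
          ring
  rw [hstep1]
  simp only [hstep2]
  rw [lintegral_tsum]
  · rw [← ENNReal.tsum_mul_left, ← ENNReal.tsum_mul_left]
    refine tsum_congr fun n => ?_
    rw [lintegral_const_mul' _ _ ENNReal.ofReal_ne_top, lintegral_cos_kernel _ (hfreq n),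
      ENNReal.ofReal_mul zero_le_two, ENNReal.ofReal_mul (Real.rpow_nonneg (hfreq n).le _)]
    simp
    ring
  · intro n
    refine (Measurable.const_mul ?_ _).aemeasurable
    refine Measurable.ennreal_ofReal (Measurable.div (by fun_prop) ?_)
    exact continuous_abs.measurable.pow_const _

/-- The Gagliardo seminorm, together with the interaction with mirror images, is controlled by
the Fourier multiplier `d_s |ξ|^(2s)`. -/
theorem gagliardo_add_le {s : ℝ} (hs : 0 < s) (hv : ContinuousOn v (Icc (-1) 1)) :
    gagliardo s v + ENNReal.ofReal (2 ^ (2 - 2 * s)) *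
      ∑' n : ℕ, ENNReal.ofReal (cosCoeff v (n + 1) ^ 2) ≤
      dConst s * ∑' n : ℕ, ENNReal.ofReal (freq (n + 1) ^ (2 * s) * cosCoeff v (n + 1) ^ 2) := by
  refine (gagliardo_add_le_lintegral_foldKernel hs hv).trans ?_
  have h := two_mul_lintegral_foldKernel v s
  rw [lintegral_foldKernel_eq hv] at h
  exact ((ENNReal.mul_right_inj two_ne_zero ENNReal.ofNat_ne_top).1 h).le

end Cosine

/-! ### The inequality for functions smooth up to the boundary -/

section Rectangle

variable {φ : ℝ × ℝ → ℝ}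

theorem uniqueDiffOn_OmegaBar : UniqueDiffOn ℝ OmegaBar :=
  (uniqueDiffOn_Icc (by norm_num)).prod (uniqueDiffOn_Icc zero_lt_one)

theorem isOpen_Omega : IsOpen Omega := isOpen_Ioo.prod isOpen_Ioo

theorem measurableSet_Omega : MeasurableSet Omega := isOpen_Omega.measurableSet

theorem Omega_subset_OmegaBar : Omega ⊆ OmegaBar :=
  prod_mono Ioo_subset_Icc_self Ioo_subset_Icc_self

/-- The gradient of `φ` relative to the closed rectangle, defined up to the boundary. -/
def gradBar (φ : ℝ × ℝ → ℝ) (p : ℝ × ℝ) : ℝ × ℝ :=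
  (fderivWithin ℝ φ OmegaBar p (1, 0), fderivWithin ℝ φ OmegaBar p (0, 1))

theorem gradBar_eq_grad {p : ℝ × ℝ} (hp : p ∈ Omega) : gradBar φ p = grad φ p := by
  have : OmegaBar ∈ 𝓝 p := mem_of_superset (isOpen_Omega.mem_nhds hp) Omega_subset_OmegaBar
  simp [gradBar, grad, fderivWithin_of_mem_nhds this]

theorem SmoothUpToBoundary.continuousOn (hφ : SmoothUpToBoundary φ) : ContinuousOn φ OmegaBar :=
  ContDiffOn.continuousOn hφ

theorem SmoothUpToBoundary.continuousOn_gradBar (hφ : SmoothUpToBoundary φ) :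
    ContinuousOn (gradBar φ) OmegaBar := by
  have h : ContinuousOn (fderivWithin ℝ φ OmegaBar) OmegaBar :=
    ContDiffOn.continuousOn_fderivWithin hφ uniqueDiffOn_OmegaBar (by simp)
  exact (h.clm_apply continuousOn_const).prodMk (h.clm_apply continuousOn_const)

theorem SmoothUpToBoundary.differentiableAt (hφ : SmoothUpToBoundary φ) {p : ℝ × ℝ}
    (hp : p ∈ Omega) : DifferentiableAt ℝ φ p :=
  (ContDiffOn.differentiableOn hφ (by simp) p (Omega_subset_OmegaBar hp)).differentiableAt
    (mem_of_superset (isOpen_Omega.mem_nhds hp) Omega_subset_OmegaBar)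

theorem SmoothUpToBoundary.hasDerivAt_fst (hφ : SmoothUpToBoundary φ) {x y : ℝ}
    (hx : x ∈ Ioo (-1:ℝ) 1) (hy : y ∈ Ioo (0:ℝ) 1) :
    HasDerivAt (fun x => φ (x, y)) (gradBar φ (x, y)).1 x := by
  rw [gradBar_eq_grad (show (x, y) ∈ Omega from ⟨hx, hy⟩)]
  exact (hφ.differentiableAt (p := (x, y)) ⟨hx, hy⟩).hasFDerivAt.comp_hasDerivAt x
    ((hasDerivAt_id x).prodMk (hasDerivAt_const x y))

theorem SmoothUpToBoundary.hasDerivAt_snd (hφ : SmoothUpToBoundary φ) {x y : ℝ}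
    (hx : x ∈ Ioo (-1:ℝ) 1) (hy : y ∈ Ioo (0:ℝ) 1) :
    HasDerivAt (fun y => φ (x, y)) (gradBar φ (x, y)).2 y := by
  rw [gradBar_eq_grad (show (x, y) ∈ Omega from ⟨hx, hy⟩)]
  exact (hφ.differentiableAt (p := (x, y)) ⟨hx, hy⟩).hasFDerivAt.comp_hasDerivAt y
    ((hasDerivAt_const y x).prodMk (hasDerivAt_id y))

theorem ContinuousOn.slice_fst {F : ℝ × ℝ → ℝ} (hF : ContinuousOn F OmegaBar) {y : ℝ}
    (hy : y ∈ Icc (0:ℝ) 1) : ContinuousOn (fun x => F (x, y)) (Icc (-1) 1) :=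
  hF.comp (by fun_prop) fun _ hx => ⟨hx, hy⟩

theorem ContinuousOn.slice_snd {F : ℝ × ℝ → ℝ} (hF : ContinuousOn F OmegaBar) {x : ℝ}
    (hx : x ∈ Icc (-1:ℝ) 1) : ContinuousOn (fun y => F (x, y)) (Icc 0 1) :=
  hF.comp (by fun_prop) fun _ hy => ⟨hx, hy⟩

theorem exists_bound_OmegaBar {F : ℝ × ℝ → ℝ} (hF : ContinuousOn F OmegaBar) :
    ∃ C, ∀ p ∈ OmegaBar, ‖F p‖ ≤ C :=
  (isCompact_Icc.prod isCompact_Icc).exists_bound_of_continuousOn hF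

theorem aestronglyMeasurable_slice_mul_cos {F : ℝ × ℝ → ℝ} (hF : ContinuousOn F OmegaBar) {y : ℝ}
    (hy : y ∈ Icc (0:ℝ) 1) (n : ℕ) :
    AEStronglyMeasurable (fun x => F (x, y) * Real.cos (freq n * (x + 1)))
      (volume.restrict (uIoc (-1) 1)) := by
  have h1 := ContinuousOn.slice_fst hF hy
  have : ContinuousOn (fun x => F (x, y) * Real.cos (freq n * (x + 1))) (Icc (-1) 1) :=
    h1.mul (Continuous.continuousOn (by fun_prop))
  rw [uIoc_of_le (by norm_num)]
  exact (this.aestronglyMeasurable measurableSet_Icc).mono_measure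
    (Measure.restrict_mono_set _ Ioc_subset_Icc_self)

/-- The cosine coefficients of horizontal slices depend continuously on the height. -/
theorem continuousOn_cosCoeff_slice {F : ℝ × ℝ → ℝ} (hF : ContinuousOn F OmegaBar) (n : ℕ) :
    ContinuousOn (fun y => cosCoeff (fun x => F (x, y)) n) (Icc 0 1) := by
  obtain ⟨C, hC⟩ := exists_bound_OmegaBar hF
  intro y hy
  refine intervalIntegral.continuousWithinAt_of_dominated_interval (bound := fun _ => C) ?_ ?_
    intervalIntegrable_const ?_
  · exact eventually_of_mem self_mem_nhdsWithin fun z hz =>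
      aestronglyMeasurable_slice_mul_cos hF hz n
  · refine eventually_of_mem self_mem_nhdsWithin fun z hz => Eventually.of_forall fun x hx => ?_
    rw [uIoc_of_le (by norm_num)] at hx
    rw [norm_mul]
    calc ‖F (x, z)‖ * ‖Real.cos (freq n * (x + 1))‖ ≤ C * 1 := by
          gcongr
          · exact (norm_nonneg _).trans (hC (x, z) ⟨Ioc_subset_Icc_self hx, hz⟩)
          · exact hC (x, z) ⟨Ioc_subset_Icc_self hx, hz⟩
          · exact Real.abs_cos_le_one _
      _ = C := mul_one C
  · refine Eventually.of_forall fun x hx => ?_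
    rw [uIoc_of_le (by norm_num)] at hx
    exact (ContinuousOn.slice_snd hF (Ioc_subset_Icc_self hx) y hy).mul continuousWithinAt_const

theorem hasDerivAt_cosCoeff_slice (hφ : SmoothUpToBoundary φ) (n : ℕ) {y : ℝ}
    (hy : y ∈ Ioo (0:ℝ) 1) :
    HasDerivAt (fun y => cosCoeff (fun x => φ (x, y)) n)
      (cosCoeff (fun x => (gradBar φ (x, y)).2) n) y := by
  have hg : ContinuousOn (fun p => (gradBar φ p).2) OmegaBar :=
    continuous_snd.comp_continuousOn hφ.continuousOn_gradBar
  obtain ⟨C, hC⟩ := exists_bound_OmegaBar hg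
  have hyI := Ioo_subset_Icc_self hy
  have hc := ContinuousOn.slice_fst hφ.continuousOn hyI
  refine (intervalIntegral.hasDerivAt_integral_of_dominated_loc_of_deriv_le (μ := volume)
    (s := Ioo 0 1) (bound := fun _ => C) (a := -1) (b := 1)
    (F := fun y x => φ (x, y) * Real.cos (freq n * (x + 1)))
    (F' := fun y x => (gradBar φ (x, y)).2 * Real.cos (freq n * (x + 1)))
    (Ioo_mem_nhds hy.1 hy.2) ?_ ?_ ?_ ?_ intervalIntegrable_const ?_).2
  · filter_upwards [Ioo_mem_nhds hy.1 hy.2] with z hz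
    exact aestronglyMeasurable_slice_mul_cos hφ.continuousOn (Ioo_subset_Icc_self hz) n
  · refine ContinuousOn.intervalIntegrable ?_
    rw [uIcc_of_le (by norm_num)]
    exact hc.mul (Continuous.continuousOn (by fun_prop))
  · exact aestronglyMeasurable_slice_mul_cos hg hyI n
  · refine Eventually.of_forall fun x hx z hz => ?_
    rw [uIoc_of_le (by norm_num)] at hx
    rw [norm_mul]
    have hmem : (x, z) ∈ OmegaBar := ⟨Ioc_subset_Icc_self hx, Ioo_subset_Icc_self hz⟩
    calc ‖(gradBar φ (x, z)).2‖ * ‖Real.cos (freq n * (x + 1))‖ ≤ C * 1 := by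
          gcongr
          · exact (norm_nonneg _).trans (hC _ hmem)
          · exact hC _ hmem
          · exact Real.abs_cos_le_one _
      _ = C := mul_one C
  · have hne : ∀ᵐ x : ℝ, x ≠ 1 := by simp [ae_iff, measure_singleton]
    filter_upwards [hne] with x hx1 hx z hz
    rw [uIoc_of_le (by norm_num)] at hx
    exact (hφ.hasDerivAt_snd ⟨hx.1, lt_of_le_of_ne hx.2 hx1⟩ hz).mul_const _

/-- Integration by parts in `x`; the sines vanish at both end points. -/
theorem sinCoeff_gradBar (hφ : SmoothUpToBoundary φ) (n : ℕ) {y : ℝ} (hy : y ∈ Ioo (0:ℝ) 1) :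
    sinCoeff (fun x => (gradBar φ (x, y)).1) n = -(freq n * cosCoeff (fun x => φ (x, y)) n) := by
  have hg : ContinuousOn (fun p => (gradBar φ p).1) OmegaBar :=
    continuous_fst.comp_continuousOn hφ.continuousOn_gradBar
  have hyI := Ioo_subset_Icc_self hy
  have hgs := ContinuousOn.slice_fst hg hyI
  have hφs := ContinuousOn.slice_fst hφ.continuousOn hyI
  have hsin : ∀ x, HasDerivAt (fun x : ℝ => Real.sin (freq n * (x + 1)))
      (freq n * Real.cos (freq n * (x + 1))) x := fun x => by
    have h1 : HasDerivAt (fun x : ℝ => freq n * (x + 1)) (freq n) x := by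
      simpa using ((hasDerivAt_id x).add_const 1).const_mul (freq n)
    simpa [mul_comm] using h1.sin
  have i1 : IntervalIntegrable (fun x => (gradBar φ (x, y)).1 * Real.sin (freq n * (x + 1)))
      volume (-1) 1 := by
    refine ContinuousOn.intervalIntegrable ?_
    rw [uIcc_of_le (by norm_num)]
    exact hgs.mul (Continuous.continuousOn (by fun_prop))
  have i2 : IntervalIntegrable (fun x => φ (x, y) * (freq n * Real.cos (freq n * (x + 1))))
      volume (-1) 1 := by
    refine ContinuousOn.intervalIntegrable ?_
    rw [uIcc_of_le (by norm_num)]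
    exact hφs.mul (Continuous.continuousOn (by fun_prop))
  have hFTC := intervalIntegral.integral_eq_sub_of_hasDerivAt_of_le (a := -1) (b := 1)
    (f := fun x => φ (x, y) * Real.sin (freq n * (x + 1))) (by norm_num)
    (hφs.mul (Continuous.continuousOn (by fun_prop)))
    (fun x hx => (hφ.hasDerivAt_fst hx hy).mul (hsin x)) (i1.add i2)
  rw [intervalIntegral.integral_add i1 i2] at hFTC
  have e1 : Real.sin (freq n * (1 + 1)) = 0 := by
    rw [show freq n * (1 + 1) = n * Real.pi by unfold freq; ring, Real.sin_nat_mul_pi]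
  have e2 : ∫ x in (-1:ℝ)..1, φ (x, y) * (freq n * Real.cos (freq n * (x + 1))) =
      freq n * cosCoeff (fun x => φ (x, y)) n := by
    rw [cosCoeff, ← intervalIntegral.integral_const_mul]
    refine intervalIntegral.integral_congr fun x _ => ?_
    ring
  rw [e2, e1] at hFTC
  simp only [neg_add_cancel, mul_zero, Real.sin_zero, sub_zero] at hFTC
  rw [sinCoeff]
  linarith

theorem lintegral_Omega_eq {F : ℝ × ℝ → ℝ≥0∞} (hF : AEMeasurable F (volume.restrict Omega)) :
    ∫⁻ p in Omega, F p = ∫⁻ y in Ioo (0:ℝ) 1, ∫⁻ x in base, F (x, y) := by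
  rw [Measure.volume_eq_prod, Omega, ← Measure.prod_restrict] at *
  exact lintegral_prod_symm _ hF

theorem lintegral_Omega_eq' {F : ℝ × ℝ → ℝ≥0∞} (hF : AEMeasurable F (volume.restrict Omega)) :
    ∫⁻ p in Omega, F p = ∫⁻ x in base, ∫⁻ y in Ioo (0:ℝ) 1, F (x, y) := by
  rw [Measure.volume_eq_prod, Omega, ← Measure.prod_restrict] at *
  exact lintegral_prod _ hF

theorem energy_grad_eq (a : ℝ) (φ : ℝ × ℝ → ℝ) : energy a (grad φ) = energy a (gradBar φ) :=
  setLIntegral_congr_fun measurableSet_Omega fun p hp => by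
    simp only [gradBar_eq_grad hp]

theorem aemeasurable_energy_density {G : ℝ × ℝ → ℝ × ℝ}
    (hG : AEStronglyMeasurable G (volume.restrict Omega)) (a : ℝ) :
    AEMeasurable (fun p => ENNReal.ofReal (((G p).1 ^ 2 + (G p).2 ^ 2) * p.2 ^ a))
      (volume.restrict Omega) := by
  have h := hG.aemeasurable
  exact ((((measurable_fst.comp_aemeasurable h).pow_const 2).add
    ((measurable_snd.comp_aemeasurable h).pow_const 2)).mul
      (measurable_snd.pow_const a).aemeasurable).ennreal_ofReal

theorem SmoothUpToBoundary.aestronglyMeasurable_gradBar (hφ : SmoothUpToBoundary φ) :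
    AEStronglyMeasurable (gradBar φ) (volume.restrict Omega) :=
  (hφ.continuousOn_gradBar.mono Omega_subset_OmegaBar).aestronglyMeasurable measurableSet_Omega

/-- The Dirichlet energy dominates the sum of the energies of the single modes, by Bessel's
inequality on horizontal lines. -/
theorem tsum_mode_energy_le (hφ : SmoothUpToBoundary φ) (a : ℝ) :
    ∑' n : ℕ, ∫⁻ y in Ioo 0 1, ENNReal.ofReal
      ((cosCoeff (fun x => (gradBar φ (x, y)).2) (n + 1) ^ 2 +
        freq (n + 1) ^ 2 * cosCoeff (fun x => φ (x, y)) (n + 1) ^ 2) * y ^ a) ≤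
      energy a (grad φ) := by
  have hg := hφ.continuousOn_gradBar
  have hg1 : ContinuousOn (fun p => (gradBar φ p).1) OmegaBar := continuous_fst.comp_continuousOn hg
  have hg2 : ContinuousOn (fun p => (gradBar φ p).2) OmegaBar := continuous_snd.comp_continuousOn hg
  rw [energy_grad_eq, energy,
    lintegral_Omega_eq (aemeasurable_energy_density hφ.aestronglyMeasurable_gradBar a),
    ← lintegral_tsum]
  · refine setLIntegral_mono' measurableSet_Ioo fun y hy => ?_
    have hyI := Ioo_subset_Icc_self hy
    have hya : 0 ≤ y ^ a := Real.rpow_nonneg hy.1.le _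
    have h1 := ContinuousOn.slice_fst hg1 hyI
    have h2 := ContinuousOn.slice_fst hg2 hyI
    have hs1 := hasSum_sq_sinCoeff h1
    have hs1' := (hasSum_nat_add_iff' 1).2 hs1
    have hs2 := hasSum_sq_cosCoeff_succ h2
    have hI : ∀ f : ℝ → ℝ, ContinuousOn f (Icc (-1) 1) → IntervalIntegrable f volume (-1) 1 :=
      fun f hf => ContinuousOn.intervalIntegrable (by rwa [uIcc_of_le (by norm_num)])
    have i1 : IntervalIntegrable (fun x => (gradBar φ (x, y)).1 ^ 2) volume (-1) 1 :=
      hI _ (h1.pow 2)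
    have i2 : IntervalIntegrable (fun x => (gradBar φ (x, y)).2 ^ 2) volume (-1) 1 :=
      hI _ (h2.pow 2)
    have hc : ContinuousOn
        (fun x => ((gradBar φ (x, y)).1 ^ 2 + (gradBar φ (x, y)).2 ^ 2) * y ^ a) (Icc (-1) 1) :=
      ((h1.pow 2).add (h2.pow 2)).mul continuousOn_const
    simp only
    rw [base, lintegral_Ioo_ofReal (by norm_num) hc (fun x _ => by positivity),
      intervalIntegral.integral_mul_const, intervalIntegral.integral_add i1 i2]
    have hsum := (hs2.add hs1').mul_right (y ^ a)
    have hnn : ∀ n : ℕ, 0 ≤ (cosCoeff (fun x => (gradBar φ (x, y)).2) (n + 1) ^ 2 +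
        sinCoeff (fun x => (gradBar φ (x, y)).1) (n + 1) ^ 2) * y ^ a := fun n => by positivity
    have e : ∀ n : ℕ, (cosCoeff (fun x => (gradBar φ (x, y)).2) (n + 1) ^ 2 +
        freq (n + 1) ^ 2 * cosCoeff (fun x => φ (x, y)) (n + 1) ^ 2) * y ^ a =
        (cosCoeff (fun x => (gradBar φ (x, y)).2) (n + 1) ^ 2 +
        sinCoeff (fun x => (gradBar φ (x, y)).1) (n + 1) ^ 2) * y ^ a := fun n => by
      rw [sinCoeff_gradBar hφ (n + 1) hy]; push_cast; ring
    simp only [e]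
    rw [← ENNReal.ofReal_tsum_of_nonneg hnn hsum.summable, hsum.tsum_eq]
    refine ENNReal.ofReal_le_ofReal (mul_le_mul_of_nonneg_right ?_ hya)
    have : 0 ≤ (∫ x in (-1:ℝ)..1, (gradBar φ (x, y)).2) ^ 2 / 2 := by positivity
    have h0 : 0 ≤ ∑ i ∈ Finset.range 1, sinCoeff (fun x => (gradBar φ (x, y)).1) i ^ 2 :=
      Finset.sum_nonneg fun i _ => sq_nonneg _
    linarith
  · intro n
    refine AEMeasurable.ennreal_ofReal (AEMeasurable.mul (AEMeasurable.add ?_ ?_) ?_)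
    · exact (((continuousOn_cosCoeff_slice hg2 (n + 1)).mono Ioo_subset_Icc_self).aemeasurable
        measurableSet_Ioo).pow_const 2
    · exact ((((continuousOn_cosCoeff_slice hφ.continuousOn (n + 1)).mono
        Ioo_subset_Icc_self).aemeasurable measurableSet_Ioo).pow_const 2).const_mul _
    · exact (measurable_id.pow_const a).aemeasurable

theorem eConst_ne_zero {s : ℝ} (hs : 1 / 2 < s) (hs1 : s < 1) : eConst s ≠ 0 := by
  have h := ofReal_le_eConst hs hs1
  have : 0 < 1 / (2 - 2 * s) - 1 / (4 - (2 - 2 * s) ^ 2) := by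
    rw [sub_pos]
    exact one_div_lt_one_div_of_lt (by linarith) (by nlinarith)
  exact (lt_of_lt_of_le (ENNReal.ofReal_pos.2 this) h).ne'

/-- The trace inequality for functions smooth up to the boundary. -/
theorem gagliardo_le_of_smooth {s : ℝ} (hs : 1 / 2 < s) (hs1 : s < 1)
    (hφ : SmoothUpToBoundary φ) :
    gagliardo s (fun x => φ (x, 0)) ≤ DConst s * energy (1 - 2 * s) (grad φ) := by
  have hs0 : 0 < s := by linarith
  have hs1' : 0 < 1 - s := by linarith
  have hg2 : ContinuousOn (fun p => (gradBar φ p).2) OmegaBar :=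
    continuous_snd.comp_continuousOn hφ.continuousOn_gradBar
  have hv : ContinuousOn (fun x => φ (x, 0)) (Icc (-1) 1) :=
    ContinuousOn.slice_fst hφ.continuousOn (left_mem_Icc.2 zero_le_one)
  have he0 : eConst s ≠ 0 := eConst_ne_zero hs hs1
  have het : eConst s ≠ ⊤ := (eConst_lt_top hs hs1).ne
  have hdiv : ∀ X : ℝ≥0∞, DConst s * (eConst s * X) = dConst s * X := fun X => by
    rw [DConst, ← mul_assoc, ENNReal.div_mul_cancel he0 het]
  have hds : dConst s * ENNReal.ofReal (s * (1 - s)) ≤ ENNReal.ofReal (2 ^ (2 - 2 * s)) := by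
    refine (mul_le_mul_left (dConst_le hs hs1) _).trans (le_of_eq ?_)
    rw [← ENNReal.ofReal_mul (by positivity)]
    congr 1
    field_simp
  set c : ℕ → ℝ := fun n => cosCoeff (fun x => φ (x, 0)) (n + 1) with hc
  set E : ℕ → ℝ≥0∞ := fun n => ∫⁻ y in Ioo 0 1, ENNReal.ofReal
      ((cosCoeff (fun x => (gradBar φ (x, y)).2) (n + 1) ^ 2 +
        freq (n + 1) ^ 2 * cosCoeff (fun x => φ (x, y)) (n + 1) ^ 2) * y ^ (1 - 2 * s)) with hE
  set X := ENNReal.ofReal (2 ^ (2 - 2 * s)) * ∑' n : ℕ, ENNReal.ofReal (c n ^ 2) with hX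
  have hXtop : X ≠ ⊤ := by
    have hS := hasSum_sq_cosCoeff_succ hv
    rw [hX, ← ENNReal.ofReal_tsum_of_nonneg (fun n => sq_nonneg _) hS.summable]
    exact ENNReal.mul_ne_top ENNReal.ofReal_ne_top ENNReal.ofReal_ne_top
  have hmode : ∀ n : ℕ, dConst s * ENNReal.ofReal (freq (n + 1) ^ (2 * s) * c n ^ 2) ≤
      DConst s * E n + ENNReal.ofReal (2 ^ (2 - 2 * s)) * ENNReal.ofReal (c n ^ 2) := by
    intro n
    have hw : 3 / 2 < freq ((n : ℝ) + 1) := by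
      have := Real.pi_gt_three
      have hn : (0:ℝ) ≤ n := by positivity
      unfold freq
      nlinarith
    have h := mode_inequality hs hs1 hw
      (f := fun y => cosCoeff (fun x => φ (x, y)) (n + 1))
      (f' := fun y => cosCoeff (fun x => (gradBar φ (x, y)).2) (n + 1))
      ((continuousOn_cosCoeff_slice hφ.continuousOn (n + 1)).mono Ico_subset_Icc_self)
      (fun t ht => hasDerivAt_cosCoeff_slice hφ (n + 1) ht)
      ((continuousOn_cosCoeff_slice hg2 (n + 1)).mono Ioo_subset_Icc_self)
    have h2 := mul_le_mul_right h (DConst s)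
    rw [mul_add, mul_left_comm, hdiv, mul_left_comm (DConst s) (ENNReal.ofReal _), hdiv] at h2
    have hwp : 0 ≤ freq ((n : ℝ) + 1) ^ (2 * s) := Real.rpow_nonneg (by linarith) _
    rw [ENNReal.ofReal_mul hwp]
    calc _ = ENNReal.ofReal (c n ^ 2) * (dConst s * ENNReal.ofReal (freq (n + 1) ^ (2 * s))) := by
          ring
      _ ≤ _ := h2
      _ ≤ _ := by
          rw [mul_comm (ENNReal.ofReal (2 ^ (2 - 2 * s)))]
          gcongr
  have hG := gagliardo_add_le hs0 hv
  -- `X` is the gain from the mirror images and bounds the total loss by truncation; it cancels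
  have hfin : gagliardo s (fun x => φ (x, 0)) + X ≤
      DConst s * energy (1 - 2 * s) (grad φ) + X := by
    calc _ ≤ dConst s * ∑' n : ℕ, ENNReal.ofReal (freq (n + 1) ^ (2 * s) * c n ^ 2) := hG
      _ = ∑' n : ℕ, dConst s * ENNReal.ofReal (freq (n + 1) ^ (2 * s) * c n ^ 2) :=
          ENNReal.tsum_mul_left.symm
      _ ≤ ∑' n : ℕ, (DConst s * E n +
            ENNReal.ofReal (2 ^ (2 - 2 * s)) * ENNReal.ofReal (c n ^ 2)) :=
          ENNReal.tsum_le_tsum hmode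
      _ = DConst s * ∑' n, E n + X := by
          rw [ENNReal.tsum_add, ENNReal.tsum_mul_left, ENNReal.tsum_mul_left]
      _ ≤ _ := by
          gcongr
          exact tsum_mode_energy_le hφ _
  exact (ENNReal.add_le_add_iff_right hXtop).1 hfin

/-- The trace estimate on `L²`. -/
theorem sqNormBase_le_of_smooth {a : ℝ} (ha : a < 0) (hφ : SmoothUpToBoundary φ) :
    sqNormBase (fun x => φ (x, 0)) ≤ 2 * (sqMass a φ + energy a (grad φ)) := by
  have hg := hφ.continuousOn_gradBar
  have hg2 : ContinuousOn (fun p => (gradBar φ p).2) OmegaBar := continuous_snd.comp_continuousOn hg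
  have hm1 : AEMeasurable (fun p : ℝ × ℝ => ENNReal.ofReal (φ p ^ 2 * p.2 ^ a))
      (volume.restrict Omega) :=
    ((((hφ.continuousOn.mono Omega_subset_OmegaBar).aemeasurable measurableSet_Omega).pow_const
      2).mul (measurable_snd.pow_const a).aemeasurable).ennreal_ofReal
  have hm2 := aemeasurable_energy_density hφ.aestronglyMeasurable_gradBar a
  have hm : AEMeasurable (fun p : ℝ × ℝ => ENNReal.ofReal (φ p ^ 2 * p.2 ^ a) +
      ENNReal.ofReal (((gradBar φ p).1 ^ 2 + (gradBar φ p).2 ^ 2) * p.2 ^ a))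
      (volume.restrict Omega) := hm1.add hm2
  rw [energy_grad_eq, sqMass, energy, ← lintegral_add_left' hm1,
    ← lintegral_const_mul'' _ hm, lintegral_Omega_eq' (hm.const_mul 2),
    sqNormBase]
  refine setLIntegral_mono' measurableSet_base fun x hx => ?_
  have hxI : x ∈ Icc (-1:ℝ) 1 := Ioo_subset_Icc_self hx
  have hs := ContinuousOn.slice_snd hφ.continuousOn hxI
  have hs2 := ContinuousOn.slice_snd hg2 hxI
  -- the factor `1 - y` removes the boundary term at `y = 1`
  have key := ofReal_sub_le_lintegral_of_deriv_le (R := 1)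
    (W := fun y => -((1 - y) * φ (x, y) ^ 2))
    (W' := fun y => -(-1 * φ (x, y) ^ 2 + (1 - y) * (2 * φ (x, y) * (gradBar φ (x, y)).2)))
    (g := fun y => 2 * (φ (x, y) ^ 2 + (gradBar φ (x, y)).2 ^ 2)) zero_le_one
    ((((by fun_prop : Continuous fun y : ℝ => 1 - y).continuousOn).mul (hs.pow 2)).neg)
    (fun y hy => ?_) ?_ (fun y _ => by positivity) (fun y hy => ?_)
  · have e : -((1 - (1:ℝ)) * φ (x, 1) ^ 2) - -((1 - 0) * φ (x, 0) ^ 2) = φ (x, 0) ^ 2 := by ring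
    simp only [e] at key
    refine key.trans (setLIntegral_mono' measurableSet_Ioo fun y hy => ?_)
    have hya : 1 ≤ y ^ a := Real.one_le_rpow_of_pos_of_le_one_of_nonpos hy.1 hy.2.le ha.le
    simp only
    rw [← ENNReal.ofReal_add (by positivity) (by positivity),
      show (2:ℝ≥0∞) = ENNReal.ofReal 2 by simp, ← ENNReal.ofReal_mul zero_le_two]
    refine ENNReal.ofReal_le_ofReal ?_
    rw [← add_mul]
    have h3 : φ (x, y) ^ 2 + (gradBar φ (x, y)).2 ^ 2 ≤
        φ (x, y) ^ 2 + ((gradBar φ (x, y)).1 ^ 2 + (gradBar φ (x, y)).2 ^ 2) := by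
      linarith [sq_nonneg (gradBar φ (x, y)).1]
    have h4 : φ (x, y) ^ 2 + ((gradBar φ (x, y)).1 ^ 2 + (gradBar φ (x, y)).2 ^ 2) ≤
        (φ (x, y) ^ 2 + ((gradBar φ (x, y)).1 ^ 2 + (gradBar φ (x, y)).2 ^ 2)) * y ^ a :=
      le_mul_of_one_le_right (by positivity) hya
    linarith
  · have h1 := hφ.hasDerivAt_snd hx hy
    have h2 := (((hasDerivAt_id y).const_sub 1).mul (h1.pow 2)).neg
    refine h2.congr_deriv ?_
    simp
  · have : ContinuousOn (fun y => 2 * (φ (x, y) ^ 2 + (gradBar φ (x, y)).2 ^ 2)) (Ioo 0 1) :=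
      (continuousOn_const.mul ((hs.pow 2).add (hs2.pow 2))).mono Ioo_subset_Icc_self
    exact this.aestronglyMeasurable measurableSet_Ioo
  · nlinarith [sq_nonneg (φ (x, y) + (1 - y) * (gradBar φ (x, y)).2), hy.1, hy.2,
      sq_nonneg (gradBar φ (x, y)).2, sq_nonneg (φ (x, y)),
      mul_nonneg (mul_nonneg hy.1.le (by linarith [hy.2] : 0 ≤ 2 - y))
        (sq_nonneg (gradBar φ (x, y)).2)]

/-! ### Passage to the closure -/

/-- Integrating a pointwise bound `f ≤ A g + B h`. -/
theorem lintegral_le_add_of_le {α : Type*} [MeasurableSpace α] {μ : Measure α} {f g h : α → ℝ}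
    {A B : ℝ} (hA : 0 ≤ A) (hB : 0 ≤ B)
    (hg : AEMeasurable (fun x => ENNReal.ofReal (g x)) μ)
    (hfgh : ∀ᵐ x ∂μ, 0 ≤ g x ∧ 0 ≤ h x ∧ f x ≤ A * g x + B * h x) :
    ∫⁻ x, ENNReal.ofReal (f x) ∂μ ≤ ENNReal.ofReal A * ∫⁻ x, ENNReal.ofReal (g x) ∂μ +
      ENNReal.ofReal B * ∫⁻ x, ENNReal.ofReal (h x) ∂μ := by
  rw [← lintegral_const_mul' _ _ ENNReal.ofReal_ne_top,
    ← lintegral_const_mul' _ _ ENNReal.ofReal_ne_top, ← lintegral_add_left' (hg.const_mul _)]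
  refine lintegral_mono_ae (hfgh.mono fun x hx => ?_)
  rw [← ENNReal.ofReal_mul hA, ← ENNReal.ofReal_mul hB,
    ← ENNReal.ofReal_add (mul_nonneg hA hx.1) (mul_nonneg hB hx.2.1)]
  exact ENNReal.ofReal_le_ofReal hx.2.2

theorem energy_add_le {ε : ℝ} (hε : 0 < ε) (a : ℝ) {F : ℝ × ℝ → ℝ × ℝ}
    (hF : AEStronglyMeasurable F (volume.restrict Omega)) (H : ℝ × ℝ → ℝ × ℝ) :
    energy a (fun p => F p + H p) ≤
      ENNReal.ofReal (1 + ε) * energy a F + ENNReal.ofReal (1 + ε⁻¹) * energy a H := by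
  refine lintegral_le_add_of_le (by positivity) (by positivity) (aemeasurable_energy_density hF a)
    (ae_restrict_of_forall_mem measurableSet_Omega fun p hp => ?_)
  have hw : 0 ≤ p.2 ^ a := Real.rpow_nonneg hp.2.1.le _
  refine ⟨by positivity, by positivity, ?_⟩
  rw [← mul_assoc, ← mul_assoc, ← add_mul]
  refine mul_le_mul_of_nonneg_right ?_ hw
  have h1 := add_sq_le hε (F p).1 (H p).1
  have h2 := add_sq_le hε (F p).2 (H p).2
  simp only [Prod.fst_add, Prod.snd_add]
  linarith

theorem sqMass_add_le (a : ℝ) {f : ℝ × ℝ → ℝ}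
    (hf : AEStronglyMeasurable f (volume.restrict Omega)) (h : ℝ × ℝ → ℝ) :
    sqMass a (fun p => f p + h p) ≤ 2 * sqMass a f + 2 * sqMass a h := by
  have h2 : (2:ℝ≥0∞) = ENNReal.ofReal 2 := by simp
  rw [h2]
  refine lintegral_le_add_of_le (by positivity) (by positivity)
    ((hf.aemeasurable.pow_const 2).mul (measurable_snd.pow_const a).aemeasurable).ennreal_ofReal
    (ae_restrict_of_forall_mem measurableSet_Omega fun p hp => ?_)
  have hw : 0 ≤ p.2 ^ a := Real.rpow_nonneg hp.2.1.le _
  refine ⟨by positivity, by positivity, ?_⟩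
  rw [← mul_assoc, ← mul_assoc, ← add_mul]
  refine mul_le_mul_of_nonneg_right ?_ hw
  nlinarith [sq_nonneg (f p - h p)]

theorem sqNormBase_add_le {f : ℝ → ℝ}
    (hf : AEStronglyMeasurable f (volume.restrict base)) (h : ℝ → ℝ) :
    sqNormBase (fun x => f x + h x) ≤ 2 * sqNormBase f + 2 * sqNormBase h := by
  have h2 : (2:ℝ≥0∞) = ENNReal.ofReal 2 := by simp
  rw [h2]
  refine lintegral_le_add_of_le (by positivity) (by positivity)
    (hf.aemeasurable.pow_const 2).ennreal_ofReal (Eventually.of_forall fun x => ?_)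
  exact ⟨sq_nonneg _, sq_nonneg _, by nlinarith [sq_nonneg (f x - h x)]⟩

theorem sqNormBase_sub_comm (f g : ℝ → ℝ) :
    sqNormBase (fun x => f x - g x) = sqNormBase (fun x => g x - f x) := by
  simp only [sqNormBase, sub_sq_comm]

theorem sqMass_sub_comm (a : ℝ) (f g : ℝ × ℝ → ℝ) :
    sqMass a (fun p => f p - g p) = sqMass a (fun p => g p - f p) := by
  simp only [sqMass, sub_sq_comm]

theorem energy_sub_comm (a : ℝ) (F G : ℝ × ℝ → ℝ × ℝ) :
    energy a (fun p => F p - G p) = energy a (fun p => G p - F p) := by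
  simp only [energy, Prod.fst_sub, Prod.snd_sub, sub_sq_comm]

theorem sqNormBase_eq_eLpNorm_sq (f : ℝ → ℝ) :
    sqNormBase f = eLpNorm f 2 (volume.restrict base) ^ 2 := by
  have h := eLpNorm_nnreal_pow_eq_lintegral (f := f) (μ := volume.restrict base)
    (p := 2) two_ne_zero
  norm_num at h
  rw [h, sqNormBase]
  refine lintegral_congr fun x => ?_
  rw [← ofReal_norm, ← ENNReal.ofReal_pow (norm_nonneg _), Real.norm_eq_abs, sq_abs]

theorem tendsto_eLpNorm_of_tendsto_sqNormBase {f : ℕ → ℝ → ℝ}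
    (h : Tendsto (fun n => sqNormBase (f n)) atTop (𝓝 0)) :
    Tendsto (fun n => eLpNorm (f n) 2 (volume.restrict base)) atTop (𝓝 0) := by
  have h' := (ENNReal.continuous_rpow_const (y := (1 / 2 : ℝ))).tendsto 0 |>.comp h
  rw [ENNReal.zero_rpow_of_pos (by norm_num)] at h'
  refine h'.congr fun n => ?_
  simp only [Function.comp]
  rw [sqNormBase_eq_eLpNorm_sq, ← ENNReal.rpow_natCast, ← ENNReal.rpow_mul]
  norm_num

variable {ψ u : ℝ × ℝ → ℝ} {G : ℝ × ℝ → ℝ × ℝ} {a : ℝ}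

theorem SmoothUpToBoundary.aestronglyMeasurable (hφ : SmoothUpToBoundary φ) :
    AEStronglyMeasurable φ (volume.restrict Omega) :=
  (hφ.continuousOn.mono Omega_subset_OmegaBar).aestronglyMeasurable measurableSet_Omega

theorem SmoothUpToBoundary.aestronglyMeasurable_grad (hφ : SmoothUpToBoundary φ) :
    AEStronglyMeasurable (grad φ) (volume.restrict Omega) :=
  hφ.aestronglyMeasurable_gradBar.congr
    (ae_restrict_of_forall_mem measurableSet_Omega fun _ hp => gradBar_eq_grad hp)

theorem SmoothUpToBoundary.continuousOn_bottom (hφ : SmoothUpToBoundary φ) :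
    ContinuousOn (fun x => φ (x, 0)) (Icc (-1) 1) :=
  ContinuousOn.slice_fst hφ.continuousOn (left_mem_Icc.2 zero_le_one)

theorem SmoothUpToBoundary.aestronglyMeasurable_bottom (hφ : SmoothUpToBoundary φ) :
    AEStronglyMeasurable (fun x => φ (x, 0)) (volume.restrict base) :=
  (hφ.continuousOn_bottom.mono Ioo_subset_Icc_self).aestronglyMeasurable measurableSet_base

theorem SmoothUpToBoundary.memLp_bottom (hφ : SmoothUpToBoundary φ) :
    MemLp (fun x => φ (x, 0)) 2 (volume.restrict base) := by
  obtain ⟨C, hC⟩ := isCompact_Icc.exists_bound_of_continuousOn hφ.continuousOn_bottom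
  have : IsFiniteMeasure (volume.restrict base) := ⟨by simp [base]⟩
  exact MemLp.of_bound hφ.aestronglyMeasurable_bottom C
    (ae_restrict_of_forall_mem measurableSet_base fun x hx => hC x (Ioo_subset_Icc_self hx))

theorem grad_sub (hφ : SmoothUpToBoundary φ) (hψ : SmoothUpToBoundary ψ) {p : ℝ × ℝ}
    (hp : p ∈ Omega) : grad (fun q => φ q - ψ q) p = grad φ p - grad ψ p := by
  simp [grad, fderiv_fun_sub (hφ.differentiableAt hp) (hψ.differentiableAt hp)]

/-- The restriction to the bottom side is continuous from `W^{1,2}(Ω, y^a)` to `L²`, in the form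
that is used for Cauchy sequences. -/
theorem sqNormBase_sub_le (ha : a < 0) (hφ : SmoothUpToBoundary φ) (hψ : SmoothUpToBoundary ψ)
    (hu : AEStronglyMeasurable u (volume.restrict Omega))
    (hG : AEStronglyMeasurable G (volume.restrict Omega)) :
    sqNormBase (fun x => φ (x, 0) - ψ (x, 0)) ≤
      4 * ((sqMass a (fun p => φ p - u p) + energy a (fun p => grad φ p - G p)) +
        (sqMass a (fun p => ψ p - u p) + energy a (fun p => grad ψ p - G p))) := by
  have hsub : SmoothUpToBoundary (fun p => φ p - ψ p) := ContDiffOn.sub hφ hψ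
  have h := sqNormBase_le_of_smooth ha hsub
  have h1 : sqMass a (fun p => φ p - ψ p) ≤
      2 * sqMass a (fun p => φ p - u p) + 2 * sqMass a (fun p => ψ p - u p) := by
    rw [sqMass_sub_comm a ψ u]
    have := sqMass_add_le a (hφ.aestronglyMeasurable.sub hu) (fun p => u p - ψ p)
    simp only [Pi.sub_apply, sub_add_sub_cancel] at this
    exact this
  have h2 : energy a (grad fun p => φ p - ψ p) ≤
      2 * energy a (fun p => grad φ p - G p) + 2 * energy a (fun p => grad ψ p - G p) := by
    rw [energy_sub_comm a (grad ψ) G]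
    have := energy_add_le one_pos a (hφ.aestronglyMeasurable_grad.sub hG) (fun p => G p - grad ψ p)
    norm_num at this
    refine le_trans (le_of_eq ?_) this
    exact setLIntegral_congr_fun measurableSet_Omega fun p hp => by
      simp only [grad_sub hφ hψ hp, Prod.fst_sub, Prod.snd_sub]
  calc _ ≤ _ := h
    _ ≤ 2 * ((2 * sqMass a (fun p => φ p - u p) + 2 * sqMass a (fun p => ψ p - u p)) +
        (2 * energy a (fun p => grad φ p - G p) + 2 * energy a (fun p => grad ψ p - G p))) := by
      gcongr
    _ = _ := by ring

/-- Restrictions of an approximating sequence converge in `L²`, by completeness. -/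
theorem exists_limit_bottom (ha : a < 0) {φ : ℕ → ℝ × ℝ → ℝ} (hφ : ∀ n, SmoothUpToBoundary (φ n))
    (hu : AEStronglyMeasurable u (volume.restrict Omega))
    (hG : AEStronglyMeasurable G (volume.restrict Omega)) (hc : ConvergesInW a φ u G) :
    ∃ v : ℝ → ℝ, AEStronglyMeasurable v (volume.restrict base) ∧
      Tendsto (fun n => sqNormBase (fun x => φ n (x, 0) - v x)) atTop (𝓝 0) := by
  have hcau : CauchySeq fun n => (hφ n).memLp_bottom.toLp := by
    rw [EMetric.cauchySeq_iff']
    intro ε hε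
    have hε8 : 0 < ε ^ 2 / 8 := ENNReal.div_pos (pow_ne_zero 2 hε.ne') (by simp)
    obtain ⟨N, hN⟩ := eventually_atTop.1 (hc.eventually (gt_mem_nhds hε8))
    refine ⟨N, fun n hn => ?_⟩
    rw [Lp.edist_toLp_toLp]
    refine lt_of_pow_lt_pow_left' 2 ?_
    have h := sqNormBase_sub_le ha (hφ n) (hφ N) hu hG
    rw [sqNormBase_eq_eLpNorm_sq] at h
    refine h.trans_lt ?_
    have e : ε ^ 2 = 4 * (ε ^ 2 / 8 + ε ^ 2 / 8) := by
      rw [← two_mul, ← mul_assoc, show (4:ℝ≥0∞) * 2 = 8 by norm_num,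
        ENNReal.mul_div_cancel (by norm_num) (by norm_num)]
    rw [e]
    exact (ENNReal.mul_lt_mul_iff_right (by norm_num) (by norm_num)).2
      (ENNReal.add_lt_add (hN n hn) (hN N le_rfl))
  obtain ⟨w, hw⟩ := cauchySeq_tendsto_of_complete hcau
  refine ⟨w, (Lp.aestronglyMeasurable w), ?_⟩
  have hw' := (Lp.tendsto_Lp_iff_tendsto_eLpNorm' _ _).1 hw
  have h2 := ((ENNReal.continuous_pow 2).tendsto 0).comp hw'
  rw [zero_pow two_ne_zero] at h2
  refine h2.congr fun n => ?_
  rw [sqNormBase_eq_eLpNorm_sq]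
  exact congrArg (· ^ 2)
    (eLpNorm_congr_ae ((hφ n).memLp_bottom.coeFn_toLp.sub EventuallyEq.rfl))

/-- The `L²` limit along one approximating sequence is the limit along every other one. -/
theorem exists_isTrace (ha : a < 0) (hu : MemW a u G) : ∃ v, IsTrace a u G v := by
  obtain ⟨φ, hφ, hc⟩ := hu.approx
  have hum := hu.aestronglyMeasurable
  have hGm := hu.aestronglyMeasurable_grad
  obtain ⟨v, hv, hlim⟩ := exists_limit_bottom ha hφ hum hGm hc
  refine ⟨v, hv, fun ψ hψ hψc => ?_⟩
  have hb : ∀ n, sqNormBase (fun x => ψ n (x, 0) - v x) ≤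
      2 * (4 * ((sqMass a (fun p => ψ n p - u p) + energy a (fun p => grad (ψ n) p - G p)) +
        (sqMass a (fun p => φ n p - u p) + energy a (fun p => grad (φ n) p - G p)))) +
      2 * sqNormBase (fun x => φ n (x, 0) - v x) := fun n => by
    have h := sqNormBase_add_le
      ((hψ n).aestronglyMeasurable_bottom.sub (hφ n).aestronglyMeasurable_bottom)
      (fun x => φ n (x, 0) - v x)
    simp only [Pi.sub_apply, sub_add_sub_cancel] at h
    refine h.trans ?_
    gcongr
    exact sqNormBase_sub_le ha (hψ n) (hφ n) hum hGm
  have h1 : Tendsto (fun n => 2 * (4 * ((sqMass a (fun p => ψ n p - u p) +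
        energy a (fun p => grad (ψ n) p - G p)) +
        (sqMass a (fun p => φ n p - u p) + energy a (fun p => grad (φ n) p - G p)))) +
      2 * sqNormBase (fun x => φ n (x, 0) - v x)) atTop (𝓝 (2 * (4 * (0 + 0)) + 2 * 0)) :=
    (ENNReal.Tendsto.const_mul (ENNReal.Tendsto.const_mul (hψc.add hc) (by simp))
      (by simp)).add (ENNReal.Tendsto.const_mul hlim (by simp))
  simp only [add_zero, mul_zero] at h1
  exact tendsto_of_tendsto_of_tendsto_of_le_of_le tendsto_const_nhds h1 (fun _ => zero_le) hb

theorem IsTrace.ae_eq (hu : MemW a u G) {v w : ℝ → ℝ} (hv : IsTrace a u G v)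
    (hw : IsTrace a u G w) : v =ᵐ[volume.restrict base] w := by
  obtain ⟨φ, hφ, hc⟩ := hu.approx
  have h1 := hv.2 φ hφ hc
  have h2 := hw.2 φ hφ hc
  have hb : ∀ n, sqNormBase (fun x => v x - w x) ≤ 2 * sqNormBase (fun x => φ n (x, 0) - v x) +
      2 * sqNormBase (fun x => φ n (x, 0) - w x) := fun n => by
    have h := sqNormBase_add_le (hv.1.sub (hφ n).aestronglyMeasurable_bottom)
      (fun x => φ n (x, 0) - w x)
    simp only [Pi.sub_apply, sub_add_sub_cancel] at h
    rwa [sqNormBase_sub_comm _ v]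
  have h0 : Tendsto (fun n => 2 * sqNormBase (fun x => φ n (x, 0) - v x) +
      2 * sqNormBase (fun x => φ n (x, 0) - w x)) atTop (𝓝 (2 * 0 + 2 * 0)) :=
    (ENNReal.Tendsto.const_mul h1 (by simp)).add (ENNReal.Tendsto.const_mul h2 (by simp))
  simp only [add_zero, mul_zero] at h0
  have hz : sqNormBase (fun x => v x - w x) = 0 := nonpos_iff_eq_zero.1 (ge_of_tendsto' h0 hb)
  rw [sqNormBase_eq_eLpNorm_sq, sq_eq_zero_iff] at hz
  filter_upwards [(eLpNorm_eq_zero_iff (hv.1.sub hw.1) two_ne_zero).1 hz] with x hx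
  exact sub_eq_zero.1 hx

theorem IsTrace.sqNormBase_lt_top (hu : MemW a u G) {v : ℝ → ℝ} (hv : IsTrace a u G v) :
    sqNormBase v < ⊤ := by
  obtain ⟨φ, hφ, hc⟩ := hu.approx
  obtain ⟨n, hn⟩ := ((hv.2 φ hφ hc).eventually (gt_mem_nhds ENNReal.zero_lt_top)).exists
  have h := sqNormBase_add_le (hφ n).aestronglyMeasurable_bottom (fun x => v x - φ n (x, 0))
  simp only [add_sub_cancel] at h
  refine h.trans_lt (ENNReal.add_lt_top.2 ⟨ENNReal.mul_lt_top (by simp) ?_,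
    ENNReal.mul_lt_top (by simp) ?_⟩)
  · rw [sqNormBase_eq_eLpNorm_sq]
    exact ENNReal.pow_lt_top (hφ n).memLp_bottom.eLpNorm_lt_top
  · rwa [sqNormBase_sub_comm]

/-- Lower semicontinuity of the Gagliardo seminorm along `L²` convergence, by Fatou's lemma on an
almost everywhere convergent subsequence. -/
theorem gagliardo_le_of_tendsto {s : ℝ} {f : ℕ → ℝ → ℝ} {v : ℝ → ℝ} {B : ℕ → ℝ≥0∞} {L : ℝ≥0∞}
    (hf : ∀ n, AEStronglyMeasurable (f n) (volume.restrict base))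
    (hv : AEStronglyMeasurable v (volume.restrict base))
    (hlim : Tendsto (fun n => sqNormBase (fun x => f n x - v x)) atTop (𝓝 0))
    (hB : ∀ n, gagliardo s (f n) ≤ B n) (hL : Tendsto B atTop (𝓝 L)) :
    gagliardo s v ≤ L := by
  obtain ⟨ns, hns, hae⟩ := (tendstoInMeasure_of_tendsto_eLpNorm two_ne_zero hf hv
    (tendsto_eLpNorm_of_tendsto_sqNormBase hlim)).exists_seq_tendsto_ae
  have hμ : (volume : Measure (ℝ × ℝ)).restrict (base ×ˢ base) =
      (volume.restrict base).prod (volume.restrict base) := by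
    rw [Measure.volume_eq_prod, Measure.prod_restrict]
  have hq1 := Measure.quasiMeasurePreserving_fst (μ := volume.restrict base)
    (ν := volume.restrict base)
  have hq2 := Measure.quasiMeasurePreserving_snd (μ := volume.restrict base)
    (ν := volume.restrict base)
  have hm : ∀ n, AEMeasurable (fun q : ℝ × ℝ =>
      ENNReal.ofReal ((f n q.1 - f n q.2) ^ 2 / |q.1 - q.2| ^ (1 + 2 * s)))
      ((volume.restrict base).prod (volume.restrict base)) := fun n => by
    have h1 := ((hf n).comp_quasiMeasurePreserving hq1).aemeasurable
    have h2 := ((hf n).comp_quasiMeasurePreserving hq2).aemeasurable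
    have h3 : Measurable fun q : ℝ × ℝ => |q.1 - q.2| ^ (1 + 2 * s) := by fun_prop
    exact (((h1.sub h2).pow_const 2).div h3.aemeasurable).ennreal_ofReal
  calc gagliardo s v = ∫⁻ q, liminf (fun i =>
          ENNReal.ofReal ((f (ns i) q.1 - f (ns i) q.2) ^ 2 / |q.1 - q.2| ^ (1 + 2 * s))) atTop
          ∂((volume.restrict base).prod (volume.restrict base)) := by
        rw [gagliardo, hμ]
        refine lintegral_congr_ae ?_
        filter_upwards [hq1.ae hae, hq2.ae hae] with q h1 h2
        exact (Tendsto.liminf_eq (ENNReal.tendsto_ofReal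
          (((h1.sub h2).pow 2).div_const _))).symm
    _ ≤ liminf (fun i => gagliardo s (f (ns i))) atTop := by
        simp only [gagliardo, hμ]
        exact lintegral_liminf_le' fun i => hm (ns i)
    _ ≤ liminf (fun i => B (ns i)) atTop := liminf_le_liminf (Eventually.of_forall fun i => hB _)
    _ = L := (hL.comp hns.tendsto_atTop).liminf_eq

theorem DConst_ne_top {s : ℝ} (hs : 1 / 2 < s) (hs1 : s < 1) : DConst s ≠ ⊤ :=
  ENNReal.div_ne_top ((dConst_le hs hs1).trans_lt ENNReal.ofReal_lt_top).ne (eConst_ne_zero hs hs1)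

theorem IsTrace.gagliardo_le {s : ℝ} (hs : 1 / 2 < s) (hs1 : s < 1) (hu : MemW (1 - 2 * s) u G)
    {v : ℝ → ℝ} (hv : IsTrace (1 - 2 * s) u G v) :
    gagliardo s v ≤ DConst s * energy (1 - 2 * s) G := by
  obtain ⟨φ, hφ, hc⟩ := hu.approx
  have hGm := hu.aestronglyMeasurable_grad
  have hD := DConst_ne_top hs hs1
  have hc2 : Tendsto (fun n => energy (1 - 2 * s) (fun p => grad (φ n) p - G p)) atTop (𝓝 0) :=
    tendsto_of_tendsto_of_tendsto_of_le_of_le tendsto_const_nhds hc (fun _ => zero_le)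
      fun n => le_add_self
  -- the factor `1 + ε` avoids subadditivity of the norm; then `ε → 0`
  have key : ∀ ε : ℝ, 0 < ε →
      gagliardo s v ≤ DConst s * (ENNReal.ofReal (1 + ε) * energy (1 - 2 * s) G) := by
    intro ε hε
    refine gagliardo_le_of_tendsto (fun n => (hφ n).aestronglyMeasurable_bottom) hv.1
      (hv.2 φ hφ hc) (B := fun n => DConst s * (ENNReal.ofReal (1 + ε) * energy (1 - 2 * s) G +
        ENNReal.ofReal (1 + ε⁻¹) * energy (1 - 2 * s) (fun p => grad (φ n) p - G p)))
      (fun n => (gagliardo_le_of_smooth hs hs1 (hφ n)).trans ?_) ?_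
    · gcongr
      have h := energy_add_le hε (1 - 2 * s) hGm (fun p => grad (φ n) p - G p)
      simpa only [add_sub_cancel] using h
    · refine ENNReal.Tendsto.const_mul ?_ (Or.inr hD)
      have := (tendsto_const_nhds (x := ENNReal.ofReal (1 + ε) * energy (1 - 2 * s) G)).add
        (ENNReal.Tendsto.const_mul hc2 (Or.inr (ENNReal.ofReal_ne_top (r := 1 + ε⁻¹))))
      simpa using this
  have hlim : Tendsto (fun ε : ℝ => DConst s * (ENNReal.ofReal (1 + ε) * energy (1 - 2 * s) G))
      (𝓝[>] 0) (𝓝 (DConst s * (ENNReal.ofReal (1 + 0) * energy (1 - 2 * s) G))) := by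
    refine ENNReal.Tendsto.const_mul (ENNReal.Tendsto.mul_const ?_ (Or.inr hu.energy_lt_top.ne))
      (Or.inr hD)
    exact (ENNReal.continuous_ofReal.tendsto _).comp
      (((continuous_const.add continuous_id).tendsto (0:ℝ)).mono_left nhdsWithin_le_nhds)
  simp only [add_zero, ENNReal.ofReal_one, one_mul] at hlim
  exact ge_of_tendsto hlim (eventually_of_mem self_mem_nhdsWithin key)

end Rectangle

end TraceIneq

end

theorem theorem5p6 (a s : ℝ) (ha : -1 < a) (ha' : a < 0) (hs : s = (1 - a) / 2)
    (u : ℝ × ℝ → ℝ) (G : ℝ × ℝ → ℝ × ℝ) (hu : TraceIneq.MemW a u G) :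
    (∃ v : ℝ → ℝ, TraceIneq.IsTrace a u G v) ∧
    (∀ v w : ℝ → ℝ, TraceIneq.IsTrace a u G v → TraceIneq.IsTrace a u G w →
      v =ᵐ[volume.restrict TraceIneq.base] w) ∧
    (∀ v : ℝ → ℝ, TraceIneq.IsTrace a u G v →
      TraceIneq.MemHs s v ∧
      TraceIneq.gagliardo s v ≤ TraceIneq.DConst s * TraceIneq.energy a G) := by
  have hs0 : 1 / 2 < s := by linarith
  have hs1 : s < 1 := by linarith
  obtain rfl : a = 1 - 2 * s := by linarith
  refine ⟨TraceIneq.exists_isTrace ha' hu, fun v w hv hw => hv.ae_eq hu hw, fun v hv => ?_⟩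
  have hle := hv.gagliardo_le hs0 hs1 hu
  exact ⟨⟨hv.1, ENNReal.add_lt_top.2 ⟨hv.sqNormBase_lt_top hu, hle.trans_lt
    (ENNReal.mul_lt_top (TraceIneq.DConst_ne_top hs0 hs1).lt_top hu.energy_lt_top)⟩⟩, hle⟩
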